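/- Let $S$ be a locally noetherian scheme and $r\ge 0$ an integer. A geometric datum of rank $r$ over $S$ is a tuple $(C,\pi,S,P,\rho,\mathcal F,\Phi)$ consisting of * a scheme $C$, a locally projective morphism $\pi:C\to S$, and a section $P\subset C$ of $\pi$ which is an effective Cartier divisor such that $\mathcal O_C(P)$ is ample relative to $\pi$; with $\mathcal I\subset\mathcal O_C$ the ideal sheaf of $P$, the conormal sheaf $\mathcal I/\mathcal I^2$ is a free $\mathcal O_P$-module of rank $1$, and $\bigcap_{n\ge 0}\pi_*\mathcal O_C(-nP)=0$; * an isomorphism $\rho:\widehat{\mathcal O}_C\to\mathcal O_P[[z]]$ of sheaves of topological $\mathcal O_P$-algebras, where $\widehat{\mathcal O}_C=\varprojlim_n\mathcal O_C/\mathcal I^n$ is an $\mathcal O_P$-algebra through $\pi$ and $P\cong S$, the topologies being the $\mathcal I$-adic one and the $z$-adic one; * a coherent sheaf $\mathcal F$ on $C$ with $\bigcap_{n\ge 0}\pi_*\mathcal F(-nP)=0$ (where $\mathcal F(-nP)$ is understood as $\mathcal I^n\mathcal F\subset\mathcal F$), and an isomorphism $\Phi:\widehat{\mathcal F}\to\widehat{\mathcal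 O}_C^{\oplus r}$ of $\widehat{\mathcal O}_C$-modules, where $\widehat{\mathcal F}=\varprojlim_n\mathcal F/\mathcal I^n\mathcal F$. A local section of $\mathcal O_C$ (respectively $\mathcal F$) outside $P$ can be written near $P$ as $a/b$ with $b$ a local generator of $\mathcal I^n$ for some $n\ge 0$ and $a$ a local section of $\mathcal O_C$ (respectively $\mathcal F$) across $P$; sending it to $\rho(a)/\rho(b)$ (respectively $\rho(\Phi(a))/\rho(b)$), one obtains maps $\pi_*(\rho)$ and $\pi_*(\rho\circ\Phi)$ to Laurent series. The Schur pair $(\mathcal A,\mathcal W)$ of the datum is given, for $U\subset S$ affine open, by $$\mathcal A(U)=\pi_*(\rho)\bigl(H^0(\pi^{-1}(U)\setminus P,\mathcal O_C)\bigr)\subset\mathcal O_S(U)((z)),\qquad \mathcal W(U)=\pi_*(\rho\circ\Phi)\bigl(H^0(\pi^{-1}(U)\setminus P,\mathcal F)\bigr)\subset\mathcal O_S(U)((z))^{\oplus r}.$$ Then for every geometric datum of rank $r$ over $S$ there are isomorphisms of sheaves of $\mathcal O_S$-modules $$\frac{\mathcal O_S((z))}{\mathcal A+\mathcal O_S[[z]]}\;\cong\;R^1\pi_*\mathcal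 O_C\qquad\text{and}\qquad\frac{\mathcal O_S((z))^{\oplus r}}{\mathcal W+\mathcal O_S[[z]]^{\oplus r}}\;\cong\;R^1\pi_*\mathcal F,$$ where the left-hand sides are the sheaves associated with the presheaves of quotients. -/

import Mathlib

open CategoryTheory Limits AlgebraicGeometry TopologicalSpace Opposite

universe u

namespace Krichever

noncomputable section

/-! ### Higher direct images

The category of sheaves of modules on a scheme is a Grothendieck abelian category, hence has
enough injectives, and `Rⁿf_*` is the `n`-th right derived functor of `f_*`. -/

section Injectives

variable {T : Type u} [SmallCategory T] {J : GrothendieckTopology T} (R : Sheaf J RingCat.{u})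

instance presheafOfModules_ab5 (R : Tᵒᵖ ⥤ RingCat.{u}) :
    AB5OfSize.{u, u} (PresheafOfModules.{u} R) where
  ofShape K _ _ := HasExactColimitsOfShape.domain_of_functor K (PresheafOfModules.toPresheaf R)

instance sheafOfModules_ab5 : AB5OfSize.{u, u} (SheafOfModules.{u} R) where
  ofShape K _ _ :=
    (PresheafOfModules.sheafificationAdjunction (𝟙 R.obj)).hasExactColimitsOfShape K

lemma isSeparating_sheafify : ObjectProperty.IsSeparating (.ofObj (fun U : T =>
    (PresheafOfModules.sheafification (𝟙 R.obj)).obj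
      ((PresheafOfModules.free R.obj).obj (yoneda.obj U)))) := by
  intro M N f g h
  refine (SheafOfModules.forget R).map_injective
    (PresheafOfModules.freeYoneda.isSeparating R.obj _ _ ?_)
  rintro _ ⟨U⟩ k
  let adj := PresheafOfModules.sheafificationAdjunction (𝟙 R.obj)
  have := h _ (ObjectProperty.ofObj_apply _ U) ((adj.homEquiv _ _).symm k)
  exact (adj.homEquiv _ _).symm.injective
    ((adj.homEquiv_naturality_right_symm k f).trans
      (this.trans (adj.homEquiv_naturality_right_symm k g).symm))

instance sheafOfModules_hasSeparator : HasSeparator (SheafOfModules.{u} R) where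
  hasSeparator := ⟨_, (isSeparating_sheafify R).isSeparator_coproduct⟩

instance sheafOfModules_isGrothendieckAbelian :
    IsGrothendieckAbelian.{u} (SheafOfModules.{u} R) where

instance modules_isGrothendieckAbelian (X : Scheme.{u}) : IsGrothendieckAbelian.{u} X.Modules :=
  inferInstanceAs (IsGrothendieckAbelian.{u} (SheafOfModules.{u} X.ringCatSheaf))

end Injectives

/-- The higher direct image functor `Rⁿf_* : Mod(𝒪_X) ⥤ Mod(𝒪_Y)`. -/
def higherDirectImage {X Y : Scheme.{u}} (f : X ⟶ Y) (n : ℕ) : X.Modules ⥤ Y.Modules :=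
  (Scheme.Modules.pushforward f).rightDerived n

/-- The structure sheaf as a sheaf of modules over itself. -/
def structureModule (X : Scheme.{u}) : X.Modules := SheafOfModules.unit X.ringCatSheaf

/-! ### Restriction of sections -/

section Restriction

variable {X : Scheme.{u}}

/-- Restriction of functions. -/
def res {V W : X.Opens} (h : V ≤ W) : Γ(X, W) →+* Γ(X, V) := (X.presheaf.map (homOfLE h).op).hom

/-- Restriction of sections of a sheaf of modules. -/
def resM (M : X.Modules) {V W : X.Opens} (h : V ≤ W) : Γ(M, W) →+ Γ(M, V) :=
  (M.presheaf.map (homOfLE h).op).hom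

lemma res_res {V W Z : X.Opens} (h : V ≤ W) (h' : W ≤ Z) (a : Γ(X, Z)) :
    res h (res h' a) = res (h.trans h') a := by
  simp only [res, ← CommRingCat.comp_apply, ← Functor.map_comp]
  rfl

lemma res_self {V : X.Opens} (a : Γ(X, V)) : res le_rfl a = a :=
  congrArg (fun f => f.hom a) (X.presheaf.map_id (op V))

lemma resM_self (M : X.Modules) {V : X.Opens} (a : Γ(M, V)) : resM M le_rfl a = a :=
  congrArg (fun f => f.hom a) (M.presheaf.map_id (op V))

lemma resM_resM (M : X.Modules) {V W Z : X.Opens} (h : V ≤ W) (h' : W ≤ Z) (a : Γ(M, Z)) :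
    resM M h (resM M h' a) = resM M (h.trans h') a := by
  simp only [resM, ← AddCommGrpCat.comp_apply, ← Functor.map_comp]
  rfl

lemma resM_smul (M : X.Modules) {V W : X.Opens} (h : V ≤ W) (a : Γ(X, W)) (m : Γ(M, W)) :
    resM M h (a • m) = res h a • resM M h m :=
  M.map_smul (homOfLE h) a m

end Restriction

/-! ### Formal completion along a closed subscheme -/

section Completion

variable {X : Scheme.{u}} (I : X.IdealSheafData)

/-- The affine open subsets of an open subset `W`. -/
abbrev AffIn (W : X.Opens) : Type u := {V : X.affineOpens // V.1 ≤ W}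

/-- Sections over `W` of the completion `lim 𝒪_X/Iⁿ`: compatible families of elements of
the `I(V)`-adic completions of `𝒪_X(V)`, for `V` affine open in `W`. -/
def completionRing (W : X.Opens) :
    Subring (∀ V : AffIn W, AdicCompletion (I.ideal V.1) Γ(X, V.1.1)) where
  carrier := {x | ∀ (V V' : AffIn W) (h : V'.1.1 ≤ V.1.1) (n : ℕ), ∃ a : Γ(X, V.1.1),
    (x V).val n = Submodule.Quotient.mk a ∧ (x V').val n = Submodule.Quotient.mk (res h a)}
  mul_mem' {x y} hx hy V V' h n := by
    obtain ⟨a, ha, ha'⟩ := hx V V' h n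
    obtain ⟨b, hb, hb'⟩ := hy V V' h n
    refine ⟨a * b, ?_, ?_⟩
    · rw [Pi.mul_apply, AdicCompletion.val_mul, ha, hb]; rfl
    · rw [Pi.mul_apply, AdicCompletion.val_mul, ha', hb', map_mul]; rfl
  one_mem' V V' h n := ⟨1, rfl, by rw [map_one]; rfl⟩
  add_mem' {x y} hx hy V V' h n := by
    obtain ⟨a, ha, ha'⟩ := hx V V' h n
    obtain ⟨b, hb, hb'⟩ := hy V V' h n
    refine ⟨a + b, ?_, ?_⟩
    · rw [Pi.add_apply, AdicCompletion.val_add_apply, ha, hb]; rfl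
    · rw [Pi.add_apply, AdicCompletion.val_add_apply, ha', hb', map_add]; rfl
  zero_mem' V V' h n := ⟨0, rfl, by rw [map_zero]; rfl⟩
  neg_mem' {x} hx V V' h n := by
    obtain ⟨a, ha, ha'⟩ := hx V V' h n
    refine ⟨-a, ?_, ?_⟩
    · rw [Pi.neg_apply, AdicCompletion.val_neg_apply, ha]; rfl
    · rw [Pi.neg_apply, AdicCompletion.val_neg_apply, ha', map_neg]; rfl

/-- Sections over `W` of the completion `lim M/IⁿM` of a quasi-coherent sheaf `M`: compatible
families of elements of the `I(V)`-adic completions of `M(V)`, for `V` affine open in `W`. -/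
def completionModule (M : X.Modules) (W : X.Opens) :
    Submodule (completionRing I W) (∀ V : AffIn W, AdicCompletion (I.ideal V.1) Γ(M, V.1.1)) where
  carrier := {x | ∀ (V V' : AffIn W) (h : V'.1.1 ≤ V.1.1) (n : ℕ), ∃ a : Γ(M, V.1.1),
    (x V).val n = Submodule.Quotient.mk a ∧ (x V').val n = Submodule.Quotient.mk (resM M h a)}
  add_mem' {x y} hx hy V V' h n := by
    obtain ⟨a, ha, ha'⟩ := hx V V' h n
    obtain ⟨b, hb, hb'⟩ := hy V V' h n
    refine ⟨a + b, ?_, ?_⟩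
    · rw [Pi.add_apply, AdicCompletion.val_add_apply, ha, hb]; rfl
    · rw [Pi.add_apply, AdicCompletion.val_add_apply, ha', hb', map_add]; rfl
  zero_mem' V V' h n := ⟨0, rfl, by rw [map_zero]; rfl⟩
  smul_mem' c x hx V V' h n := by
    obtain ⟨a, ha, ha'⟩ := c.2 V V' h n
    obtain ⟨b, hb, hb'⟩ := hx V V' h n
    refine ⟨a • b, ?_, ?_⟩
    · change (c.1 V • x V).val n = _
      rw [AdicCompletion.smul_eval, ha, hb]; rfl
    · change (c.1 V' • x V').val n = _
      rw [AdicCompletion.smul_eval, ha', hb', resM_smul]; rfl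

instance completionModule_module (M : X.Modules) (W : X.Opens) :
    Module (completionRing I W) (completionModule I M W) :=
  Submodule.module _

instance completionModule_smul (M : X.Modules) (W : X.Opens) :
    SMul (completionRing I W) (completionModule I M W) :=
  (completionModule_module I M W).toSMul

/-- Restriction of sections of the completed structure sheaf. -/
def completionRes {W' W : X.Opens} (h : W' ≤ W) : completionRing I W →+* completionRing I W' where
  toFun x := ⟨fun V => x.1 ⟨V.1, V.2.trans h⟩, fun V V' h' n =>
    x.2 ⟨V.1, V.2.trans h⟩ ⟨V'.1, V'.2.trans h⟩ h' n⟩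
  map_one' := rfl
  map_mul' _ _ := rfl
  map_zero' := rfl
  map_add' _ _ := rfl

/-- Restriction of sections of the completion of a sheaf of modules. -/
def completionResM (M : X.Modules) {W' W : X.Opens} (h : W' ≤ W) :
    completionModule I M W →+ completionModule I M W' where
  toFun x := ⟨fun V => x.1 ⟨V.1, V.2.trans h⟩, fun V V' h' n =>
    x.2 ⟨V.1, V.2.trans h⟩ ⟨V'.1, V'.2.trans h⟩ h' n⟩
  map_zero' := rfl
  map_add' _ _ := rfl

/-- The canonical map from `𝒪_X` to its completion. -/
def toCompletion (W : X.Opens) : Γ(X, W) →+* completionRing I W where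
  toFun a := ⟨fun V => algebraMap Γ(X, V.1.1) _ (res V.2 a), fun V V' h n =>
    ⟨res V.2 a, rfl, by rw [res_res]; rfl⟩⟩
  map_one' := by ext V : 2; simp
  map_mul' _ _ := by ext V : 2; simp
  map_zero' := by ext V : 2; simp
  map_add' _ _ := by ext V : 2; simp

/-- The canonical map from a sheaf of modules to its completion. -/
def toCompletionM (M : X.Modules) (W : X.Opens) : Γ(M, W) →+ completionModule I M W where
  toFun a := ⟨fun V => AdicCompletion.of _ _ (resM M V.2 a), fun V V' h n =>
    ⟨resM M V.2 a, rfl, by rw [resM_resM]; rfl⟩⟩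
  map_zero' := by ext V : 2; simp
  map_add' _ _ := by ext V : 2; simp

lemma completionRes_toCompletion {W' W : X.Opens} (h : W' ≤ W) (a : Γ(X, W)) :
    completionRes I h (toCompletion I W a) = toCompletion I W' (res h a) := by
  apply Subtype.ext
  funext V
  change algebraMap Γ(X, V.1.1) _ (res _ a) = algebraMap Γ(X, V.1.1) _ (res _ (res h a))
  rw [res_res]

lemma completionResM_toCompletionM (M : X.Modules) {W' W : X.Opens} (h : W' ≤ W) (a : Γ(M, W)) :
    completionResM I M h (toCompletionM I M W a) = toCompletionM I M W' (resM M h a) := by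
  apply Subtype.ext
  funext V
  change AdicCompletion.of _ _ (resM M _ a) = AdicCompletion.of _ _ (resM M _ (resM M h a))
  rw [resM_resM]

lemma toCompletionM_smul (M : X.Modules) (W : X.Opens) (c : Γ(X, W)) (a : Γ(M, W)) :
    toCompletionM I M W (c • a) = toCompletion I W c • toCompletionM I M W a := by
  apply Subtype.ext
  funext V
  change AdicCompletion.of (I.ideal V.1) Γ(M, V.1.1) (resM M V.2 (c • a)) =
    algebraMap Γ(X, V.1.1) (AdicCompletion (I.ideal V.1) Γ(X, V.1.1)) (res V.2 c) •
      AdicCompletion.of (I.ideal V.1) Γ(M, V.1.1) (resM M V.2 a)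
  rw [resM_smul, map_smul]
  apply AdicCompletion.ext
  intro n
  rw [AdicCompletion.smul_eval]
  rfl

end Completion

/-! ### Laurent series -/

section Laurent

/-- The ring homomorphism `A((z)) → B((z))` induced by `A → B` on coefficients. -/
def laurentMap {A B : Type u} [CommRing A] [CommRing B] (f : A →+* B) :
    LaurentSeries A →+* LaurentSeries B where
  toFun g := HahnSeries.map g f
  map_one' := HahnSeries.map_one f.toMonoidWithZeroHom
  map_mul' _ _ := HahnSeries.map_mul (f : A →ₙ+* B)
  map_zero' := by ext; simp
  map_add' _ _ := by ext; simp

@[simp]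
lemma laurentMap_coeff {A B : Type u} [CommRing A] [CommRing B] (f : A →+* B)
    (g : LaurentSeries A) (n : ℤ) : (laurentMap f g).coeff n = f (g.coeff n) := rfl

lemma laurentMap_smul {A B : Type u} [CommRing A] [CommRing B] (f : A →+* B) (a : A)
    (g : LaurentSeries A) : laurentMap f (a • g) = f a • laurentMap f g := by
  ext; simp

lemma laurentMap_res_res {X : Scheme.{u}} {V W Z : X.Opens} (h : V ≤ W) (h' : W ≤ Z)
    (g : LaurentSeries Γ(X, Z)) :
    laurentMap (res h) (laurentMap (res h') g) = laurentMap (res (h.trans h')) g := by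
  ext n
  simp [res_res]

lemma laurentMap_ofPowerSeries {A B : Type u} [CommRing A] [CommRing B] (f : A →+* B)
    (q : PowerSeries A) : laurentMap f (HahnSeries.ofPowerSeries ℤ A q) =
      HahnSeries.ofPowerSeries ℤ B (PowerSeries.map f q) := by
  ext n
  rw [laurentMap_coeff]
  by_cases hn : 0 ≤ n
  · lift n to ℕ using hn
    simp [HahnSeries.ofPowerSeries_apply_coeff]
  · rw [HahnSeries.ofPowerSeries_apply, HahnSeries.ofPowerSeries_apply,
      HahnSeries.embDomain_of_notMem_range, HahnSeries.embDomain_of_notMem_range, map_zero]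
    all_goals
      rintro ⟨m, hm⟩
      simp at hm
      omega

variable (S : Scheme.{u})

/-- The presheaf `U ↦ 𝒪_S(U)((z))` of abelian groups. -/
def laurentAb : S.Opensᵒᵖ ⥤ Ab.{u} where
  obj U := AddCommGrpCat.of (LaurentSeries Γ(S, U.unop))
  map f := AddCommGrpCat.ofHom (laurentMap (S.presheaf.map f).hom).toAddMonoidHom
  map_id U := by ext g n; simp
  map_comp f f' := by ext g n; simp

/-- The presheaf `U ↦ 𝒪_S(U)((z))ʳ` of abelian groups. -/
def laurentPowAb (r : ℕ) : S.Opensᵒᵖ ⥤ Ab.{u} where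
  obj U := AddCommGrpCat.of (Fin r → LaurentSeries Γ(S, U.unop))
  map f := AddCommGrpCat.ofHom ((laurentMap (S.presheaf.map f).hom).toAddMonoidHom.compLeft (Fin r))
  map_id U := by
    apply AddCommGrpCat.hom_ext; apply AddMonoidHom.ext; intro g
    funext i; apply HahnSeries.ext; funext n; simp
  map_comp f f' := by
    apply AddCommGrpCat.hom_ext; apply AddMonoidHom.ext; intro g
    funext i; apply HahnSeries.ext; funext n; simp

instance laurentModule (U : S.Opensᵒᵖ) :
    Module (S.ringCatSheaf.obj.obj U) ((laurentAb S).obj U) :=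
  inferInstanceAs (Module Γ(S, U.unop) (LaurentSeries Γ(S, U.unop)))

instance laurentPowModule (r : ℕ) (U : S.Opensᵒᵖ) :
    Module (S.ringCatSheaf.obj.obj U) ((laurentPowAb S r).obj U) :=
  inferInstanceAs (Module Γ(S, U.unop) (Fin r → LaurentSeries Γ(S, U.unop)))

/-- The presheaf `𝒪_S((z))` of `𝒪_S`-modules, `U ↦ 𝒪_S(U)((z))`. -/
def laurent : S.PresheafOfModules :=
  PresheafOfModules.ofPresheaf (laurentAb S) fun _ _ f r m =>
    laurentMap_smul (S.presheaf.map f).hom r m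

/-- The presheaf `𝒪_S((z))ʳ` of `𝒪_S`-modules, `U ↦ 𝒪_S(U)((z))ʳ`. -/
def laurentPow (r : ℕ) : S.PresheafOfModules :=
  PresheafOfModules.ofPresheaf (laurentPowAb S r) fun _ _ f r m =>
    funext fun i => laurentMap_smul (S.presheaf.map f).hom r (m i)

/-- The submodule `A[[z]]` of `A((z))`. -/
def powerSeriesIn (A : Type u) [CommRing A] : Submodule A (LaurentSeries A) where
  carrier := {g | ∀ n < 0, g.coeff n = 0}
  add_mem' {a b} ha hb n hn := by rw [HahnSeries.coeff_add, ha n hn, hb n hn, add_zero]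
  zero_mem' _ _ := rfl
  smul_mem' c a ha n hn := by rw [HahnSeries.coeff_smul, ha n hn, smul_zero]

/-- The submodule `A[[z]]ʳ` of `A((z))ʳ`. -/
def powerSeriesPowIn (A : Type u) [CommRing A] (r : ℕ) : Submodule A (Fin r → LaurentSeries A) :=
  Submodule.pi Set.univ fun _ => powerSeriesIn A

/-- The subpresheaf `𝒪_S[[z]]` of `𝒪_S((z))`. -/
def powerSeriesSub : (laurent S).Submodule where
  obj U := powerSeriesIn Γ(S, U.unop)
  map f (g : LaurentSeries _) (hg : ∀ n < 0, g.coeff n = 0) n hn := by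
    change (S.presheaf.map f).hom (HahnSeries.coeff g n) = 0
    rw [hg n hn, map_zero]

/-- The subpresheaf `𝒪_S[[z]]ʳ` of `𝒪_S((z))ʳ`. -/
def powerSeriesPowSub (r : ℕ) : (laurentPow S r).Submodule where
  obj U := powerSeriesPowIn Γ(S, U.unop) r
  map f (g : Fin r → LaurentSeries _) (hg : ∀ i ∈ Set.univ, ∀ n < 0, (g i).coeff n = 0) i hi n hn := by
    change (S.presheaf.map f).hom (HahnSeries.coeff (g i) n) = 0
    rw [hg i hi n hn, map_zero]

variable {S} in
/-- The quotient sheaf of a presheaf of modules by a subpresheaf: the sheaf associated with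
the presheaf of quotients. -/
def quotientSheaf (M : S.PresheafOfModules) (N : M.Submodule) : S.Modules :=
  (PresheafOfModules.sheafification (𝟙 S.ringCatSheaf.obj)).obj (cokernel N.ι)

end Laurent

/-! ### Relative curves with a section -/

section Curve

/-- The structure morphism `ℙⁿ_R ⟶ Spec R` of projective space over a ring. -/
def projectiveSpaceToSpec (n : ℕ) (R : CommRingCat.{u}) :
    letI := MvPolynomial.gradedAlgebra (σ := Fin (n + 1)) (R := R)
    Proj (MvPolynomial.homogeneousSubmodule (Fin (n + 1)) R) ⟶ Spec R :=
  letI := MvPolynomial.gradedAlgebra (σ := Fin (n + 1)) (R := R)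
  Proj.toSpecZero (MvPolynomial.homogeneousSubmodule (Fin (n + 1)) R) ≫
    Spec.map (CommRingCat.ofHom
      (algebraMap R (MvPolynomial.homogeneousSubmodule (Fin (n + 1)) R 0)))

/-- `π` is locally projective: every point of the base has an affine open neighbourhood `U`
such that `π⁻¹(U)` is isomorphic over `U` to a closed subscheme of some `ℙⁿ_U`. -/
def IsLocallyProjective {C S : Scheme.{u}} (π : C ⟶ S) : Prop :=
  ∀ s : S, ∃ U : S.affineOpens, s ∈ U.1 ∧ ∃ (n : ℕ)
    (i : letI := MvPolynomial.gradedAlgebra (σ := Fin (n + 1)) (R := Γ(S, U.1))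
      (π ⁻¹ᵁ U.1).toScheme ⟶ Proj (MvPolynomial.homogeneousSubmodule (Fin (n + 1)) Γ(S, U.1))),
    IsClosedImmersion i ∧
      i ≫ projectiveSpaceToSpec n Γ(S, U.1) ≫ U.2.fromSpec = (π ⁻¹ᵁ U.1).ι ≫ π

variable {C : Scheme.{u}} (I : C.IdealSheafData)

/-- The complement of the closed subscheme defined by `I`. -/
def away : C.Opens := I.support.compl

/-- `I` is the ideal sheaf of an effective Cartier divisor: it is locally generated by one
element which is not a zero divisor. -/
def IsCartier : Prop :=
  ∀ x : C, ∃ V : C.affineOpens, x ∈ V.1 ∧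
    ∃ b ∈ nonZeroDivisors Γ(C, V.1), I.ideal V = Ideal.span {b}

/-- For an effective Cartier divisor `P` with ideal sheaf `I`: the sections over `W` of
`𝒪_C(nP)`, i.e. the functions `f` on `W ∖ P` such that `Iⁿ f` consists of functions that
extend over `P`. -/
def poleSections (n : ℕ) (W : C.Opens) : Set Γ(C, W ⊓ away I) :=
  {f | ∀ V : AffIn W, ∀ b ∈ I.ideal V.1 ^ n, ∃ a : Γ(C, V.1.1),
    res inf_le_left a = res inf_le_left b * res (inf_le_inf_right (away I) V.2) f}

/-- The section `s` of `𝒪_C(nP)` over `W` generates this sheaf in a neighbourhood of `y`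
(that is, `s` does not vanish at `y` as a section of the line bundle `𝒪_C(nP)`). -/
def GeneratesAt (n : ℕ) {W : C.Opens} (s : Γ(C, W ⊓ away I)) (y : C) : Prop :=
  ∃ (V : C.Opens) (hV : V ≤ W), y ∈ V ∧ ∀ (V' : C.Opens) (h : V' ≤ V),
    ∀ t ∈ poleSections I n V', ∃ a : Γ(C, V'),
      t = res inf_le_left a * res (inf_le_inf_right (away I) (h.trans hV)) s

/-- The line bundle `𝒪_C(P)` is ample relative to `π`: for every affine open `U` of the base,
`π⁻¹(U)` is covered by affine open subsets of the form `{s ≠ 0}`, with `s` a section of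
`𝒪_C(nP)` over `π⁻¹(U)`, `n ≥ 1`. -/
def IsRelativelyAmple {S : Scheme.{u}} (π : C ⟶ S) : Prop :=
  ∀ (U : S.affineOpens), ∀ x ∈ π ⁻¹ᵁ U.1, ∃ n ≥ 1, ∃ s ∈ poleSections I n (π ⁻¹ᵁ U.1),
    ∃ W : AffIn (π ⁻¹ᵁ U.1), x ∈ W.1.1 ∧ ∀ y ∈ π ⁻¹ᵁ U.1, y ∈ W.1.1 ↔ GeneratesAt I n s y

/-- `I/I²` is a free `𝒪_C/I`-module of rank one: it has a global section which is a basis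
over every affine open subset. -/
def ConormalTrivial : Prop :=
  ∃ e : ∀ V : C.affineOpens, (I.ideal V).Cotangent,
    (∀ (V V' : C.affineOpens) (h : V'.1 ≤ V.1), ∃ (b : I.ideal V) (b' : I.ideal V'),
      b'.1 = res h b.1 ∧ (I.ideal V).toCotangent b = e V ∧ (I.ideal V').toCotangent b' = e V') ∧
    ∀ V : C.affineOpens, Function.Bijective
      (LinearMap.toSpanSingleton (Γ(C, V.1) ⧸ I.ideal V) (I.ideal V).Cotangent (e V))

lemma section_le {S C : Scheme.{u}} {π : C ⟶ S} {p : S ⟶ C} (h : p ≫ π = 𝟙 S)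
    {W : C.Opens} {U : S.Opens} (hW : W ≤ π ⁻¹ᵁ U) : p ⁻¹ᵁ W ≤ U := by
  intro x hx
  have h1 : π (p x) ∈ U := hW hx
  have h2 : π (p x) = x := by
    rw [← Scheme.Hom.comp_apply, h]; rfl
  rwa [h2] at h1

lemma preimage_le {S C : Scheme.{u}} (p : S ⟶ C) {W' W : C.Opens} (h : W' ≤ W) :
    p ⁻¹ᵁ W' ≤ p ⁻¹ᵁ W := fun _ hx => h hx

end Curve

/-! ### Geometric data -/

/-- A geometric datum of rank `r` over `S`. The section `P ⊂ C` is given by a morphism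
`p : S ⟶ C` with `p ≫ π = 𝟙`; its ideal sheaf is `p.ker`, and a sheaf on `P ≅ S` is
regarded as a sheaf on `C` by means of `p_*`. -/
structure GeometricDatum (S : Scheme.{u}) (r : ℕ) where
  /-- the total space -/
  C : Scheme.{u}
  /-- the projection -/
  π : C ⟶ S
  /-- the section -/
  p : S ⟶ C
  section_eq : p ≫ π = 𝟙 S
  locallyProjective : IsLocallyProjective π
  cartier : IsCartier p.ker
  ample : IsRelativelyAmple p.ker π
  conormal : ConormalTrivial p.ker
  /-- the isomorphism `ρ` from the formal completion of `𝒪_C` along `P` to `𝒪_P[[z]]` -/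
  ρ (W : C.Opens) : completionRing p.ker W ≃+* PowerSeries Γ(S, p ⁻¹ᵁ W)
  /-- `ρ` is a morphism of sheaves -/
  ρ_res {W' W : C.Opens} (h : W' ≤ W) (x : completionRing p.ker W) :
    ρ W' (completionRes p.ker h x) = PowerSeries.map (res (preimage_le p h)) (ρ W x)
  /-- `ρ` is a morphism of `𝒪_P`-algebras, where `𝒪_P ≅ 𝒪_S` acts through `π` -/
  ρ_algebra (U : S.Opens) (W : C.Opens) (h : W ≤ π ⁻¹ᵁ U) (c : Γ(S, U)) :
    ρ W (toCompletion p.ker W (res h (π.app U c))) =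
      PowerSeries.C (res (section_le section_eq h) c)
  /-- `ρ` is continuous -/
  ρ_continuous (V : C.affineOpens) (n : ℕ) : ∃ m : ℕ, ∀ x : completionRing p.ker V.1,
    (x.1 ⟨V, le_rfl⟩).val m = 0 → PowerSeries.X ^ n ∣ ρ V.1 x
  /-- the inverse of `ρ` is continuous -/
  ρ_symm_continuous (V : C.affineOpens) (n : ℕ) : ∃ m : ℕ, ∀ x : completionRing p.ker V.1,
    PowerSeries.X ^ m ∣ ρ V.1 x → (x.1 ⟨V, le_rfl⟩).val n = 0
  /-- the intersection of all `π_* 𝒪_C(-nP)` is zero -/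
  separated (U : S.Opens) (f : Γ(C, π ⁻¹ᵁ U)) :
    (∀ (n : ℕ) (V : AffIn (π ⁻¹ᵁ U)), res V.2 f ∈ p.ker.ideal V.1 ^ n) → f = 0
  /-- the sheaf on the total space -/
  F : C.Modules
  quasicoherent : SheafOfModules.IsQuasicoherent (R := C.ringCatSheaf) F
  finiteType : SheafOfModules.IsFiniteType (R := C.ringCatSheaf) F
  /-- the intersection of all `π_* F(-nP)` is zero -/
  separatedF (U : S.Opens) (m : Γ(F, π ⁻¹ᵁ U)) :
    (∀ (n : ℕ) (V : AffIn (π ⁻¹ᵁ U)),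
      resM F V.2 m ∈ (p.ker.ideal V.1 ^ n • ⊤ : Submodule Γ(C, V.1.1) Γ(F, V.1.1))) → m = 0
  /-- the isomorphism `Φ` from the formal completion of `F` along `P` to the free module
  of rank `r` over the formal completion of `𝒪_C` -/
  Φ (W : C.Opens) :
    completionModule p.ker F W ≃ₗ[completionRing p.ker W] (Fin r → completionRing p.ker W)
  /-- `Φ` is a morphism of sheaves -/
  Φ_res {W' W : C.Opens} (h : W' ≤ W) (x : completionModule p.ker F W) (i : Fin r) :
    Φ W' (completionResM p.ker F h x) i = completionRes p.ker h (Φ W x i)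

namespace GeometricDatum

variable {S : Scheme.{u}} {r : ℕ} (D : GeometricDatum S r)

/-- The ideal sheaf of the section `P`. -/
abbrev ideal : D.C.IdealSheafData := D.p.ker

/-- `π⁻¹(U) ∖ P` -/
abbrev punctured (U : S.Opens) : D.C.Opens := D.π ⁻¹ᵁ U ⊓ away D.ideal

/-- The image in `𝒪_S(p⁻¹W)((z))` of a function on `W` under completion and `ρ`. -/
def expand (W : D.C.Opens) : Γ(D.C, W) →+* LaurentSeries Γ(S, D.p ⁻¹ᵁ W) :=
  (HahnSeries.ofPowerSeries ℤ _).comp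
    ((D.ρ W).toRingHom.comp (toCompletion D.ideal W))

/-- The image in `𝒪_S(p⁻¹W)((z))ʳ` of a section of `F` on `W` under completion and `ρ ∘ Φ`. -/
def expandF (W : D.C.Opens) (m : Γ(D.F, W)) (i : Fin r) : LaurentSeries Γ(S, D.p ⁻¹ᵁ W) :=
  HahnSeries.ofPowerSeries ℤ _ (D.ρ W (D.Φ W (toCompletionM D.ideal D.F W m) i))

/-- On the affine open `V`, the function `f` on `π⁻¹(U) ∖ P` is a quotient `a / b` with `b` a
local equation of `nP`, and `g` restricts to `ρ(a) / ρ(b)`. -/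
def LocalExpansion {U : S.Opens} (f : Γ(D.C, D.punctured U)) (g : LaurentSeries Γ(S, U))
    (V : AffIn (D.π ⁻¹ᵁ U)) : Prop :=
  ∃ (n : ℕ) (a b : Γ(D.C, V.1.1)), D.ideal.ideal V.1 ^ n = Ideal.span {b} ∧
    res (inf_le_left : V.1.1 ⊓ away D.ideal ≤ _) a =
      res inf_le_left b * res (inf_le_inf_right _ V.2) f ∧
    D.expand V.1.1 b * laurentMap (res (section_le D.section_eq V.2)) g = D.expand V.1.1 a

/-- On the affine open `V`, the section `m` of `F` over `π⁻¹(U) ∖ P` is a quotient `a / b` with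
`b` a local equation of `nP`, and `g` restricts to `ρ(Φ(a)) / ρ(b)`. -/
def LocalExpansionF {U : S.Opens} (m : Γ(D.F, D.punctured U)) (g : Fin r → LaurentSeries Γ(S, U))
    (V : AffIn (D.π ⁻¹ᵁ U)) : Prop :=
  ∃ (n : ℕ) (a : Γ(D.F, V.1.1)) (b : Γ(D.C, V.1.1)), D.ideal.ideal V.1 ^ n = Ideal.span {b} ∧
    resM D.F (inf_le_left : V.1.1 ⊓ away D.ideal ≤ _) a =
      res (inf_le_left : V.1.1 ⊓ away D.ideal ≤ _) b • resM D.F (inf_le_inf_right _ V.2) m ∧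
    ∀ i, D.expand V.1.1 b * laurentMap (res (section_le D.section_eq V.2)) (g i) =
      D.expandF V.1.1 a i

/-- `g ∈ 𝒪_S(U)((z))` is the image `π_*(ρ)(f)` of the function `f` on `π⁻¹(U) ∖ P`. -/
def IsExpansion {U : S.Opens} (f : Γ(D.C, D.punctured U)) (g : LaurentSeries Γ(S, U)) : Prop :=
  ∀ x ∈ U, ∃ V : AffIn (D.π ⁻¹ᵁ U), D.p x ∈ V.1.1 ∧ D.LocalExpansion f g V

/-- `g ∈ 𝒪_S(U)((z))ʳ` is the image `π_*(ρ ∘ Φ)(m)` of the section `m` of `F` over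
`π⁻¹(U) ∖ P`. -/
def IsExpansionF {U : S.Opens} (m : Γ(D.F, D.punctured U)) (g : Fin r → LaurentSeries Γ(S, U)) :
    Prop :=
  ∀ x ∈ U, ∃ V : AffIn (D.π ⁻¹ᵁ U), D.p x ∈ V.1.1 ∧ D.LocalExpansionF m g V

/-! #### The expansions form subpresheaves of modules -/

lemma expand_res {W' W : D.C.Opens} (h : W' ≤ W) (a : Γ(D.C, W)) :
    D.expand W' (res h a) = laurentMap (res (preimage_le D.p h)) (D.expand W a) := by
  change HahnSeries.ofPowerSeries ℤ _ (D.ρ W' (toCompletion D.ideal W' (res h a))) =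
    laurentMap _ (HahnSeries.ofPowerSeries ℤ _ (D.ρ W (toCompletion D.ideal W a)))
  rw [laurentMap_ofPowerSeries, ← D.ρ_res, completionRes_toCompletion]

lemma expandF_res {W' W : D.C.Opens} (h : W' ≤ W) (a : Γ(D.F, W)) (i : Fin r) :
    D.expandF W' (resM D.F h a) i = laurentMap (res (preimage_le D.p h)) (D.expandF W a i) := by
  have h1 := completionResM_toCompletionM D.p.ker D.F h a
  have h2 := D.Φ_res h (toCompletionM D.p.ker D.F W a) i
  have h3 := D.ρ_res h (D.Φ W (toCompletionM D.p.ker D.F W a) i)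
  have h4 := congrArg (fun x => D.ρ W' (D.Φ W' x i)) h1
  have h5 := h4.symm.trans ((congrArg (D.ρ W') h2).trans h3)
  exact (congrArg (HahnSeries.ofPowerSeries ℤ _) h5).trans (laurentMap_ofPowerSeries _ _).symm

lemma expandF_add (W : D.C.Opens) (a a' : Γ(D.F, W)) (i : Fin r) :
    D.expandF W (a + a') i = D.expandF W a i + D.expandF W a' i := by
  rw [expandF, map_add, LinearEquiv.map_add, Pi.add_apply, map_add, map_add]
  rfl

lemma expandF_zero (W : D.C.Opens) (i : Fin r) : D.expandF W 0 i = 0 := by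
  have h := D.expandF_add W 0 0 i
  rwa [add_zero, left_eq_add] at h

lemma equiv_smul_apply {R M : Type u} [CommRing R] [AddCommGroup M] [Module R M]
    (e : M ≃ₗ[R] (Fin r → R)) (c : R) (m : M) (i : Fin r) : e (c • m) i = c * e m i := by
  rw [map_smul, Pi.smul_apply, smul_eq_mul]

lemma expandF_smul (W : D.C.Opens) (c : Γ(D.C, W)) (a : Γ(D.F, W)) (i : Fin r) :
    D.expandF W (c • a) i = D.expand W c * D.expandF W a i := by
  have h1 := toCompletionM_smul D.p.ker D.F W c a
  have h2 := equiv_smul_apply (D.Φ W) (toCompletion D.p.ker W c) (toCompletionM D.p.ker D.F W a) i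
  have h3 := congrArg (fun x => D.ρ W (D.Φ W x i)) h1
  have h4 := h3.trans ((congrArg (D.ρ W) h2).trans (map_mul (D.ρ W) _ _))
  exact (congrArg (HahnSeries.ofPowerSeries ℤ _) h4).trans (map_mul _ _ _)

lemma expand_const {U : S.Opens} {W : D.C.Opens} (h : W ≤ D.π ⁻¹ᵁ U) (c : Γ(S, U)) :
    D.expand W (res h (D.π.app U c)) = HahnSeries.C (res (section_le D.section_eq h) c) := by
  change HahnSeries.ofPowerSeries ℤ _ (D.ρ W (toCompletion D.ideal W (res h (D.π.app U c)))) = _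
  rw [D.ρ_algebra, HahnSeries.ofPowerSeries_C]

lemma ideal_pow_res {V V' : D.C.affineOpens} (h : V'.1 ≤ V.1) {n : ℕ} {b : Γ(D.C, V.1)}
    (hb : D.ideal.ideal V ^ n = Ideal.span {b}) :
    D.ideal.ideal V' ^ n = Ideal.span {res h b} := by
  have h1 : (D.ideal.ideal V).map (res h) = D.ideal.ideal V' := D.ideal.map_ideal h
  rw [← h1, ← Ideal.map_pow, hb, Ideal.map_span, Set.image_singleton]

variable {D}

lemma LocalExpansion.restrict {U U' : S.Opens} (hU : U' ≤ U) {f : Γ(D.C, D.punctured U)}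
    {g : LaurentSeries Γ(S, U)} {V : AffIn (D.π ⁻¹ᵁ U)} (H : D.LocalExpansion f g V)
    (V' : AffIn (D.π ⁻¹ᵁ U')) (h : V'.1.1 ≤ V.1.1) :
    D.LocalExpansion (res (inf_le_inf_right _ (preimage_le D.π hU)) f) (laurentMap (res hU) g)
      V' := by
  obtain ⟨n, a, b, hb, h1, h2⟩ := H
  refine ⟨n, res h a, res h b, D.ideal_pow_res h hb, ?_, ?_⟩
  · have := congrArg (res (inf_le_inf_right (away D.ideal) h)) h1
    rw [map_mul] at this
    simpa only [res_res] using this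
  · have := congrArg (laurentMap (res (preimage_le D.p h))) h2
    rw [map_mul] at this
    simpa only [expand_res, laurentMap_res_res] using this

lemma LocalExpansionF.restrict {U U' : S.Opens} (hU : U' ≤ U) {f : Γ(D.F, D.punctured U)}
    {g : Fin r → LaurentSeries Γ(S, U)} {V : AffIn (D.π ⁻¹ᵁ U)} (H : D.LocalExpansionF f g V)
    (V' : AffIn (D.π ⁻¹ᵁ U')) (h : V'.1.1 ≤ V.1.1) :
    D.LocalExpansionF (resM D.F (inf_le_inf_right _ (preimage_le D.π hU)) f)
      (fun i => laurentMap (res hU) (g i)) V' := by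
  obtain ⟨n, a, b, hb, h1, h2⟩ := H
  refine ⟨n, resM D.F h a, res h b, D.ideal_pow_res h hb, ?_, fun i => ?_⟩
  · have := congrArg (resM D.F (inf_le_inf_right (away D.ideal) h)) h1
    rw [resM_smul] at this
    simpa only [res_res, resM_resM] using this
  · have := congrArg (laurentMap (res (preimage_le D.p h))) (h2 i)
    rw [map_mul] at this
    simpa only [expand_res, expandF_res, laurentMap_res_res] using this

lemma laurentMap_res_self {U : S.Opens} (g : LaurentSeries Γ(S, U)) :
    laurentMap (res le_rfl) g = g := by
  ext n
  simp [res_self]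

lemma LocalExpansion.shrink {U : S.Opens} {f : Γ(D.C, D.punctured U)}
    {g : LaurentSeries Γ(S, U)} {V : AffIn (D.π ⁻¹ᵁ U)} (H : D.LocalExpansion f g V)
    (V' : AffIn (D.π ⁻¹ᵁ U)) (h : V'.1.1 ≤ V.1.1) : D.LocalExpansion f g V' := by
  have := H.restrict le_rfl V' h
  rwa [laurentMap_res_self, res_self] at this

lemma LocalExpansionF.shrink {U : S.Opens} {f : Γ(D.F, D.punctured U)}
    {g : Fin r → LaurentSeries Γ(S, U)} {V : AffIn (D.π ⁻¹ᵁ U)} (H : D.LocalExpansionF f g V)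
    (V' : AffIn (D.π ⁻¹ᵁ U)) (h : V'.1.1 ≤ V.1.1) : D.LocalExpansionF f g V' := by
  have := H.restrict le_rfl V' h
  simp only [laurentMap_res_self] at this
  rwa [resM_self] at this

lemma LocalExpansion.add {U : S.Opens} {f f' : Γ(D.C, D.punctured U)}
    {g g' : LaurentSeries Γ(S, U)} {V : AffIn (D.π ⁻¹ᵁ U)} (H : D.LocalExpansion f g V)
    (H' : D.LocalExpansion f' g' V) : D.LocalExpansion (f + f') (g + g') V := by
  obtain ⟨n, a, b, hb, h1, h2⟩ := H
  obtain ⟨n', a', b', hb', h1', h2'⟩ := H'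
  refine ⟨n + n', b' * a + b * a', b * b', ?_, ?_, ?_⟩
  · rw [pow_add, hb, hb', Ideal.span_singleton_mul_span_singleton]
  · simp only [map_add, map_mul, h1, h1']; ring
  · simp only [map_add, map_mul, ← h2, ← h2']; ring

lemma LocalExpansionF.add {U : S.Opens} {f f' : Γ(D.F, D.punctured U)}
    {g g' : Fin r → LaurentSeries Γ(S, U)} {V : AffIn (D.π ⁻¹ᵁ U)} (H : D.LocalExpansionF f g V)
    (H' : D.LocalExpansionF f' g' V) : D.LocalExpansionF (f + f') (g + g') V := by
  obtain ⟨n, a, b, hb, h1, h2⟩ := H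
  obtain ⟨n', a', b', hb', h1', h2'⟩ := H'
  refine ⟨n + n', b' • a + b • a', b * b', ?_, ?_, fun i => ?_⟩
  · rw [pow_add, hb, hb', Ideal.span_singleton_mul_span_singleton]
  · simp only [map_add, map_mul, resM_smul, h1, h1', smul_add, smul_smul, mul_comm]
  · simp only [expandF_add, expandF_smul, map_add, map_mul, Pi.add_apply, ← h2, ← h2']; ring

lemma LocalExpansion.smul {U : S.Opens} (c : Γ(S, U)) {f : Γ(D.C, D.punctured U)}
    {g : LaurentSeries Γ(S, U)} {V : AffIn (D.π ⁻¹ᵁ U)} (H : D.LocalExpansion f g V) :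
    D.LocalExpansion (res inf_le_left (D.π.app U c) * f) (c • g) V := by
  obtain ⟨n, a, b, hb, h1, h2⟩ := H
  refine ⟨n, res V.2 (D.π.app U c) * a, b, hb, ?_, ?_⟩
  · simp only [map_mul, h1, res_res]; ring
  · rw [map_mul, ← h2, laurentMap_smul, expand_const, ← HahnSeries.C_mul_eq_smul]; ring

lemma LocalExpansionF.smul {U : S.Opens} (c : Γ(S, U)) {f : Γ(D.F, D.punctured U)}
    {g : Fin r → LaurentSeries Γ(S, U)} {V : AffIn (D.π ⁻¹ᵁ U)} (H : D.LocalExpansionF f g V) :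
    D.LocalExpansionF ((res inf_le_left (D.π.app U c) : Γ(D.C, D.punctured U)) • f)
      (c • g) V := by
  obtain ⟨n, a, b, hb, h1, h2⟩ := H
  refine ⟨n, res V.2 (D.π.app U c) • a, b, hb, ?_, fun i => ?_⟩
  · simp only [resM_smul, h1, res_res, smul_smul, mul_comm]
  · rw [expandF_smul, ← h2, Pi.smul_apply, laurentMap_smul, expand_const,
      ← HahnSeries.C_mul_eq_smul]; ring

variable (D)

lemma exists_affine {U : S.Opens} {x : S} (W : D.C.Opens) (hW : D.p x ∈ W) (hU : x ∈ U) :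
    ∃ V : AffIn (D.π ⁻¹ᵁ U), D.p x ∈ V.1.1 ∧ V.1.1 ≤ W := by
  have hx : D.p x ∈ D.π ⁻¹ᵁ U := by
    change D.π (D.p x) ∈ U
    rwa [← Scheme.Hom.comp_apply, D.section_eq]
  obtain ⟨V, hV, hxV, hle⟩ := exists_isAffineOpen_mem_and_subset (U := W ⊓ D.π ⁻¹ᵁ U) ⟨hW, hx⟩
  exact ⟨⟨⟨V, hV⟩, fun y hy => (hle hy).2⟩, hxV, fun y hy => (hle hy).1⟩

/-- `A(U) = π_*(ρ)(H⁰(π⁻¹(U) ∖ P, 𝒪_C)) ⊂ 𝒪_S(U)((z))` -/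
def sectionsA (U : S.Opens) : Submodule Γ(S, U) (LaurentSeries Γ(S, U)) where
  carrier := {g | ∃ f, D.IsExpansion f g}
  add_mem' := by
    rintro g g' ⟨f, hf⟩ ⟨f', hf'⟩
    refine ⟨f + f', fun x hx => ?_⟩
    obtain ⟨V, hV, H⟩ := hf x hx
    obtain ⟨V', hV', H'⟩ := hf' x hx
    obtain ⟨Z, hZ, hle⟩ := D.exists_affine (V.1.1 ⊓ V'.1.1) ⟨hV, hV'⟩ hx
    exact ⟨Z, hZ, (H.shrink Z (hle.trans inf_le_left)).add (H'.shrink Z (hle.trans inf_le_right))⟩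
  zero_mem' := by
    refine ⟨0, fun x hx => ?_⟩
    obtain ⟨Z, hZ, -⟩ := D.exists_affine ⊤ trivial hx
    exact ⟨Z, hZ, 0, 0, 1, by simp, by simp, by simp⟩
  smul_mem' := by
    rintro c g ⟨f, hf⟩
    refine ⟨res inf_le_left (D.π.app U c) * f, fun x hx => ?_⟩
    obtain ⟨V, hV, H⟩ := hf x hx
    exact ⟨V, hV, H.smul c⟩

/-- `W(U) = π_*(ρ ∘ Φ)(H⁰(π⁻¹(U) ∖ P, F)) ⊂ 𝒪_S(U)((z))ʳ` -/
def sectionsW (U : S.Opens) : Submodule Γ(S, U) (Fin r → LaurentSeries Γ(S, U)) where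
  carrier := {g | ∃ m, D.IsExpansionF m g}
  add_mem' := by
    rintro g g' ⟨f, hf⟩ ⟨f', hf'⟩
    refine ⟨f + f', fun x hx => ?_⟩
    obtain ⟨V, hV, H⟩ := hf x hx
    obtain ⟨V', hV', H'⟩ := hf' x hx
    obtain ⟨Z, hZ, hle⟩ := D.exists_affine (V.1.1 ⊓ V'.1.1) ⟨hV, hV'⟩ hx
    exact ⟨Z, hZ, (H.shrink Z (hle.trans inf_le_left)).add (H'.shrink Z (hle.trans inf_le_right))⟩
  zero_mem' := by
    refine ⟨0, fun x hx => ?_⟩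
    obtain ⟨Z, hZ, -⟩ := D.exists_affine ⊤ trivial hx
    exact ⟨Z, hZ, 0, 0, 1, by simp, by simp, fun i => by simp [expandF_zero]⟩
  smul_mem' := by
    rintro c g ⟨f, hf⟩
    refine ⟨(res inf_le_left (D.π.app U c) : Γ(D.C, D.punctured U)) • f, fun x hx => ?_⟩
    obtain ⟨V, hV, H⟩ := hf x hx
    exact ⟨V, hV, H.smul c⟩

/-- The first member `A ⊂ 𝒪_S((z))` of the Schur pair of the geometric datum. -/
def schurA : (laurent S).Submodule where
  obj U := D.sectionsA U.unop
  map {U U'} i g hg := by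
    obtain ⟨f, hf⟩ : ∃ f, D.IsExpansion f g := hg
    refine ⟨res (inf_le_inf_right _ (preimage_le D.π i.unop.le)) f, fun x hx => ?_⟩
    obtain ⟨V, hV, H⟩ := hf x (i.unop.le hx)
    obtain ⟨Z, hZ, hle⟩ := D.exists_affine V.1.1 hV hx
    exact ⟨Z, hZ, H.restrict i.unop.le Z hle⟩

/-- The second member `W ⊂ 𝒪_S((z))ʳ` of the Schur pair of the geometric datum. -/
def schurW : (laurentPow S r).Submodule where
  obj U := D.sectionsW U.unop
  map {U U'} i g hg := by
    obtain ⟨f, hf⟩ : ∃ f, D.IsExpansionF f g := hg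
    refine ⟨resM D.F (inf_le_inf_right _ (preimage_le D.π i.unop.le)) f, fun x hx => ?_⟩
    obtain ⟨V, hV, H⟩ := hf x (i.unop.le hx)
    obtain ⟨Z, hZ, hle⟩ := D.exists_affine V.1.1 hV hx
    exact ⟨Z, hZ, H.restrict i.unop.le Z hle⟩

end GeometricDatum

end
end Krichever

namespace Krichever

noncomputable section

/-! ### Sheaves of modules on a site -/

section Site

variable {T : Type u} [SmallCategory T] {J : GrothendieckTopology T} (R : Sheaf J RingCat.{u})

/-! The theorem is Mayer–Vietoris along `P`, with a formal neighbourhood of `P` in place of an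
actual one. Locally on the base, `π⁻¹(U)` is the union of an affine neighbourhood `V` of the
section, on which the ideal of `P` is generated by one function `b`, and of `Y = π⁻¹(U) ∖ P`. If `Y`
is affine too, `H¹(π⁻¹(U), F)` is `F(V ∖ P) / (F(V) + F(Y))`. Expansion along `P` turns `F(V ∖ P) /
F(V)` into Laurent vectors modulo power series: every section on `V ∖ P` has an expansion
(`exists_expands`), one with integral expansion extends over `P` (`Expands.exists_extension`), and
every Laurent vector is an expansion up to power series (`exists_expands_sub`). The last two hold
because sections are dense in the completion and because, by continuity of `ρ` and its inverse,
`ρ(b)` is invertible in Laurent series and its powers clear all poles. The image of `F(Y)` is the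
module `W`.

Affineness of `Y` (`isAffineOpen_punctured`) comes from properness of `π` and ampleness of `P`:
sections of `𝒪(nP)` are functions on `Y` whose inverses are regular near the points where they
generate. This gives the valuative criterion for `Y → Spec Γ(Y)` and an affine cover of `Y` by basic
opens.

Cohomology enters through an exact sequence `0 → F → J → Q → 0` with `J` injective, so that the
first direct image is the cokernel of `π_* J → π_* Q`. A Laurent vector `g` gives a section `f` of
`F` on `V ∖ P`; as `J` is flasque, `f` extends to `t` in `J(V)`, and the image of `t` in `Q`
vanishes on `V ∖ P`, hence glues with zero on `Y` to a section `x`. The class of `x` depends only on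
`g`, so the local classes glue to a map from Laurent vectors to the direct image. Its kernel is
locally `W` plus power series, and it is locally surjective. The case of `𝒪_C` is that of the rank
one datum with `F = 𝒪_C`. -/

lemma freeYonedaEquiv_map (R : Tᵒᵖ ⥤ RingCat.{u}) {V U : T} (i : V ⟶ U)
    {M : PresheafOfModules.{u} R} (g : (PresheafOfModules.free R).obj (yoneda.obj U) ⟶ M) :
    PresheafOfModules.freeYonedaEquiv ((PresheafOfModules.free R).map (yoneda.map i) ≫ g) =
    M.map i.op (PresheafOfModules.freeYonedaEquiv g) := by
  have h1 (ψ : (PresheafOfModules.free R).obj (yoneda.obj U) ⟶ M) :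
      PresheafOfModules.freeYonedaEquiv ψ = ψ.app (op U) (ModuleCat.freeMk (𝟙 U)) := by
    simp [PresheafOfModules.freeYonedaEquiv, PresheafOfModules.freeHomEquiv, yonedaEquiv]
    rfl
  have h2 (ψ : (PresheafOfModules.free R).obj (yoneda.obj V) ⟶ M) :
      PresheafOfModules.freeYonedaEquiv ψ = ψ.app (op V) (ModuleCat.freeMk (𝟙 V)) := by
    simp [PresheafOfModules.freeYonedaEquiv, PresheafOfModules.freeHomEquiv, yonedaEquiv]
    rfl
  rw [h1, h2]
  refine Eq.trans ?_ (PresheafOfModules.naturality_apply g i.op _)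
  change g.app (op V) _ = g.app (op V) _
  congr 1
  have e1 : (ModuleCat.free (R.obj (op V))).map ((yoneda.map i).app (op V))
      (ModuleCat.freeMk (𝟙 V)) = ModuleCat.freeMk (𝟙 V ≫ i) := ModuleCat.free_map_apply _ _
  have e2 : (PresheafOfModules.freeObj (R := R) (yoneda.obj U)).map i.op (ModuleCat.freeMk (𝟙 U)) =
      ModuleCat.freeMk (i ≫ 𝟙 U) := ModuleCat.freeDesc_apply _ _
  refine e1.trans (Eq.trans ?_ e2.symm)
  rw [Category.id_comp, Category.comp_id]

/-- Factor the underlying presheaf map through its image. The first factor is surjective on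
sections. The inclusion of the image becomes both mono and epi after sheafification, hence an
isomorphism, so it is locally surjective. -/
lemma isLocallySurjective_forget_map {M N : SheafOfModules.{u} R} (φ : M ⟶ N) [Epi φ] :
    PresheafOfModules.IsLocallySurjective J ((SheafOfModules.forget R).map φ) := by
  let f := (SheafOfModules.forget R ⋙ PresheafOfModules.restrictScalars (𝟙 R.obj)).map φ
  let a := PresheafOfModules.sheafification (𝟙 R.obj)
  let adj := PresheafOfModules.sheafificationAdjunction (𝟙 R.obj)
  have h1 : a.map f ≫ adj.counit.app N = adj.counit.app M ≫ φ := adj.counit.naturality φ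
  have h3 : Epi (a.map f) := by
    rw [(IsIso.eq_comp_inv _).mpr h1]
    infer_instance
  have h4 : Epi (a.map (Abelian.image.ι f)) := by
    rw [← Abelian.image.fac f, Functor.map_comp] at h3
    exact epi_of_epi (a.map (Abelian.factorThruImage f)) _
  have h5 : IsIso (a.map (Abelian.image.ι f)) := isIso_of_mono_of_epi _
  have h6 : (J.W.inverseImage
      (PresheafOfModules.toPresheaf R.obj)) (Abelian.image.ι f) := by
    rw [PresheafOfModules.inverseImage_W_toPresheaf_eq_inverseImage_isomorphisms
      (𝟙 R.obj)]
    exact h5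
  have h7 : PresheafOfModules.IsLocallySurjective J
    (Abelian.image.ι f) := GrothendieckTopology.W.isLocallySurjective h6
  have h8 : PresheafOfModules.IsLocallySurjective J
      (Abelian.factorThruImage f) :=
    Presheaf.isLocallySurjective_of_surjective _ _ fun U =>
      PresheafOfModules.surjective_of_epi (Abelian.factorThruImage f) U
  have h9 : PresheafOfModules.IsLocallySurjective J
      (Abelian.factorThruImage f ≫ Abelian.image.ι f) := by
    unfold PresheafOfModules.IsLocallySurjective
    rw [Functor.map_comp]
    infer_instance
  rwa [Abelian.image.fac] at h9

end Site

/-! ### Sections of sheaves of modules -/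

section Sections

variable {X : Scheme.{u}}

lemma app_resM {M N : X.Modules} (φ : M ⟶ N) {V W : X.Opens} (h : V ≤ W) (m : Γ(M, W)) :
    φ.app V (resM M h m) = resM N h (φ.app W m) :=
  NatTrans.naturality_apply φ.mapPresheaf (homOfLE h).op m

lemma section_ext (M : X.Modules) {W : X.Opens} {s t : Γ(M, W)}
    (H : ∀ x ∈ W, ∃ (V : X.Opens) (h : V ≤ W), x ∈ V ∧ resM M h s = resM M h t) : s = t := by
  choose V h hx e using H
  refine TopCat.Sheaf.eq_of_locally_eq' ⟨M.presheaf, M.isSheaf⟩ (fun x : W => V x.1 x.2) W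
    (fun x => homOfLE (h x.1 x.2)) ?_ s t fun x => e x.1 x.2
  intro x hxW
  exact Opens.mem_iSup.mpr ⟨⟨x, hxW⟩, hx x hxW⟩

lemma exists_glue (M : X.Modules) {ι : Type*} (W : X.Opens) (V : ι → X.Opens) (h : ∀ i, V i ≤ W)
    (hcov : W ≤ ⨆ i, V i) (s : ∀ i, Γ(M, V i))
    (hs : ∀ i j, resM M (inf_le_left : V i ⊓ V j ≤ V i) (s i) = resM M inf_le_right (s j)) :
    ∃ t : Γ(M, W), ∀ i, resM M (h i) t = s i :=
  (TopCat.Sheaf.existsUnique_gluing' ⟨M.presheaf, M.isSheaf⟩ V W (fun i => homOfLE (h i)) hcov s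
    hs).exists

lemma exists_glue₂ (M : X.Modules) {W V V' : X.Opens} (h : V ≤ W) (h' : V' ≤ W)
    (hcov : W ≤ V ⊔ V') (s : Γ(M, V)) (s' : Γ(M, V'))
    (hs : resM M (inf_le_left : V ⊓ V' ≤ V) s = resM M inf_le_right s') :
    ∃ t : Γ(M, W), resM M h t = s ∧ resM M h' t = s' := by
  let U : Bool → X.Opens := fun b => if b then V else V'
  obtain ⟨t, ht⟩ := exists_glue M W U (by rintro (_ | _); exacts [h', h])
    (hcov.trans (sup_le (le_iSup U true) (le_iSup U false)))
    (fun | true => s | false => s') (by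
      rintro (_ | _) (_ | _)
      · rfl
      · have e : V' ⊓ V ≤ V ⊓ V' := le_of_eq (inf_comm _ _)
        have := congrArg (resM M e) hs
        rw [resM_resM, resM_resM] at this
        exact this.symm
      · exact hs
      · rfl)
  exact ⟨t, ht true, ht false⟩

lemma section_ext₂ (M : X.Modules) {W V V' : X.Opens} (h : V ≤ W) (h' : V' ≤ W)
    (hcov : W ≤ V ⊔ V') {s t : Γ(M, W)} (e : resM M h s = resM M h t)
    (e' : resM M h' s = resM M h' t) : s = t :=
  section_ext M fun _ hx => (hcov hx).elim (fun hV => ⟨V, h, hV, e⟩) fun hV => ⟨V', h', hV, e'⟩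

/-- The sheaf of modules which represents the sections over `U`. -/
def freeOn (U : X.Opens) : X.Modules :=
  (PresheafOfModules.sheafification (𝟙 X.ringCatSheaf.obj)).obj
    ((PresheafOfModules.free X.ringCatSheaf.obj).obj (yoneda.obj U))

/-- Morphisms from `freeOn U` are sections over `U`. -/
def freeOnEquiv (U : X.Opens) (M : X.Modules) : (freeOn U ⟶ M) ≃ Γ(M, U) :=
  ((PresheafOfModules.sheafificationAdjunction (𝟙 X.ringCatSheaf.obj)).homEquiv _ M).trans
    PresheafOfModules.freeYonedaEquiv

lemma freeOnEquiv_comp {U : X.Opens} {M N : X.Modules} (f : freeOn U ⟶ M) (φ : M ⟶ N) :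
    freeOnEquiv U N (f ≫ φ) = φ.app U (freeOnEquiv U M f) := by
  have h := (PresheafOfModules.sheafificationAdjunction
    (𝟙 X.ringCatSheaf.obj)).homEquiv_naturality_right f φ
  exact congrArg PresheafOfModules.freeYonedaEquiv h

/-- The inclusion `freeOn V ⟶ freeOn U` for `V ≤ U`. -/
def freeOnMap {V U : X.Opens} (h : V ≤ U) : freeOn V ⟶ freeOn U :=
  (PresheafOfModules.sheafification (𝟙 X.ringCatSheaf.obj)).map
    ((PresheafOfModules.free X.ringCatSheaf.obj).map (yoneda.map (homOfLE h)))

/-- There is at most one inclusion of `W` into `V`, so the map of free presheaves is injective on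
bases over each `W`; sheafification preserves monomorphisms. Extending maps along this inclusion is
what makes injective sheaves flasque. -/
instance {V U : X.Opens} (h : V ≤ U) : Mono (freeOnMap h) := by
  have : Mono ((PresheafOfModules.free X.ringCatSheaf.obj).map (yoneda.map (homOfLE h))) := by
    apply PresheafOfModules.mono_of_injective
    intro W
    change Function.Injective (Finsupp.mapDomain _)
    apply Finsupp.mapDomain_injective
    intro a b _
    exact Subsingleton.elim (α := W.unop ⟶ V) a b
  exact inferInstanceAs (Mono (C := SheafOfModules X.ringCatSheaf)
    ((PresheafOfModules.sheafification (𝟙 X.ringCatSheaf.obj)).map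
      ((PresheafOfModules.free X.ringCatSheaf.obj).map (yoneda.map (homOfLE h)))))

lemma freeYonedaEquiv_opens {V U : X.Opens} (h : V ≤ U) {M : X.PresheafOfModules}
    (g : (PresheafOfModules.free X.ringCatSheaf.obj).obj (yoneda.obj U) ⟶ M) :
    PresheafOfModules.freeYonedaEquiv ((PresheafOfModules.free X.ringCatSheaf.obj).map
      (yoneda.map (homOfLE h)) ≫ g) =
    M.map (homOfLE h).op (PresheafOfModules.freeYonedaEquiv g) :=
  freeYonedaEquiv_map _ (homOfLE h) g

lemma freeOnEquiv_map {V U : X.Opens} (h : V ≤ U) {M : X.Modules} (f : freeOn U ⟶ M) :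
    freeOnEquiv V M (freeOnMap h ≫ f) = resM M h (freeOnEquiv U M f) := by
  have h1 := (PresheafOfModules.sheafificationAdjunction
    (𝟙 X.ringCatSheaf.obj)).homEquiv_naturality_left
      ((PresheafOfModules.free X.ringCatSheaf.obj).map (yoneda.map (homOfLE h))) f
  refine (congrArg PresheafOfModules.freeYonedaEquiv h1).trans ?_
  exact freeYonedaEquiv_opens h _

/-- Injective sheaves of modules are flasque. -/
lemma resM_surjective_of_injective (J : X.Modules) [Injective J] {V U : X.Opens} (h : V ≤ U) :
    Function.Surjective (resM J h) := by
  intro s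
  obtain ⟨f, rfl⟩ := (freeOnEquiv V J).surjective s
  refine ⟨freeOnEquiv U J (Injective.factorThru f (freeOnMap h)), ?_⟩
  rw [← freeOnEquiv_map, Injective.comp_factorThru]

lemma app_injective_of_mono {M N : X.Modules} (φ : M ⟶ N) [Mono φ] (U : X.Opens) :
    Function.Injective (φ.app U) := by
  intro s t h
  obtain ⟨f, rfl⟩ := (freeOnEquiv U M).surjective s
  obtain ⟨g, rfl⟩ := (freeOnEquiv U M).surjective t
  rw [← freeOnEquiv_comp, ← freeOnEquiv_comp] at h
  rw [(cancel_mono φ).mp ((freeOnEquiv U N).injective h)]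

lemma freeOnEquiv_zero (U : X.Opens) (M : X.Modules) : freeOnEquiv U M 0 = 0 := by
  have := freeOnEquiv_comp (0 : freeOn U ⟶ M) (0 : M ⟶ M)
  rw [comp_zero] at this
  exact this

lemma isLocallySurjective_of_epi {M N : X.Modules} (φ : M ⟶ N) [Epi φ] :
    PresheafOfModules.IsLocallySurjective (Opens.grothendieckTopology X)
      ((Scheme.Modules.toPresheafOfModules X).map φ) := by
  have : Epi (C := SheafOfModules X.ringCatSheaf) φ := ‹Epi φ›
  exact isLocallySurjective_forget_map _ φ

lemma exists_local_lift_of_epi {M N : X.Modules} (φ : M ⟶ N) [Epi φ] {U : X.Opens} (n : Γ(N, U))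
    {x : X} (hx : x ∈ U) :
    ∃ (V : X.Opens) (h : V ≤ U), x ∈ V ∧ ∃ m : Γ(M, V), φ.app V m = resM N h n := by
  have := isLocallySurjective_of_epi φ
  obtain ⟨V, h, ⟨m, hm⟩, hxV⟩ := (TopCat.Presheaf.isLocallySurjective_iff _).mp this U n x hx
  exact ⟨V, h, hxV, m, hm⟩

/-- Exactness on sections at the left end. -/
lemma exists_of_exact_mono {S : ShortComplex X.Modules} (hS : S.Exact) [Mono S.f] {U : X.Opens}
    (m : Γ(S.X₂, U)) (hm : S.g.app U m = 0) : ∃ k : Γ(S.X₁, U), S.f.app U k = m := by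
  obtain ⟨f, rfl⟩ := (freeOnEquiv U _).surjective m
  rw [← freeOnEquiv_comp, ← freeOnEquiv_zero] at hm
  refine ⟨freeOnEquiv U _ (hS.lift f ((freeOnEquiv U _).injective hm)), ?_⟩
  rw [← freeOnEquiv_comp, hS.lift_f]

/-- Exactness on sections, locally. -/
lemma exists_local_of_exact {S : ShortComplex X.Modules} (hS : S.Exact) {U : X.Opens}
    (m : Γ(S.X₂, U)) (hm : S.g.app U m = 0) {x : X} (hx : x ∈ U) :
    ∃ (V : X.Opens) (h : V ≤ U), x ∈ V ∧ ∃ k : Γ(S.X₁, V), S.f.app V k = resM S.X₂ h m := by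
  obtain ⟨f, rfl⟩ := (freeOnEquiv U _).surjective m
  rw [← freeOnEquiv_comp, ← freeOnEquiv_zero] at hm
  have hm' := (freeOnEquiv U _).injective hm
  -- Exactness makes `S.f` an epimorphism onto the kernel of `S.g`, where `m` lives; the local lift
  -- is taken along that epimorphism.
  have : Epi (kernel.lift S.g S.f S.zero) := hS.epi_kernelLift
  obtain ⟨V, h, hxV, k, hk⟩ := exists_local_lift_of_epi (kernel.lift S.g S.f S.zero)
    (freeOnEquiv U _ (kernel.lift S.g f hm')) hx
  refine ⟨V, h, hxV, k, ?_⟩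
  have h1 : S.f = kernel.lift S.g S.f S.zero ≫ kernel.ι _ := by simp
  have h2 : f = kernel.lift S.g f hm' ≫ kernel.ι _ := by simp
  rw [h1, h2, freeOnEquiv_comp, ← app_resM, ← hk]
  rfl

end Sections

/-! ### The first right derived functor -/

section Derived

/-- If `k` is a kernel of `g`, the homology of `f ≫ k` and `g` is the cokernel of `f`. -/
lemma nonempty_homology_iso_cokernel {A : Type*} [Category* A] [Abelian A] {X K Y Z : A}
    (f : X ⟶ K) (k : K ⟶ Y) (g : Y ⟶ Z) (w : k ≫ g = 0) (hk : IsLimit (KernelFork.ofι k w))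
    (w' : (f ≫ k) ≫ g = 0) :
    Nonempty ((ShortComplex.mk (f ≫ k) g w').homology ≅ cokernel f) := by
  have e : hk.lift (KernelFork.ofι (f ≫ k) w') = f :=
    Fork.IsLimit.hom_ext hk (Fork.IsLimit.lift_ι hk)
  let L : (ShortComplex.mk (f ≫ k) g w').LeftHomologyData :=
    { K := K
      H := cokernel f
      i := k
      π := cokernel.π f
      wi := w
      hi := hk
      wπ := (congrArg (· ≫ cokernel.π f) e).trans (cokernel.condition f)
      hπ := CokernelCofork.IsColimit.ofπ _ _
        (fun q hq => cokernel.desc f q ((congrArg (· ≫ q) e).symm.trans hq))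
        (fun q hq => cokernel.π_desc _ _ _)
        (fun q hq m hm => by rw [← cancel_epi (cokernel.π f), hm, cokernel.π_desc]) }
  exact ⟨L.homologyIso⟩

/-- In an injective resolution take `J` to be the term in degree 0 and `Q` the kernel of the
differential from degree 1 to degree 2; exactness makes `Q` the quotient of `J` by `X`. As `G` is
left exact, `G(Q)` is still the kernel of the next differential, so the first cohomology of the
image complex is the cokernel of `G(J) → G(Q)`. -/
lemma exists_rightDerived_one_presentation {A B : Type*} [Category* A] [Category* B] [Abelian A]
    [Abelian B] [HasInjectiveResolutions A] (G : A ⥤ B) [G.Additive] [PreservesFiniteLimits G]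
    (X : A) :
    ∃ (J Q : A) (i : X ⟶ J) (p : J ⟶ Q) (w : i ≫ p = 0)
      (δ : G.obj Q ⟶ (G.rightDerived 1).obj X) (w' : G.map p ≫ δ = 0),
      Injective J ∧ (ShortComplex.mk i p w).ShortExact ∧ (ShortComplex.mk _ δ w').Exact ∧
        Epi δ := by
  let I := injectiveResolution X
  let d := I.cocomplex.d 0 1
  let d' := I.cocomplex.d 1 2
  have hd : d ≫ d' = 0 := I.cocomplex.d_comp_d 0 1 2
  let p : I.cocomplex.X 0 ⟶ kernel d' := kernel.lift d' d hd
  have hp : Epi p := (I.exact_succ 0).epi_kernelLift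
  have hpd : p ≫ kernel.ι d' = d := kernel.lift_ι _ _ _
  let i : X ⟶ I.cocomplex.X 0 := I.ι.f 0
  have hi : Mono i := inferInstanceAs (Mono (I.ι.f 0))
  have hw : i ≫ p = 0 := by
    rw [← cancel_mono (kernel.ι d'), Category.assoc, hpd, zero_comp]
    exact I.ι_f_zero_comp_complex_d
  have hex : (ShortComplex.mk i d I.ι_f_zero_comp_complex_d).Exact := I.exact₀
  have hex' : (ShortComplex.mk i p hw).Exact := by
    refine ShortComplex.exact_of_f_is_kernel _ ?_
    refine KernelFork.IsLimit.ofι' _ _ fun k hk => ⟨hex.lift k ?_, hex.lift_f _ _⟩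
    have hk' : k ≫ p = 0 := hk
    change k ≫ d = 0
    rw [← hpd, reassoc_of% hk', zero_comp]
  have w1 : G.map (kernel.ι d') ≫ G.map d' = 0 := by
    rw [← G.map_comp, kernel.condition, G.map_zero]
  have hk := isLimitForkMapOfIsLimit' G (kernel.condition d') (kernelIsKernel d')
  obtain ⟨e⟩ := nonempty_homology_iso_cokernel (G.map p) (G.map (kernel.ι d')) (G.map d') w1 hk
    (by rw [Category.assoc, w1, comp_zero])
  let K := (G.mapHomologicalComplex (ComplexShape.up ℕ)).obj I.cocomplex
  have hK : G.map d ≫ G.map d' = 0 := by rw [← G.map_comp, hd, G.map_zero]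
  let e' : (G.rightDerived 1).obj X ≅ (ShortComplex.mk (G.map d) (G.map d') hK).homology :=
    I.isoRightDerivedObj G 1 ≪≫ K.homologyIsoSc' 0 1 2 (by simp) (by simp)
  have hc : G.map d = G.map p ≫ G.map (kernel.ι d') := by rw [← G.map_comp, hpd]
  have hiso : Nonempty ((G.rightDerived 1).obj X ≅ cokernel (G.map p)) := by
    simp only [hc] at e'
    exact ⟨e' ≪≫ e⟩
  obtain ⟨e⟩ := hiso
  refine ⟨_, _, i, p, hw, cokernel.π (G.map p) ≫ e.inv, ?_, I.injective 0,
    { exact := hex', mono_f := hi, epi_g := hp }, ?_, inferInstance⟩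
  · rw [cokernel.condition_assoc, zero_comp]
  · refine ShortComplex.exact_of_g_is_cokernel _ ?_
    exact CokernelCofork.IsColimit.ofπ _ _
        (fun q hq => e.hom ≫ cokernel.desc _ q hq)
        (fun q hq => by simp)
        (fun q hq m hm => by rw [← cancel_epi (cokernel.π (G.map p) ≫ e.inv), hm]; simp)

end Derived

section HigherDirectImage

variable {X S : Scheme.{u}}

instance (π : X ⟶ S) : PreservesFiniteLimits (Scheme.Modules.pushforward π) := by
  have : PreservesLimits (Scheme.Modules.pushforward π) :=
    (Scheme.Modules.pullbackPushforwardAdjunction π).rightAdjoint_preservesLimits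
  infer_instance

/-- The connecting map presenting `R¹π_* F` as a cokernel. -/
lemma exists_connecting_map (π : X ⟶ S) (F : X.Modules) :
    ∃ (J Q : X.Modules) (i : F ⟶ J) (p : J ⟶ Q) (w : i ≫ p = 0)
      (δ : (Scheme.Modules.pushforward π).obj Q ⟶ (higherDirectImage π 1).obj F)
      (w' : (Scheme.Modules.pushforward π).map p ≫ δ = 0),
      Injective J ∧ (ShortComplex.mk i p w).ShortExact ∧ (ShortComplex.mk _ δ w').Exact ∧
        Epi δ :=
  exists_rightDerived_one_presentation (Scheme.Modules.pushforward π) F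

end HigherDirectImage

/-! ### Sheaves associated with quotients -/

section QuotientSite

variable {T : Type u} [SmallCategory T] {J : GrothendieckTopology T} (R : Sheaf J RingCat.{u})

/-- Sheafification inverts locally bijective maps, and the counit identifies the sheafification of a
sheaf with the sheaf itself. -/
lemma nonempty_sheafification_iso {P : PresheafOfModules.{u} R.obj} {N : SheafOfModules.{u} R}
    (d : P ⟶ N.val) (h1 : PresheafOfModules.IsLocallySurjective J d)
    (h2 : PresheafOfModules.IsLocallyInjective J d) :
    Nonempty ((PresheafOfModules.sheafification (𝟙 R.obj)).obj P ≅ N) := by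
  let a := PresheafOfModules.sheafification (𝟙 R.obj)
  let adj := PresheafOfModules.sheafificationAdjunction (𝟙 R.obj)
  let d' : P ⟶ (SheafOfModules.forget R ⋙ PresheafOfModules.restrictScalars (𝟙 R.obj)).obj N := d
  have h3 : IsIso (a.map d') := by
    have : Presheaf.IsLocallyInjective J ((PresheafOfModules.toPresheaf R.obj).map d') := h2
    have : Presheaf.IsLocallySurjective J ((PresheafOfModules.toPresheaf R.obj).map d') := h1
    have h4 : (J.W.inverseImage (PresheafOfModules.toPresheaf R.obj)) d' :=
      J.W_of_isLocallyBijective ((PresheafOfModules.toPresheaf R.obj).map d')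
    rw [PresheafOfModules.inverseImage_W_toPresheaf_eq_inverseImage_isomorphisms (𝟙 R.obj)] at h4
    exact h4
  exact ⟨asIso (a.map d') ≪≫ asIso (adj.counit.app N)⟩

end QuotientSite

section Quotient

variable {S : Scheme.{u}}

/-- The hypotheses say that the map induced on the presheaf cokernel is locally injective and
locally surjective. This reduces the theorem to statements about sections near a point of the base.
-/
lemma nonempty_quotientSheaf_iso {M : S.PresheafOfModules} {N : M.Submodule} {T : S.Modules}
    (φ : M ⟶ (Scheme.Modules.toPresheafOfModules S).obj T)
    (hN : ∀ (U : S.Opens) (m : M.obj (op U)), m ∈ N.obj (op U) → φ.app (op U) m = 0)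
    (hinj : ∀ (U : S.Opens) (m : M.obj (op U)), φ.app (op U) m = 0 → ∀ x ∈ U,
      ∃ (V : S.Opens) (h : V ≤ U), x ∈ V ∧ M.map (homOfLE h).op m ∈ N.obj (op V))
    (hsurj : ∀ (U : S.Opens) (t : Γ(T, U)), ∀ x ∈ U,
      ∃ (V : S.Opens) (h : V ≤ U), x ∈ V ∧ ∃ m : M.obj (op V), φ.app (op V) m = resM T h t) :
    Nonempty (quotientSheaf M N ≅ T) := by
  have hN' : N.ι ≫ φ = 0 := by
    ext U m
    exact hN U.unop m.1 m.2
  let d := cokernel.desc N.ι φ hN'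
  have hd (U : S.Opens) (m : M.obj (op U)) :
      d.app (op U) ((cokernel.π N.ι).app (op U) m) = φ.app (op U) m := by
    conv_rhs => rw [← cokernel.π_desc N.ι φ hN']
    rfl
  have hsurjπ (U : S.Opens) : Function.Surjective ((cokernel.π N.ι).app (op U)) :=
    PresheafOfModules.surjective_of_epi (cokernel.π N.ι) (op U)
  have h1 : PresheafOfModules.IsLocallySurjective (Opens.grothendieckTopology S) d := by
    refine (TopCat.Presheaf.isLocallySurjective_iff _).mpr fun U t x hx => ?_
    obtain ⟨V, h, hxV, m, hm⟩ := hsurj U t x hx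
    exact ⟨V, h, ⟨(cokernel.π N.ι).app (op V) m, (hd V m).trans hm⟩, hxV⟩
  have h2 : PresheafOfModules.IsLocallyInjective (Opens.grothendieckTopology S) d := by
    refine ⟨fun {U} c c' hcc' => ?_⟩
    intro x hx
    obtain ⟨m, rfl⟩ := hsurjπ U.unop c
    obtain ⟨m', rfl⟩ := hsurjπ U.unop c'
    have h3 : φ.app (op U.unop) (m - m') = 0 := by
      rw [map_sub, sub_eq_zero]
      exact (hd _ m).symm.trans (hcc'.trans (hd _ m'))
    obtain ⟨V, h, hxV, hm⟩ := hinj _ _ h3 x hx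
    refine ⟨V, homOfLE h, ?_, hxV⟩
    have h4 : (cokernel.π N.ι).app (op V) (M.map (homOfLE h).op (m - m')) = 0 :=
      congrArg (fun f : N.toPresheafOfModules ⟶ cokernel N.ι => f.app (op V) ⟨_, hm⟩)
        (cokernel.condition N.ι)
    have h5 := PresheafOfModules.naturality_apply (cokernel.π N.ι) (homOfLE h).op (m - m')
    rw [h4, map_sub, map_sub] at h5
    exact sub_eq_zero.mp h5.symm
  exact nonempty_sheafification_iso S.ringCatSheaf d h1 h2

end Quotient

/-! ### Quasi-coherent sheaves on affine open subsets -/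

section Quasicoherent

variable {X : Scheme.{u}}

lemma spec_eq_zero_of_localizing {R : CommRingCat.{u}} (N : (Spec R).Modules)
    (h : IsLocalizing (modulesSpecToSheaf.obj N)) (f : R) {D : (Spec R).Opens}
    (hD : D = PrimeSpectrum.basicOpen f) (s : Γ(N, ⊤))
    (hs : resM N (le_top : D ≤ ⊤) s = 0) : ∃ n : ℕ, f ^ n • s = 0 := by
  subst hD
  let φ := ((modulesSpecToSheaf.obj N).obj.map (PrimeSpectrum.basicOpen f).leTop.op).hom
  have hf : IsLocalizedModule.Away f φ := h f
  obtain ⟨⟨_, n, rfl⟩, hn⟩ := (IsLocalizedModule.eq_zero_iff (.powers f) φ).mp hs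
  exact ⟨n, hn⟩

lemma spec_exists_of_localizing {R : CommRingCat.{u}} (N : (Spec R).Modules)
    (h : IsLocalizing (modulesSpecToSheaf.obj N)) (f : R) {D : (Spec R).Opens}
    (hD : D = PrimeSpectrum.basicOpen f) (s : Γ(N, D)) :
    ∃ (n : ℕ) (t : Γ(N, ⊤)), f ^ n • s = resM N (le_top : D ≤ ⊤) t := by
  subst hD
  let φ := ((modulesSpecToSheaf.obj N).obj.map (PrimeSpectrum.basicOpen f).leTop.op).hom
  have hf : IsLocalizedModule.Away f φ := h f
  obtain ⟨n, t, ht⟩ := hf.surj _ _ s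
  exact ⟨n, t, ht⟩

/-- The action on the restricted sheaf passes through the identification of functions on the
spectrum with functions on `V`. Unwinding it lets localization statements on the spectrum be read on
`X`. -/
lemma restrict_fromSpec_smul (M : X.Modules) {V : X.Opens} (hV : IsAffineOpen V)
    (W : (Spec Γ(X, V)).Opens) (h : hV.fromSpec ''ᵁ W ≤ V) (r : Γ(X, V))
    (m : Γ(M.restrict hV.fromSpec, W)) :
    (r • m : Γ(M.restrict hV.fromSpec, W)) =
      (res h r • (show Γ(M, hV.fromSpec ''ᵁ W) from m) : Γ(M, hV.fromSpec ''ᵁ W)) := by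
  have h1 := Scheme.Hom.appLE_appIso_inv hV.fromSpec (U := V) (V := W)
    (hV.fromSpec_preimage_self.symm ▸ le_top)
  rw [Scheme.Hom.appLE, hV.fromSpec_app_of_le V le_rfl] at h1
  have h2 : (hV.fromSpec.appIso W).inv (((Spec Γ(X, V)).presheaf.map W.leTop.op)
      ((Scheme.ΓSpecIso Γ(X, V)).inv r)) = res h r := by
    rw [res]
    refine Eq.trans ?_ (congrArg (fun f => f.hom r) h1)
    simp only [← ConcreteCategory.comp_apply, Category.assoc]
    have e : X.presheaf.map (homOfLE (le_refl V)).op = 𝟙 _ := X.presheaf.map_id _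
    rw [e, Category.id_comp, ← Functor.map_comp_assoc]
    rfl
  rw [← h2]
  rfl

/-- Sections of a quasi-coherent sheaf over an affine open subset which vanish on a basic open
subset. -/
lemma exists_pow_smul_eq_zero (M : X.Modules)
    (hM : SheafOfModules.IsQuasicoherent (R := X.ringCatSheaf) M)
    {V : X.Opens} (hV : IsAffineOpen V) (f : Γ(X, V)) (s : Γ(M, V))
    (hs : resM M (X.basicOpen_le f) s = 0) : ∃ n : ℕ, f ^ n • s = 0 := by
  have hM' : M.IsQuasicoherent := hM
  have h1 : IsIso (M.restrict hV.fromSpec).fromTildeΓ := inferInstance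
  obtain ⟨D, hD⟩ : ∃ D : (Spec Γ(X, V)).Opens, D = PrimeSpectrum.basicOpen f := ⟨_, rfl⟩
  have eD : hV.fromSpec ''ᵁ D = X.basicOpen f := by
    rw [hD]
    exact hV.fromSpec_image_basicOpen f
  have eT : hV.fromSpec ''ᵁ ⊤ = V := by
    rw [Scheme.Hom.image_top_eq_opensRange, hV.opensRange_fromSpec]
  have h3 : resM M (hV.fromSpec.image_mono (le_top : D ≤ ⊤))
      (resM M eT.le s) = 0 := by
    rw [resM_resM, ← resM_resM M eD.le (X.basicOpen_le f), hs, map_zero]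
  obtain ⟨n, hn⟩ := spec_eq_zero_of_localizing (M.restrict hV.fromSpec)
    ((isIso_fromTildeΓ_iff_isLocalizing _).mp h1) f hD (resM M eT.le s) h3
  refine ⟨n, ?_⟩
  have h5 : res eT.le (f ^ n) • resM M eT.le s = 0 :=
    (restrict_fromSpec_smul M hV ⊤ eT.le (f ^ n) (resM M eT.le s)).symm.trans hn
  rw [← resM_smul] at h5
  have h6 := congrArg (resM M eT.ge) h5
  rwa [resM_resM, resM_self, map_zero] at h6

/-- Sections of a quasi-coherent sheaf over a basic open subset of an affine open subset. -/
lemma exists_resM_eq_pow_smul (M : X.Modules)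
    (hM : SheafOfModules.IsQuasicoherent (R := X.ringCatSheaf) M)
    {V : X.Opens} (hV : IsAffineOpen V) (f : Γ(X, V)) (s : Γ(M, X.basicOpen f)) :
    ∃ (n : ℕ) (t : Γ(M, V)),
      resM M (X.basicOpen_le f) t = res (X.basicOpen_le f) f ^ n • s := by
  have hM' : M.IsQuasicoherent := hM
  have h1 : IsIso (M.restrict hV.fromSpec).fromTildeΓ := inferInstance
  obtain ⟨D, hD⟩ : ∃ D : (Spec Γ(X, V)).Opens, D = PrimeSpectrum.basicOpen f := ⟨_, rfl⟩
  have eD : hV.fromSpec ''ᵁ D = X.basicOpen f := by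
    rw [hD]
    exact hV.fromSpec_image_basicOpen f
  have eT : hV.fromSpec ''ᵁ ⊤ = V := by
    rw [Scheme.Hom.image_top_eq_opensRange, hV.opensRange_fromSpec]
  obtain ⟨n, t, h5⟩ : ∃ (n : ℕ) (t : Γ(M, hV.fromSpec ''ᵁ ⊤)),
      res (eD.le.trans (X.basicOpen_le f)) (f ^ n) • resM M eD.le s =
        resM M (hV.fromSpec.image_mono (le_top : D ≤ ⊤)) t := by
    obtain ⟨n, t, ht⟩ := spec_exists_of_localizing (M.restrict hV.fromSpec)
      ((isIso_fromTildeΓ_iff_isLocalizing _).mp h1) f hD (resM M eD.le s)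
    exact ⟨n, t, (restrict_fromSpec_smul M hV _ (eD.le.trans (X.basicOpen_le f)) (f ^ n) _).symm.trans ht⟩
  refine ⟨n, resM M eT.ge t, ?_⟩
  have h6 := congrArg (resM M eD.ge) h5
  rw [resM_smul, resM_resM, resM_resM, resM_self, res_res, map_pow] at h6
  rw [resM_resM, h6]

end Quasicoherent

/-! ### Lifting sections over affine open subsets -/

section Lifting

variable {X : Scheme.{u}} {M : X.Modules}

lemma basicOpen_res' {V W : X.Opens} (h : W ≤ V) (f : Γ(X, V)) :
    X.basicOpen (res h f) = W ⊓ X.basicOpen f :=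
  X.basicOpen_res f (homOfLE h).op

/-- Holding for all large exponents, rather than for one, allows finitely many such conditions to
share an exponent. -/
lemma eventually_pow_smul_eq_zero
    (hM : SheafOfModules.IsQuasicoherent (R := X.ringCatSheaf) M)
    {W : X.Opens} (hW : IsAffineOpen W) {V : X.Opens} (h : W ≤ V) (f : Γ(X, V)) (s : Γ(M, W))
    (hs : resM M (inf_le_left : W ⊓ X.basicOpen f ≤ W) s = 0) :
    ∀ᶠ n : ℕ in Filter.atTop, res h f ^ n • s = 0 := by
  have e := basicOpen_res' h f
  obtain ⟨n, hn⟩ := exists_pow_smul_eq_zero M hM hW (res h f) s (by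
    rw [← resM_resM M e.le inf_le_left, hs, map_zero])
  refine Filter.eventually_atTop.mpr ⟨n, fun m hm => ?_⟩
  obtain ⟨k, rfl⟩ := Nat.exists_eq_add_of_le' hm
  rw [pow_add, mul_smul, hn, smul_zero]

lemma eventually_exists_resM_eq_pow_smul
    (hM : SheafOfModules.IsQuasicoherent (R := X.ringCatSheaf) M)
    {W : X.Opens} (hW : IsAffineOpen W) {V : X.Opens} (h : W ≤ V) (f : Γ(X, V))
    (s : Γ(M, W ⊓ X.basicOpen f)) :
    ∀ᶠ n : ℕ in Filter.atTop, ∃ t : Γ(M, W),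
      resM M (inf_le_left : W ⊓ X.basicOpen f ≤ W) t =
        res ((inf_le_left : W ⊓ X.basicOpen f ≤ W).trans h) f ^ n • s := by
  have e := basicOpen_res' h f
  obtain ⟨n, t, ht⟩ := exists_resM_eq_pow_smul M hM hW (res h f) (resM M e.le s)
  have ht' := congrArg (resM M e.ge) ht
  rw [resM_smul, resM_resM, resM_resM, resM_self, map_pow, res_res, res_res] at ht'
  refine Filter.eventually_atTop.mpr ⟨n, fun m hm => ?_⟩
  obtain ⟨k, rfl⟩ := Nat.exists_eq_add_of_le' hm
  refine ⟨res h f ^ k • t, ?_⟩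
  rw [resM_smul, ht', map_pow, res_res, smul_smul, pow_add]

/-- A Čech `1`-cocycle of a quasi-coherent sheaf on a covering of an affine open subset by finitely
many basic open subsets is a coboundary. -/
lemma exists_splitting (hM : SheafOfModules.IsQuasicoherent (R := X.ringCatSheaf) M)
    {V : X.Opens} (hV : IsAffineOpen V) {ι : Type*} [Finite ι] (v : ι → Γ(X, V))
    (hv : Ideal.span (Set.range v) = ⊤)
    (c : ∀ i j, Γ(M, X.basicOpen (v i) ⊓ X.basicOpen (v j)))
    (hc : ∀ (i j k : ι) (W : X.Opens) (hi : W ≤ X.basicOpen (v i)) (hj : W ≤ X.basicOpen (v j))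
      (hk : W ≤ X.basicOpen (v k)), resM M (le_inf hi hk) (c i k) =
        resM M (le_inf hi hj) (c i j) + resM M (le_inf hj hk) (c j k)) :
    ∃ s : ∀ i, Γ(M, X.basicOpen (v i)), ∀ i j,
      resM M inf_le_left (s i) - resM M inf_le_right (s j) = c i j := by
  have := Fintype.ofFinite ι
  have hD (i) : X.basicOpen (v i) ≤ V := X.basicOpen_le (v i)
  have hD2 (i j) : X.basicOpen (v i) ⊓ X.basicOpen (v j) ≤ V := inf_le_left.trans (hD i)
  -- One power of `v k` clears the denominators of every `c i k`, giving an extension `e i k` to the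
  -- basic open of `v i`.
  obtain ⟨N, hN⟩ : ∃ N : ℕ, ∀ i k, ∃ t : Γ(M, X.basicOpen (v i)),
      resM M inf_le_left t = res (hD2 i k) (v k) ^ N • c i k := by
    refine Filter.Eventually.exists (f := Filter.atTop) ?_
    rw [Filter.eventually_all]; intro i
    rw [Filter.eventually_all]; intro k
    exact eventually_exists_resM_eq_pow_smul hM (hV.basicOpen (v i)) (hD i) (v k) (c i k)
  choose e he using hN
  have haff (i j) : IsAffineOpen (X.basicOpen (v i) ⊓ X.basicOpen (v j)) := by
    rw [← basicOpen_res' (hD i)]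
    exact (hV.basicOpen (v i)).basicOpen _
  -- On triple overlaps the cocycle identity gives `e i k - e j k = v k ^ N • c i j`; on the overlap
  -- of `i` and `j` alone this holds after multiplication by a further power of `v k`.
  obtain ⟨L, hL⟩ : ∃ L : ℕ, ∀ i j k, res (hD2 i j) (v k) ^ L •
      (resM M inf_le_left (e i k) - resM M inf_le_right (e j k) -
        res (hD2 i j) (v k) ^ N • c i j) = 0 := by
    refine Filter.Eventually.exists (f := Filter.atTop) ?_
    rw [Filter.eventually_all]; intro i
    rw [Filter.eventually_all]; intro j
    rw [Filter.eventually_all]; intro k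
    refine eventually_pow_smul_eq_zero hM (haff i j) (hD2 i j) (v k) _ ?_
    have hi : X.basicOpen (v i) ⊓ X.basicOpen (v j) ⊓ X.basicOpen (v k) ≤ X.basicOpen (v i) :=
      inf_le_left.trans inf_le_left
    have hj : X.basicOpen (v i) ⊓ X.basicOpen (v j) ⊓ X.basicOpen (v k) ≤ X.basicOpen (v j) :=
      inf_le_left.trans inf_le_right
    have hk : X.basicOpen (v i) ⊓ X.basicOpen (v j) ⊓ X.basicOpen (v k) ≤ X.basicOpen (v k) :=
      inf_le_right
    have h1 := congrArg (resM M (le_inf hi hk)) (he i k)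
    have h2 := congrArg (resM M (le_inf hj hk)) (he j k)
    rw [resM_smul, resM_resM, map_pow, res_res] at h1 h2
    rw [map_sub, map_sub, resM_resM, resM_resM, resM_smul, map_pow, res_res, h1, h2,
      hc i j k _ hi hj hk, smul_add, sub_sub, add_comm, sub_eq_zero]
  -- A partition of unity: since `e i k` stands for `v k ^ N • c i k`, the sum of the `a k * v k ^ L
  -- • e i k` is a weighted mean of the `c i k` over `k`, whose differences are the `c i j`.
  obtain ⟨a, ha⟩ : ∃ a : ι → Γ(X, V), ∑ k, a k * v k ^ (L + N) = 1 := by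
    have h1 := Ideal.span_pow_eq_top (Set.range v) hv (L + N)
    rw [← Set.range_comp] at h1
    exact Ideal.mem_span_range_iff_exists_fun.mp (h1 ▸ Submodule.mem_top)
  refine ⟨fun i => ∑ k, res (hD i) (a k * v k ^ L) • e i k, fun i j => ?_⟩
  have h1 (k : ι) : res (hD2 i j) (a k * v k ^ L) • resM M inf_le_left (e i k) -
      res (hD2 i j) (a k * v k ^ L) • resM M inf_le_right (e j k) =
      res (hD2 i j) (a k * v k ^ (L + N)) • c i j := by
    have h2 := congrArg (fun x => res (hD2 i j) (a k) • x) (hL i j k)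
    simp only [smul_sub, smul_zero, smul_smul, sub_eq_zero] at h2
    rw [map_mul, map_mul, map_pow, map_pow, pow_add, ← mul_assoc]
    rw [mul_assoc]
    exact h2
  simp only [map_sum, resM_smul, res_res, ← Finset.sum_sub_distrib, h1]
  rw [← Finset.sum_smul, ← map_sum, ha, map_one, one_smul]

/-- Sections over affine open subsets lift along epimorphisms with quasi-coherent kernel. -/
lemma app_surjective_of_isAffineOpen {F J Q : X.Modules} {i : F ⟶ J} {p : J ⟶ Q} {w : i ≫ p = 0}
    (hS : (ShortComplex.mk i p w).ShortExact)
    (hF : SheafOfModules.IsQuasicoherent (R := X.ringCatSheaf) F)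
    {V : X.Opens} (hV : IsAffineOpen V) : Function.Surjective (p.app V) := by
  intro q
  have hi : Mono i := hS.mono_f
  have hp : Epi p := hS.epi_g
  -- Local liftability makes the functions on whose basic open `q` lifts generate the unit ideal;
  -- finitely many of them suffice.
  let s : Set Γ(X, V) := {f | ∃ t : Γ(J, X.basicOpen f), p.app _ t = resM Q (X.basicOpen_le f) q}
  have hs : Ideal.span s = ⊤ := by
    rw [← hV.iSup_basicOpen_eq_self_iff]
    refine le_antisymm (iSup_le fun f => X.basicOpen_le _) fun x hx => ?_
    obtain ⟨W, hWV, hxW, t, ht⟩ := exists_local_lift_of_epi p q hx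
    obtain ⟨f, hf, hxf⟩ := hV.exists_basicOpen_le ⟨x, hxW⟩ hx
    refine Opens.mem_iSup.mpr ⟨⟨f, resM J hf t, ?_⟩, hxf⟩
    rw [app_resM, ht, resM_resM]
  obtain ⟨s', hs's, hs'⟩ := (Ideal.span_eq_top_iff_finite s).mp hs
  let v : s' → Γ(X, V) := Subtype.val
  have hv : Ideal.span (Set.range v) = ⊤ := by
    rw [Subtype.range_coe]
    exact hs'
  have hD (j) : X.basicOpen (v j) ≤ V := X.basicOpen_le (v j)
  choose t ht using fun j : s' => hs's j.2
  -- Differences of local lifts form a cocycle in `F`. Splitting it corrects the lifts so that they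
  -- glue.
  have hc (j k : s') : ∃ c : Γ(F, X.basicOpen (v j) ⊓ X.basicOpen (v k)),
      i.app _ c = resM J inf_le_left (t j) - resM J inf_le_right (t k) :=
    exists_of_exact_mono hS.exact _ (by
      change p.app _ _ = 0
      rw [map_sub, app_resM, app_resM, ht, ht, resM_resM, resM_resM, sub_self])
  choose c hc using hc
  obtain ⟨σ, hσ⟩ := exists_splitting hF hV v hv c (fun j k l W hj hk hl => by
    apply app_injective_of_mono i
    rw [map_add, app_resM, app_resM, app_resM, hc, hc, hc]
    simp only [map_sub, resM_resM, sub_add_sub_cancel])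
  have hcov : V ≤ ⨆ j, X.basicOpen (v j) := by
    refine ((hV.iSup_basicOpen_eq_self_iff (s := Set.range v)).mpr hv).ge.trans ?_
    refine iSup_le ?_
    rintro ⟨_, j, rfl⟩
    exact le_iSup (fun j => X.basicOpen (v j)) j
  obtain ⟨T, hT⟩ := exists_glue J V (fun j => X.basicOpen (v j)) hD hcov
    (fun j => t j - i.app _ (σ j)) (fun j k => by
      rw [map_sub, map_sub, ← app_resM, ← app_resM, sub_eq_sub_iff_sub_eq_sub, ← hc, ← hσ,
        map_sub])
  refine ⟨T, section_ext Q fun x hx => ?_⟩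
  obtain ⟨j, hj⟩ := Opens.mem_iSup.mp (hcov hx)
  refine ⟨_, hD j, hj, ?_⟩
  have h0 : p.app (X.basicOpen (v j)) (i.app _ (σ j)) = 0 :=
    congrArg (fun f : F ⟶ Q => f.app (X.basicOpen (v j)) (σ j)) w
  rw [← app_resM, hT, map_sub, h0, sub_zero, ht]

end Lifting

/-! ### Completion along a principal ideal -/

section PrincipalCompletion

/-- An element of the adic completion for a principal ideal `(b)` which vanishes modulo `bⁿ`
is `bⁿ` times the limit of a sequence. -/
lemma exists_divided_sequence {A M : Type u} [CommRing A] [AddCommGroup M] [Module A M]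
    {I : Ideal A} {b : A} (hI : I = Ideal.span {b}) (y : AdicCompletion I M) (n : ℕ)
    (hy : y.val n = 0) :
    ∃ u : ℕ → M, (∀ k, u (k + 1) - u k ∈ (I ^ k • ⊤ : Submodule A M)) ∧
      ∀ k, y.val k = Submodule.Quotient.mk (b ^ n • u k) := by
  have hpow (k : ℕ) (m : M) : m ∈ (I ^ k • ⊤ : Submodule A M) ↔ ∃ w, b ^ k • w = m := by
    rw [hI, Ideal.span_singleton_pow, Submodule.ideal_span_singleton_smul,
      Submodule.mem_smul_pointwise_iff_exists]
    simp
  choose m hm using fun k => Submodule.Quotient.mk_surjective _ (y.val k)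
  have hle (k l : ℕ) (h : k ≤ l) : y.val k = Submodule.Quotient.mk (m l) := by
    rw [← AdicCompletion.transitionMap_comp_eval_apply I M h y]
    change Submodule.factorPow I M h (y.val l) = _
    rw [← hm l]
    rfl
  have h0 : ∃ w, b ^ n • w = m n := by
    rw [← hpow, ← Submodule.Quotient.mk_eq_zero, hm, hy]
  have h1 (j : ℕ) : ∃ w, b ^ (n + j) • w = m (n + j + 1) - m (n + j) := by
    rw [← hpow, ← Submodule.Quotient.eq, hm, ← hle _ _ (Nat.le_succ _)]
  obtain ⟨w, hw⟩ := h0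
  choose v hv using h1
  -- The sum telescopes: consecutive representatives differ by `b ^ (n + j) • v j`, and the first
  -- one is `b ^ n • w`. The quotients by `b ^ n` are chosen, not obtained by cancellation, so `b`
  -- may act on `M` with torsion.
  have h2 (k : ℕ) : b ^ n • (w + ∑ j ∈ Finset.range k, b ^ j • v j) = m (n + k) := by
    induction k with
    | zero => simpa using hw
    | succ k ih =>
      rw [Finset.sum_range_succ, ← add_assoc, smul_add, ih, smul_smul, ← pow_add, hv]
      abel_nf
  refine ⟨fun k => w + ∑ j ∈ Finset.range k, b ^ j • v j, fun k => ?_, fun k => ?_⟩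
  · rw [hpow]
    exact ⟨v k, by simp only [Finset.sum_range_succ]; abel⟩
  · rw [h2, hle k (n + k) (Nat.le_add_left _ _)]

variable {X : Scheme.{u}} {I : X.IdealSheafData} {V V' : X.affineOpens} (h : V'.1 ≤ V.1)

include h in
lemma res_mem_ideal_pow {n : ℕ} {a : Γ(X, V.1)} (ha : a ∈ I.ideal V ^ n) :
    res h a ∈ I.ideal V' ^ n := by
  have h1 : (I.ideal V).map (res h) = I.ideal V' := I.map_ideal h
  rw [← h1, ← Ideal.map_pow]
  exact Ideal.mem_map_of_mem _ ha

lemma resM_mem_smul_top {M : X.Modules} {n : ℕ} {m : Γ(M, V.1)}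
    (hm : m ∈ (I.ideal V ^ n • ⊤ : Submodule Γ(X, V.1) Γ(M, V.1))) :
    resM M h m ∈ (I.ideal V' ^ n • ⊤ : Submodule Γ(X, V'.1) Γ(M, V'.1)) := by
  refine Submodule.smul_induction_on hm (fun a ha m _ => ?_) fun m m' hm hm' => ?_
  · rw [resM_smul]
    exact Submodule.smul_mem_smul (res_mem_ideal_pow h ha) trivial
  · rw [map_add]
    exact add_mem hm hm'

/-- For affine `V` the component at `V` itself determines those at smaller affine opens, by
compatibility at each finite level. -/
lemma completionModule_ext {M : X.Modules} {x y : completionModule I M V.1}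
    (hxy : ∀ n, (x.1 ⟨V, le_rfl⟩).val n = (y.1 ⟨V, le_rfl⟩).val n) : x = y := by
  apply Subtype.ext
  funext V'
  apply AdicCompletion.ext
  intro n
  obtain ⟨a, ha, ha'⟩ := x.2 ⟨V, le_rfl⟩ V' V'.2 n
  obtain ⟨c, hc, hc'⟩ := y.2 ⟨V, le_rfl⟩ V' V'.2 n
  have h1 := hxy n
  rw [ha, hc, Submodule.Quotient.eq] at h1
  rw [ha', hc', Submodule.Quotient.eq, ← map_sub]
  exact resM_mem_smul_top V'.2 h1

/-- The limit of a Cauchy sequence in the completion. -/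
def completionLimit (M : X.Modules) (u : ℕ → Γ(M, V.1))
    (hu : ∀ k, u (k + 1) - u k ∈ (I.ideal V ^ k • ⊤ : Submodule Γ(X, V.1) Γ(M, V.1))) :
    completionModule I M V.1 :=
  ⟨fun V' => AdicCompletion.mk _ _ (AdicCompletion.AdicCauchySequence.mk (I.ideal V'.1) _
      (fun k => resM M V'.2 (u k)) fun k => by
        rw [SModEq.comm, SModEq.sub_mem, ← map_sub]
        exact resM_mem_smul_top V'.2 (hu k)),
    fun V' V'' h n => ⟨resM M V'.2 (u n), rfl, by rw [resM_resM]; rfl⟩⟩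

lemma toCompletionM_val (M : X.Modules) (a : Γ(M, V.1)) (n : ℕ) :
    ((toCompletionM I M V.1 a).1 ⟨V, le_rfl⟩).val n = Submodule.Quotient.mk a := by
  change Submodule.Quotient.mk (resM M le_rfl a) = _
  rw [resM_self]

lemma toCompletion_smul_val (M : X.Modules) (b : Γ(X, V.1)) (y : completionModule I M V.1) (n : ℕ)
    {c : Γ(M, V.1)} (hc : (y.1 ⟨V, le_rfl⟩).val n = Submodule.Quotient.mk c) :
    ((toCompletion I V.1 b • y).1 ⟨V, le_rfl⟩).val n = Submodule.Quotient.mk (b • c) := by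
  change (algebraMap Γ(X, V.1) (AdicCompletion (I.ideal V) Γ(X, V.1)) (res le_rfl b) •
    y.1 ⟨V, le_rfl⟩).val n = _
  rw [AdicCompletion.smul_eval, res_self, hc]
  rfl

lemma completionLimit_val (M : X.Modules) (u : ℕ → Γ(M, V.1))
    (hu : ∀ k, u (k + 1) - u k ∈ (I.ideal V ^ k • ⊤ : Submodule Γ(X, V.1) Γ(M, V.1))) (n : ℕ) :
    ((completionLimit M u hu).1 ⟨V, le_rfl⟩).val n = Submodule.Quotient.mk (u n) := by
  change Submodule.Quotient.mk (resM M le_rfl (u n)) = _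
  rw [resM_self]

lemma exists_divided_sections {M : X.Modules} {b : Γ(X, V.1)}
    (hb : I.ideal V = Ideal.span {b}) (y : completionModule I M V.1) (n : ℕ)
    (hy : (y.1 ⟨V, le_rfl⟩).val n = 0) :
    ∃ u : ℕ → Γ(M, V.1),
      (∀ k, u (k + 1) - u k ∈ (I.ideal V ^ k • ⊤ : Submodule Γ(X, V.1) Γ(M, V.1))) ∧
      ∀ k, (y.1 ⟨V, le_rfl⟩).val k = Submodule.Quotient.mk (b ^ n • u k) :=
  exists_divided_sequence (M := Γ(M, V.1)) hb (y.1 ⟨V, le_rfl⟩) n hy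

lemma eq_pow_smul_completionLimit {M : X.Modules} {b : Γ(X, V.1)} (y : completionModule I M V.1)
    (n : ℕ) (u : ℕ → Γ(M, V.1))
    (hu : ∀ k, u (k + 1) - u k ∈ (I.ideal V ^ k • ⊤ : Submodule Γ(X, V.1) Γ(M, V.1)))
    (hyu : ∀ k, (y.1 ⟨V, le_rfl⟩).val k = Submodule.Quotient.mk (b ^ n • u k)) :
    y = toCompletion I V.1 b ^ n • completionLimit M u hu := by
  rw [← map_pow]
  refine completionModule_ext fun k => ?_
  rw [toCompletion_smul_val M (b ^ n) (completionLimit M u hu) k (completionLimit_val M u hu k),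
    hyu]

lemma exists_eq_pow_smul {M : X.Modules} {b : Γ(X, V.1)} (hb : I.ideal V = Ideal.span {b})
    (y : completionModule I M V.1) (n : ℕ) (hy : (y.1 ⟨V, le_rfl⟩).val n = 0) :
    ∃ y' : completionModule I M V.1, y = toCompletion I V.1 b ^ n • y' :=
  let ⟨_, hu, hyu⟩ := exists_divided_sections hb y n hy
  ⟨_, eq_pow_smul_completionLimit y n _ hu hyu⟩

lemma exists_val_eq_mk {M : X.Modules} (y : completionModule I M V.1) (n : ℕ) :
    ∃ a : Γ(M, V.1), (y.1 ⟨V, le_rfl⟩).val n = Submodule.Quotient.mk a := by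
  obtain ⟨a, ha, -⟩ := y.2 ⟨V, le_rfl⟩ ⟨V, le_rfl⟩ le_rfl n
  exact ⟨a, ha⟩

lemma sub_toCompletionM_val {M : X.Modules} (y : completionModule I M V.1) (n : ℕ) (a : Γ(M, V.1))
    (ha : (y.1 ⟨V, le_rfl⟩).val n = Submodule.Quotient.mk a) :
    ((y - toCompletionM I M V.1 a).1 ⟨V, le_rfl⟩).val n = 0 := by
  have h1 := toCompletionM_val (I := I) M a n
  have h2 : ((y - toCompletionM I M V.1 a).1 ⟨V, le_rfl⟩).val n =
      (y.1 ⟨V, le_rfl⟩).val n - ((toCompletionM I M V.1 a).1 ⟨V, le_rfl⟩).val n := rfl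
  rw [h2, h1, ha, sub_self]

lemma exists_eq_add_of_sub {M : X.Modules} {b : Γ(X, V.1)} {n : ℕ}
    {y w : completionModule I M V.1}
    (h : ∃ y' : completionModule I M V.1, y - w = toCompletion I V.1 b ^ n • y') :
    ∃ y' : completionModule I M V.1, y = w + toCompletion I V.1 b ^ n • y' := by
  obtain ⟨z, hz⟩ := h
  exact ⟨z, sub_eq_iff_eq_add'.mp hz⟩

/-- Density of sections in the completion, with the error exhibited as a multiple of `b ^ n`: take a
representative modulo the `n`-th power of the ideal and divide the difference. -/
lemma exists_eq_toCompletionM_add {M : X.Modules} {b : Γ(X, V.1)}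
    (hb : I.ideal V = Ideal.span {b}) (y : completionModule I M V.1) (n : ℕ) :
    ∃ (a : Γ(M, V.1)), ∃ (y' : completionModule I M V.1),
      y = toCompletionM I M V.1 a + toCompletion I V.1 b ^ n • y' := by
  obtain ⟨a, ha⟩ := exists_val_eq_mk y n
  exact ⟨a, exists_eq_add_of_sub (exists_eq_pow_smul hb _ n (sub_toCompletionM_val y n a ha))⟩

/-- As `b` generates the `n`-th power of the ideal, divisibility by `b` is vanishing at level `n`,
which the completion sees. -/
lemma exists_eq_smul_of_toCompletionM_eq {M : X.Modules} {b : Γ(X, V.1)} {n : ℕ}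
    (hb : I.ideal V ^ n = Ideal.span {b}) (a : Γ(M, V.1)) (y : completionModule I M V.1)
    (hy : toCompletionM I M V.1 a = toCompletion I V.1 b • y) : ∃ m, a = b • m := by
  obtain ⟨c, hc⟩ := exists_val_eq_mk y n
  have h1 := toCompletionM_val (I := I) M a n
  rw [hy, toCompletion_smul_val M b y n hc] at h1
  have h3 : a ∈ (I.ideal V ^ n • ⊤ : Submodule Γ(X, V.1) Γ(M, V.1)) := by
    rw [← Submodule.Quotient.mk_eq_zero, ← h1, Submodule.Quotient.mk_eq_zero, hb]
    exact Submodule.smul_mem_smul (Ideal.mem_span_singleton_self b) trivial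
  rw [hb, Submodule.ideal_span_singleton_smul, Submodule.mem_smul_pointwise_iff_exists] at h3
  obtain ⟨m, -, hm⟩ := h3
  exact ⟨m, hm.symm⟩

lemma exists_eq_mul_of_val_one_eq_zero {b : Γ(X, V.1)} (hb : I.ideal V = Ideal.span {b})
    (x : completionRing I V.1) (hx : (x.1 ⟨V, le_rfl⟩).val 1 = 0) :
    ∃ y : completionRing I V.1, x = toCompletion I V.1 b * y := by
  -- The completion of `𝒪_X` as a module consists of the same families as the completed ring.
  obtain ⟨y, hy⟩ := exists_eq_pow_smul (M := structureModule X) hb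
    (⟨x.1, x.2⟩ : completionModule I (structureModule X) V.1) 1 hx
  refine ⟨⟨y.1, y.2⟩, ?_⟩
  rw [pow_one] at hy
  apply Subtype.ext
  exact congrArg Subtype.val hy

end PrincipalCompletion

/-! ### Power series inside Laurent series -/

section PowerSeriesIn

variable {A : Type u} [CommRing A]

lemma ofPowerSeries_mem (q : PowerSeries A) : HahnSeries.ofPowerSeries ℤ A q ∈ powerSeriesIn A := by
  intro n hn
  rw [HahnSeries.ofPowerSeries_apply, HahnSeries.embDomain_of_notMem_range]
  rintro ⟨m, hm⟩
  simp at hm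
  omega

lemma exists_ofPowerSeries_eq {g : LaurentSeries A} (hg : g ∈ powerSeriesIn A) :
    ∃ q, HahnSeries.ofPowerSeries ℤ A q = g := by
  refine ⟨PowerSeries.mk fun n => g.coeff n, ?_⟩
  ext n
  by_cases hn : 0 ≤ n
  · lift n to ℕ using hn
    simp [HahnSeries.ofPowerSeries_apply_coeff]
  · rw [hg n (not_le.mp hn)]
    exact ofPowerSeries_mem _ n (not_le.mp hn)

lemma exists_ofPowerSeries_eq_pi {r : ℕ} {g : Fin r → LaurentSeries A}
    (hg : ∀ i, g i ∈ powerSeriesIn A) :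
    ∃ q : Fin r → PowerSeries A, ∀ i, HahnSeries.ofPowerSeries ℤ A (q i) = g i := by
  choose q hq using fun i => exists_ofPowerSeries_eq (hg i)
  exact ⟨q, hq⟩

lemma mul_mem_powerSeriesIn {g g' : LaurentSeries A} (hg : g ∈ powerSeriesIn A)
    (hg' : g' ∈ powerSeriesIn A) : g * g' ∈ powerSeriesIn A := by
  obtain ⟨q, rfl⟩ := exists_ofPowerSeries_eq hg
  obtain ⟨q', rfl⟩ := exists_ofPowerSeries_eq hg'
  rw [← map_mul]
  exact ofPowerSeries_mem _

lemma isUnit_ofPowerSeries_X_pow (n : ℕ) :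
    IsUnit (HahnSeries.ofPowerSeries ℤ A (PowerSeries.X ^ n)) := by
  rw [HahnSeries.ofPowerSeries_X_pow]
  refine IsUnit.of_mul_eq_one (HahnSeries.single (-(n : ℤ)) 1) ?_
  rw [HahnSeries.single_mul_single, add_neg_cancel, mul_one]
  rfl

lemma eventually_X_pow_mul_mem (g : LaurentSeries A) : ∀ᶠ n : ℕ in Filter.atTop,
    HahnSeries.ofPowerSeries ℤ A (PowerSeries.X ^ n) * g ∈ powerSeriesIn A := by
  -- The pole of `g` has order at most the absolute value of its order, so this power of the
  -- variable clears it.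
  refine Filter.eventually_atTop.mpr ⟨g.order.natAbs, fun k hk n hn => ?_⟩
  rw [HahnSeries.ofPowerSeries_X_pow]
  have h := HahnSeries.coeff_single_mul_add (r := (1 : A)) (x := g) (a := n - k) (b := (k : ℤ))
  rw [sub_add_cancel, one_mul] at h
  rw [h]
  exact HahnSeries.coeff_eq_zero_of_lt_order (by omega)

lemma laurentMap_mem {B : Type u} [CommRing B] (f : A →+* B) {g : LaurentSeries A}
    (hg : g ∈ powerSeriesIn A) : laurentMap f g ∈ powerSeriesIn B := fun n hn => by
  rw [laurentMap_coeff, hg n hn, map_zero]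

end PowerSeriesIn

section Coordinates

variable {R M : Type u} [CommRing R] [AddCommGroup M] [Module R M] {r : ℕ} (e : M ≃ₗ[R] (Fin r → R))

lemma equiv_add_apply (m m' : M) (i : Fin r) : e (m + m') i = e m i + e m' i := by
  rw [map_add, Pi.add_apply]

lemma exists_equiv_apply_eq {P : Type u} [CommRing P] (ρ : R ≃+* P) (q : Fin r → P) :
    ∃ m, ∀ i, ρ (e m i) = q i :=
  ⟨e.symm fun i => ρ.symm (q i), fun i => by
    rw [LinearEquiv.apply_symm_apply, RingEquiv.apply_symm_apply]⟩

lemma eq_of_equiv_apply_eq {P : Type u} [CommRing P] (ρ : R ≃+* P) {m m' : M}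
    (h : ∀ i, ρ (e m i) = ρ (e m' i)) : m = m' :=
  e.injective (funext fun i => ρ.injective (h i))

end Coordinates

/-! ### Expansions along the section -/

namespace GeometricDatum

variable {S : Scheme.{u}} {r : ℕ} (D : GeometricDatum S r) {V : D.C.affineOpens} {b : Γ(D.C, V.1)}

lemma expandF_mem (W : D.C.Opens) (a : Γ(D.F, W)) (i : Fin r) :
    D.expandF W a i ∈ powerSeriesIn _ :=
  ofPowerSeries_mem _

lemma toCompletion_val (a : Γ(D.C, V.1)) (n : ℕ) :
    ((toCompletion D.ideal V.1 a).1 ⟨V, le_rfl⟩).val n = Submodule.Quotient.mk a := by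
  change Submodule.Quotient.mk (res le_rfl a) = _
  rw [res_self]

/-- By continuity of the inverse of `ρ`, some `z ^ m` comes from an element of the completion
vanishing modulo the ideal, hence from a multiple of `b`. So `ρ(b)` divides `z ^ m`, which is
invertible as a Laurent series. -/
lemma isUnit_expand (hb : D.ideal.ideal V = Ideal.span {b}) : IsUnit (D.expand V.1 b) := by
  obtain ⟨m, hm⟩ := D.ρ_symm_continuous V 1
  have h1 := hm ((D.ρ V.1).symm (PowerSeries.X ^ m)) (by rw [RingEquiv.apply_symm_apply])
  obtain ⟨y, hy⟩ := exists_eq_mul_of_val_one_eq_zero hb _ h1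
  have h2 : PowerSeries.X ^ m = D.ρ V.1 (toCompletion D.ideal V.1 b) * D.ρ V.1 y := by
    rw [← map_mul, ← hy, RingEquiv.apply_symm_apply]
  have h3 := isUnit_ofPowerSeries_X_pow (A := Γ(S, D.p ⁻¹ᵁ V.1)) m
  rw [h2, map_mul] at h3
  exact isUnit_of_mul_isUnit_left h3

/-- Choose `k` such that `z ^ k` clears the poles of all components. By continuity of `ρ`, some
`ρ(b) ^ n` is divisible by `z ^ k`. -/
lemma exists_expand_pow_mul_mem (hb : D.ideal.ideal V = Ideal.span {b})
    (g : Fin r → LaurentSeries Γ(S, D.p ⁻¹ᵁ V.1)) :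
    ∃ n : ℕ, ∀ i, D.expand V.1 b ^ n * g i ∈ powerSeriesIn _ := by
  obtain ⟨k, hk⟩ := (Filter.eventually_all.mpr fun i => eventually_X_pow_mul_mem (g i)).exists
  obtain ⟨n, hn⟩ := D.ρ_continuous V k
  have h1 : ((toCompletion D.ideal V.1 (b ^ n)).1 ⟨V, le_rfl⟩).val n = 0 := by
    rw [toCompletion_val, Submodule.Quotient.mk_eq_zero, hb, Ideal.span_singleton_pow, smul_eq_mul,
      Ideal.mul_top]
    exact Ideal.mem_span_singleton_self _
  obtain ⟨q, hq⟩ := hn _ h1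
  refine ⟨n, fun i => ?_⟩
  have h2 : D.expand V.1 b ^ n = HahnSeries.ofPowerSeries ℤ _ (PowerSeries.X ^ k) *
      HahnSeries.ofPowerSeries ℤ _ q := by
    rw [← map_mul, ← hq, ← map_pow]
    rfl
  rw [h2, mul_right_comm]
  exact mul_mem_powerSeriesIn (hk i) (ofPowerSeries_mem q)

lemma rho_phi_add (W : D.C.Opens) (y y' : completionModule D.ideal D.F W) (i : Fin r) :
    D.ρ W (D.Φ W (y + y') i) = D.ρ W (D.Φ W y i) + D.ρ W (D.Φ W y' i) :=
  (congrArg (D.ρ W) (equiv_add_apply (D.Φ W) y y' i)).trans (map_add (D.ρ W) _ _)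

lemma rho_phi_smul (W : D.C.Opens) (c : completionRing D.ideal W)
    (y : completionModule D.ideal D.F W) (i : Fin r) :
    D.ρ W (D.Φ W (c • y) i) = D.ρ W c * D.ρ W (D.Φ W y i) :=
  (congrArg (D.ρ W) (equiv_smul_apply (D.Φ W) c y i)).trans (map_mul (D.ρ W) _ _)

lemma exists_rho_phi_eq (W : D.C.Opens) (q : Fin r → PowerSeries Γ(S, D.p ⁻¹ᵁ W)) :
    ∃ y, ∀ i, D.ρ W (D.Φ W y i) = q i :=
  exists_equiv_apply_eq (D.Φ W) (D.ρ W) q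

lemma eq_of_rho_phi_eq (W : D.C.Opens) {y y' : completionModule D.ideal D.F W}
    (h : ∀ i, D.ρ W (D.Φ W y i) = D.ρ W (D.Φ W y' i)) : y = y' :=
  eq_of_equiv_apply_eq (D.Φ W) (D.ρ W) h

lemma exists_eq_rho_phi_add (hb : D.ideal.ideal V = Ideal.span {b})
    (q : Fin r → PowerSeries Γ(S, D.p ⁻¹ᵁ V.1)) (n : ℕ) :
    ∃ (a : Γ(D.F, V.1)) (q' : Fin r → PowerSeries Γ(S, D.p ⁻¹ᵁ V.1)),
      ∀ i, q i = D.ρ V.1 (D.Φ V.1 (toCompletionM D.ideal D.F V.1 a) i) +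
        D.ρ V.1 (toCompletion D.ideal V.1 b ^ n) * q' i := by
  refine (D.exists_rho_phi_eq V.1 q).elim fun y hy => ?_
  refine (exists_eq_toCompletionM_add hb y n).elim fun a ha => ha.elim fun y' hy' => ?_
  exact ⟨a, fun i => D.ρ V.1 (D.Φ V.1 y' i), fun i => (hy i).symm.trans
    ((congrArg (fun y => D.ρ V.1 (D.Φ V.1 y i)) hy').trans ((D.rho_phi_add V.1 _ _ i).trans
      (congrArg (fun x => _ + x) (D.rho_phi_smul V.1 _ _ i))))⟩

lemma ofPowerSeries_rho_pow (n : ℕ) (b : Γ(D.C, V.1)) :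
    HahnSeries.ofPowerSeries ℤ _ (D.ρ V.1 (toCompletion D.ideal V.1 b ^ n)) =
      D.expand V.1 b ^ n := by
  rw [map_pow, map_pow]
  rfl

lemma eq_expandF_add (n : ℕ) (a : Γ(D.F, V.1)) (i : Fin r)
    {g : LaurentSeries Γ(S, D.p ⁻¹ᵁ V.1)} {q q' : PowerSeries Γ(S, D.p ⁻¹ᵁ V.1)}
    (hq : HahnSeries.ofPowerSeries ℤ _ q = g)
    (hy : q = D.ρ V.1 (D.Φ V.1 (toCompletionM D.ideal D.F V.1 a) i) +
      D.ρ V.1 (toCompletion D.ideal V.1 b ^ n) * q') :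
    g = D.expandF V.1 a i + D.expand V.1 b ^ n * HahnSeries.ofPowerSeries ℤ _ q' := by
  refine hq.symm.trans ((congrArg (HahnSeries.ofPowerSeries ℤ _) hy).trans ?_)
  refine (map_add (HahnSeries.ofPowerSeries ℤ _) _ _).trans ?_
  refine congrArg (fun x => D.expandF V.1 a i + x) ?_
  rw [map_mul, ofPowerSeries_rho_pow]

/-- The approximation that realises polar parts: once everything is divided by `ρ(b) ^ n`, the error
is still a vector of power series. -/
lemma exists_eq_expandF_add (hb : D.ideal.ideal V = Ideal.span {b})
    {g : Fin r → LaurentSeries Γ(S, D.p ⁻¹ᵁ V.1)} (hg : ∀ i, g i ∈ powerSeriesIn _) (n : ℕ) :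
    ∃ (a : Γ(D.F, V.1)) (h : Fin r → LaurentSeries Γ(S, D.p ⁻¹ᵁ V.1)),
      (∀ i, h i ∈ powerSeriesIn _) ∧ ∀ i, g i = D.expandF V.1 a i + D.expand V.1 b ^ n * h i := by
  refine (exists_ofPowerSeries_eq_pi hg).elim fun q hq => ?_
  refine (D.exists_eq_rho_phi_add hb q n).elim fun a ha => ha.elim fun q' hy => ?_
  refine ⟨a, fun i => HahnSeries.ofPowerSeries ℤ _ (q' i), fun i => ofPowerSeries_mem _,
    fun i => ?_⟩
  exact D.eq_expandF_add n a i (hq i) (hy i)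

lemma exists_eq_smul_of_rho_phi_eq {n : ℕ} (hb : D.ideal.ideal V ^ n = Ideal.span {b})
    (a : Γ(D.F, V.1)) (q : Fin r → PowerSeries Γ(S, D.p ⁻¹ᵁ V.1))
    (e : ∀ i, D.ρ V.1 (D.Φ V.1 (toCompletionM D.ideal D.F V.1 a) i) =
      D.ρ V.1 (toCompletion D.ideal V.1 b) * q i) : ∃ m, a = b • m :=
  (D.exists_rho_phi_eq V.1 q).elim fun y hy =>
    exists_eq_smul_of_toCompletionM_eq hb a y (D.eq_of_rho_phi_eq V.1 fun i => (e i).trans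
      ((congrArg (fun x => _ * x) (hy i).symm).trans (D.rho_phi_smul V.1 _ _ i).symm))

lemma rho_phi_eq_of_expandF_eq {a : Γ(D.F, V.1)} {i : Fin r}
    {h : LaurentSeries Γ(S, D.p ⁻¹ᵁ V.1)} {q : PowerSeries Γ(S, D.p ⁻¹ᵁ V.1)}
    (hq : HahnSeries.ofPowerSeries ℤ _ q = h) (e : D.expand V.1 b * h = D.expandF V.1 a i) :
    D.ρ V.1 (D.Φ V.1 (toCompletionM D.ideal D.F V.1 a) i) =
      D.ρ V.1 (toCompletion D.ideal V.1 b) * q := by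
  apply HahnSeries.ofPowerSeries_injective (Γ := ℤ)
  refine Eq.trans ?_ (map_mul (HahnSeries.ofPowerSeries ℤ _) _ _).symm
  exact e.symm.trans (congrArg (fun x => D.expand V.1 b * x) hq.symm)

lemma exists_eq_smul_of_expandF_eq {n : ℕ} (hb : D.ideal.ideal V ^ n = Ideal.span {b})
    (a : Γ(D.F, V.1)) {h : Fin r → LaurentSeries Γ(S, D.p ⁻¹ᵁ V.1)}
    (hh : ∀ i, h i ∈ powerSeriesIn _) (e : ∀ i, D.expand V.1 b * h i = D.expandF V.1 a i) :
    ∃ m, a = b • m :=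
  (exists_ofPowerSeries_eq_pi hh).elim fun q hq => D.exists_eq_smul_of_rho_phi_eq hb a q
    fun i => D.rho_phi_eq_of_expandF_eq (hq i) (e i)

end GeometricDatum

/-! ### Local equations of the divisor and its complement -/

section Away

variable {X : Scheme.{u}} {I : X.IdealSheafData} {V : X.affineOpens}

lemma isUnit_res_of_le_basicOpen {W W' : X.Opens} (h : W' ≤ W) (b : Γ(X, W))
    (hb : W' ≤ X.basicOpen b) : IsUnit (res h b) := by
  rw [← res_res hb (X.basicOpen_le b)]
  exact (RingedSpace.isUnit_res_basicOpen X.toRingedSpace b).map (res hb)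

lemma inf_away_eq_basicOpen {b : Γ(X, V.1)} (hb : I.ideal V = Ideal.span {b}) :
    V.1 ⊓ away I = X.basicOpen b := by
  ext x
  constructor
  · rintro ⟨hxV, hx⟩
    by_contra hxb
    refine hx ((I.mem_support_iff_of_mem hxV).mpr ?_)
    rw [hb, Scheme.zeroLocus_span]
    simpa using hxb
  · intro hxb
    have hxV : x ∈ V.1 := X.basicOpen_le b hxb
    refine ⟨hxV, fun hx => ?_⟩
    have h1 := (I.mem_support_iff_of_mem hxV).mp hx
    rw [hb, Scheme.zeroLocus_span] at h1
    simp at h1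
    exact h1 hxb

/-- Some function `c` of the ideal is invertible at a given point off the support, and `b` divides
`c ^ n`. Only an inclusion holds, because `b` is a unit on all of `V` when `n = 0`. -/
lemma inf_away_le_basicOpen {n : ℕ} {b : Γ(X, V.1)} (hb : I.ideal V ^ n = Ideal.span {b}) :
    V.1 ⊓ away I ≤ X.basicOpen b := by
  rintro x ⟨hxV, hx⟩
  obtain ⟨c, hc, hxc⟩ : ∃ c ∈ I.ideal V, x ∈ X.basicOpen c := by
    by_contra! h
    exact hx ((I.mem_support_iff_of_mem hxV).mpr ((Scheme.mem_zeroLocus_iff _ _ _).mpr h))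
  have h2 : c ^ n ∈ Ideal.span {b} := hb ▸ Ideal.pow_mem_pow hc n
  obtain ⟨d, hd⟩ := Ideal.mem_span_singleton.mp h2
  have h3 := ((X.mem_basicOpen _ _ hxV).mp hxc).pow n
  rw [← map_pow, hd, map_mul] at h3
  exact (X.mem_basicOpen _ _ hxV).mpr (isUnit_of_mul_isUnit_left h3)

lemma isUnit_res_away {n : ℕ} {b : Γ(X, V.1)} (hb : I.ideal V ^ n = Ideal.span {b}) :
    IsUnit (res (inf_le_left : V.1 ⊓ away I ≤ V.1) b) :=
  isUnit_res_of_le_basicOpen _ b (inf_away_le_basicOpen hb)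

end Away

/-! ### Expansions of sections with poles -/

namespace GeometricDatum

variable {S : Scheme.{u}} {r : ℕ} (D : GeometricDatum S r) (V : D.C.affineOpens)

/-- The section `f` of `F` on `V ∖ P` is a quotient `a / b` with `b` a local equation of `nP`,
and `g` is `ρ(Φ(a)) / ρ(b)`. -/
def Expands (f : Γ(D.F, V.1 ⊓ away D.ideal)) (g : Fin r → LaurentSeries Γ(S, D.p ⁻¹ᵁ V.1)) :
    Prop :=
  ∃ (n : ℕ) (a : Γ(D.F, V.1)) (b : Γ(D.C, V.1)), D.ideal.ideal V ^ n = Ideal.span {b} ∧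
    resM D.F inf_le_left a = res (inf_le_left : V.1 ⊓ away D.ideal ≤ _) b • f ∧
    ∀ i, D.expand V.1 b * g i = D.expandF V.1 a i

variable {D V}

lemma expands_section (m : Γ(D.F, V.1)) :
    D.Expands V (resM D.F inf_le_left m) (D.expandF V.1 m) :=
  ⟨0, m, 1, by simp, by simp, by simp⟩

lemma Expands.add {f f' : Γ(D.F, V.1 ⊓ away D.ideal)}
    {g g' : Fin r → LaurentSeries Γ(S, D.p ⁻¹ᵁ V.1)} (H : D.Expands V f g)
    (H' : D.Expands V f' g') : D.Expands V (f + f') (g + g') := by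
  obtain ⟨n, a, b, hb, h1, h2⟩ := H
  obtain ⟨n', a', b', hb', h1', h2'⟩ := H'
  refine ⟨n + n', b' • a + b • a', b * b', ?_, ?_, fun i => ?_⟩
  · rw [pow_add, hb, hb', Ideal.span_singleton_mul_span_singleton]
  · simp only [map_add, map_mul, resM_smul, h1, h1', smul_add, smul_smul, mul_comm]
  · simp only [expandF_add, expandF_smul, map_mul, Pi.add_apply, ← h2, ← h2']; ring

lemma Expands.smul {U : S.Opens} (hV : V.1 ≤ D.π ⁻¹ᵁ U) (c : Γ(S, U))
    {f : Γ(D.F, V.1 ⊓ away D.ideal)} {g : Fin r → LaurentSeries Γ(S, D.p ⁻¹ᵁ V.1)}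
    (H : D.Expands V f g) :
    D.Expands V (res ((inf_le_left : V.1 ⊓ away D.ideal ≤ _).trans hV) (D.π.app _ c) • f)
      (res (section_le D.section_eq hV) c • g) := by
  obtain ⟨n, a, b, hb, h1, h2⟩ := H
  refine ⟨n, res hV (D.π.app _ c) • a, b, hb, ?_, fun i => ?_⟩
  · simp only [resM_smul, h1, res_res, smul_smul, mul_comm]
  · rw [expandF_smul, ← h2, Pi.smul_apply, expand_const, ← HahnSeries.C_mul_eq_smul]
    ring

lemma Expands.neg {f : Γ(D.F, V.1 ⊓ away D.ideal)}
    {g : Fin r → LaurentSeries Γ(S, D.p ⁻¹ᵁ V.1)} (H : D.Expands V f g) :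
    D.Expands V (-f) (-g) := by
  obtain ⟨n, a, b, hb, h1, h2⟩ := H
  refine ⟨n, (-1 : Γ(D.C, V.1)) • a, b, hb, ?_, fun i => ?_⟩
  · rw [neg_one_smul, map_neg, h1, smul_neg]
  · rw [expandF_smul, ← h2, Pi.neg_apply, map_neg, map_one]
    ring

lemma Expands.sub {f f' : Γ(D.F, V.1 ⊓ away D.ideal)}
    {g g' : Fin r → LaurentSeries Γ(S, D.p ⁻¹ᵁ V.1)} (H : D.Expands V f g)
    (H' : D.Expands V f' g') : D.Expands V (f - f') (g - g') := by
  rw [sub_eq_add_neg, sub_eq_add_neg]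
  exact H.add H'.neg

lemma Expands.restrict {f : Γ(D.F, V.1 ⊓ away D.ideal)}
    {g : Fin r → LaurentSeries Γ(S, D.p ⁻¹ᵁ V.1)} (H : D.Expands V f g) {V' : D.C.affineOpens}
    (h : V'.1 ≤ V.1) :
    D.Expands V' (resM D.F (inf_le_inf_right _ h) f)
      (fun i => laurentMap (res (preimage_le D.p h)) (g i)) := by
  obtain ⟨n, a, b, hb, h1, h2⟩ := H
  refine ⟨n, resM D.F h a, res h b, D.ideal_pow_res h hb, ?_, fun i => ?_⟩
  · have := congrArg (resM D.F (inf_le_inf_right (away D.ideal) h)) h1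
    rw [resM_smul] at this
    simpa only [res_res, resM_resM] using this
  · have := congrArg (laurentMap (res (preimage_le D.p h))) (h2 i)
    rw [map_mul] at this
    rw [expand_res, expandF_res, this]

/-- A section with integral expansion extends over the divisor. -/
lemma Expands.exists_extension {f : Γ(D.F, V.1 ⊓ away D.ideal)}
    {g : Fin r → LaurentSeries Γ(S, D.p ⁻¹ᵁ V.1)} (H : D.Expands V f g)
    (hg : ∀ i, g i ∈ powerSeriesIn _) : ∃ m : Γ(D.F, V.1), resM D.F inf_le_left m = f := by
  obtain ⟨n, a, b, hb, h1, h2⟩ := H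
  obtain ⟨m, rfl⟩ := D.exists_eq_smul_of_expandF_eq hb a hg h2
  refine ⟨m, ?_⟩
  rw [resM_smul] at h1
  exact (isUnit_res_away hb).smul_left_cancel.mp h1

/-- Every family of Laurent series is, up to power series, the expansion of a section. -/
lemma exists_expands_sub {b : Γ(D.C, V.1)} (hb : D.ideal.ideal V = Ideal.span {b})
    (g : Fin r → LaurentSeries Γ(S, D.p ⁻¹ᵁ V.1)) :
    ∃ (f : Γ(D.F, V.1 ⊓ away D.ideal)) (h : Fin r → LaurentSeries Γ(S, D.p ⁻¹ᵁ V.1)),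
      (∀ i, h i ∈ powerSeriesIn _) ∧ D.Expands V f (g - h) := by
  obtain ⟨n, hn⟩ := D.exists_expand_pow_mul_mem hb g
  obtain ⟨a, h, hh, ha⟩ := D.exists_eq_expandF_add hb hn n
  have hbn : D.ideal.ideal V ^ n = Ideal.span {b ^ n} := by rw [hb, Ideal.span_singleton_pow]
  obtain ⟨u, hu⟩ := (isUnit_res_away hbn).exists_right_inv
  -- The section is `a / b ^ n`, where `a` approximates `ρ(b) ^ n * g` with error `ρ(b) ^ n * h`.
  refine ⟨u • resM D.F inf_le_left a, h, hh, n, a, b ^ n, hbn, ?_, fun i => ?_⟩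
  · rw [smul_smul, hu, one_smul]
  · rw [map_pow, Pi.sub_apply, mul_sub, ha, add_sub_cancel_right]

/-- Every section on the complement of the divisor has an expansion. -/
lemma exists_expands {b : Γ(D.C, V.1)} (hb : D.ideal.ideal V = Ideal.span {b})
    (f : Γ(D.F, V.1 ⊓ away D.ideal)) : ∃ g, D.Expands V f g := by
  have e := inf_away_eq_basicOpen hb
  -- `V ∖ P` is the basic open of `b`, so quasi-coherence bounds the pole of `f` along `P`.
  obtain ⟨n, a, ha⟩ := exists_resM_eq_pow_smul D.F D.quasicoherent V.2 b (resM D.F e.ge f)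
  have hbn : D.ideal.ideal V ^ n = Ideal.span {b ^ n} := by rw [hb, Ideal.span_singleton_pow]
  obtain ⟨u, hu⟩ := ((D.isUnit_expand hb).pow n).exists_right_inv
  refine ⟨fun i => u * D.expandF V.1 a i, n, a, b ^ n, hbn, ?_, fun i => ?_⟩
  · have := congrArg (resM D.F e.le) ha
    rw [resM_smul, resM_resM, resM_resM, resM_self, map_pow, res_res] at this
    rw [this, map_pow]
  · rw [← mul_assoc, map_pow, hu, one_mul]

end GeometricDatum

/-! ### Locally projective morphisms are proper -/

section Proper

open MvPolynomial in
-- `Proj` is proper over the spectrum of the degree zero part. Polynomials homogeneous of degree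
-- zero are constants, so that spectrum is a closed subscheme of `Spec R`.
instance isProper_projectiveSpaceToSpec (n : ℕ) (R : CommRingCat.{u}) :
    IsProper (projectiveSpaceToSpec n R) := by
  let := MvPolynomial.gradedAlgebra (σ := Fin (n + 1)) (R := R)
  let A := homogeneousSubmodule (Fin (n + 1)) R
  have hsurj : Function.Surjective (algebraMap R (A 0)) := by
    rintro ⟨q, hq⟩
    refine ⟨q.coeff 0, Subtype.ext ?_⟩
    have : q = C (q.coeff 0) := totalDegree_eq_zero_iff_eq_C.mp (by
      simpa using (mem_homogeneousSubmodule 0 q).mp hq |>.totalDegree_le)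
    exact this.symm
  have : IsScalarTower R (A 0) (MvPolynomial (Fin (n + 1)) R) :=
    IsScalarTower.of_algebraMap_eq (R := R) (S := A 0) fun _ => rfl
  have : Algebra.FiniteType (A 0) (MvPolynomial (Fin (n + 1)) R) :=
    Algebra.FiniteType.of_restrictScalars_finiteType R (A 0) _
  have : IsClosedImmersion (Spec.map (CommRingCat.ofHom (algebraMap R (A 0)))) :=
    IsClosedImmersion.spec_of_surjective _ hsurj
  unfold projectiveSpaceToSpec
  infer_instance

lemma IsLocallyProjective.isProper {C S : Scheme.{u}} {π : C ⟶ S} (h : IsLocallyProjective π) :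
    IsProper π := by
  refine IsZariskiLocalAtTarget.of_forall_exists_morphismRestrict (P := @IsProper) fun s => ?_
  obtain ⟨U, hs, n, i, hi, e⟩ := h s
  refine ⟨U.1, hs, ?_⟩
  have h1 : i ≫ projectiveSpaceToSpec n Γ(S, U.1) = π ∣_ U.1 ≫ U.2.isoSpec.hom := by
    have := U.2.isOpenImmersion_fromSpec
    rw [← cancel_mono U.2.fromSpec, Category.assoc, e, Category.assoc]
    exact (morphismRestrict_ι π U.1).symm.trans
      (congrArg (π ∣_ U.1 ≫ ·) (IsAffineOpen.isoSpec_hom_fromSpec U.2).symm)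
  have h2 : IsProper (π ∣_ U.1 ≫ U.2.isoSpec.hom) := by
    rw [← h1]
    infer_instance
  exact (MorphismProperty.cancel_right_of_respectsIso @IsProper _ _).mp h2

end Proper

/-! ### The valuative criterion for the map from an open subset to the spectrum of its functions -/

section ValuativeCriterion

lemma eq_of_comp_eq_of_appTop_injective {X Y Z : Scheme.{u}} [IsAffine Z] {k : X ⟶ Y}
    (hk : Function.Injective k.appTop) {f g : Y ⟶ Z} (h : k ≫ f = k ≫ g) : f = g := by
  refine ext_of_isAffine (CommRingCat.hom_ext (RingHom.ext fun x => hk ?_))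
  exact congrArg (fun q => q.appTop.hom x) h

variable {C S : Scheme.{u}} (π : C ⟶ S) [IsProper π] {U : S.Opens} (hU : IsAffineOpen U)
  {Y : C.Opens} (hY : Y ≤ π ⁻¹ᵁ U) 

include hU hY in
-- Properness of `π` extends a `K`-point of `Y` to an `R`-point of `C`; the issue is that it stays
-- in `Y`. Near the image of the closed point, `u` is the inverse of a function `s` on `Y`. Since
-- `s` has a value in `R`, the value of `u` is a unit of `R`, so the closed point maps into the
-- basic open of `u`, which lies in `Y`.
lemma existence_toSpecΓ
    (H : ∀ c ∈ π ⁻¹ᵁ U, ∃ (s : Γ(C, Y)) (V : C.Opens) (u : Γ(C, V)), c ∈ V ∧ C.basicOpen u ≤ Y ∧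
      res (inf_le_left : V ⊓ Y ≤ V) u * res inf_le_right s = 1) :
    ValuativeCriterion.Existence Y.toSpecΓ := by
  rintro ⟨R, K, i₁, i₂, ⟨w⟩⟩
  let k : Spec (.of K) ⟶ Spec (.of R) := Spec.map (CommRingCat.ofHom (algebraMap R K))
  have w' : i₁ ≫ Y.toSpecΓ = k ≫ i₂ := w
  let j : Spec (.of R) ⟶ S := i₂ ≫ Spec.map (π.appLE U Y hY) ≫ hU.fromSpec
  have hj : (i₁ ≫ Y.ι) ≫ π = k ≫ j := by
    simp only [j, ← reassoc_of% w', Scheme.Opens.toSpecΓ_SpecMap_appLE_assoc, Category.assoc]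
    simp [Scheme.Hom.resLE_comp_ι]
  have hval : ValuativeCriterion.Existence π := by
    have h1 : UniversallyClosed π := inferInstance
    rw [UniversallyClosed.eq_valuativeCriterion] at h1
    exact h1.1
  obtain ⟨⟨l, hl₁, hl₂⟩⟩ := hval ⟨R, K, i₁ ≫ Y.ι, j, ⟨hj⟩⟩
  replace hl₁ : k ≫ l = i₁ ≫ Y.ι := hl₁
  replace hl₂ : l ≫ π = j := hl₂
  have hk : Function.Injective k.appTop := by
    let P : MorphismProperty CommRingCat.{u} :=
      RingHom.toMorphismProperty fun f => Function.Injective f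
    have : P.RespectsIso :=
      RingHom.toMorphismProperty_respectsIso_iff.mp RingHom.injective_respectsIso
    exact (MorphismProperty.arrow_mk_iso_iff P (arrowIsoΓSpecOfIsAffine
      (CommRingCat.ofHom (algebraMap R K)))).mp (FaithfulSMul.algebraMap_injective R K)
  have hc : l (IsLocalRing.closedPoint R) ∈ π ⁻¹ᵁ U := by
    have h1 : (l ≫ π) (IsLocalRing.closedPoint R) ∈ U := by
      rw [hl₂]
      simp only [j]
      rw [← SetLike.mem_coe, ← hU.range_fromSpec]
      exact ⟨_, rfl⟩
    exact h1
  obtain ⟨s, V, u, hcV, huY, hus⟩ := H _ hc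
  have hV : ⊤ ≤ l ⁻¹ᵁ V := (Scheme.preimage_eq_top_of_closedPoint_mem l hcV).ge
  have hkV : ⊤ ≤ (i₁ ≫ Y.ι) ⁻¹ᵁ V := by
    rw [← hl₁]
    exact fun x _ => hV (x := k x) trivial
  have hkY : ⊤ ≤ (i₁ ≫ Y.ι) ⁻¹ᵁ Y := fun x _ => (i₁ x).2
  have h1 : k.appTop (l.appLE V ⊤ hV u) = (i₁ ≫ Y.ι).appLE V ⊤ hkV u := by
    have h := congrArg (·.hom u) (k.appLE_comp_appLE l V ⊤ ⊤ hV le_rfl)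
    rw [Scheme.Hom.appTop, Scheme.Hom.app_eq_appLE]
    have hq : ∀ q (hq : q = i₁ ≫ Y.ι) (e : ⊤ ≤ q ⁻¹ᵁ V),
        q.appLE V ⊤ e = (i₁ ≫ Y.ι).appLE V ⊤ hkV := by
      rintro _ rfl _
      rfl
    exact h.trans (congrArg (·.hom u) (hq _ hl₁ _))
  have h2 : k.appTop (i₂.appTop ((Scheme.ΓSpecIso _).inv s)) = (i₁ ≫ Y.ι).appLE Y ⊤ hkY s := by
    change (i₂.appTop ≫ k.appTop) _ = _
    rw [← Scheme.Hom.comp_appTop, ← w', Scheme.Hom.comp_appTop, Scheme.Opens.toSpecΓ_appTop]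
    have h := congrArg (·.hom s) (i₁.appLE_comp_appLE Y.ι Y ⊤ ⊤
      (Scheme.Opens.ι_preimage_self Y).ge le_rfl)
    refine Eq.trans ?_ h
    rw [Scheme.Hom.appTop, Scheme.Hom.app_eq_appLE]
    have h4 := congrArg (·.hom s) (Scheme.ΓSpecIso Γ(C, Y)).inv_hom_id
    have h5 : Y.ι.appLE Y ⊤ (Scheme.Opens.ι_preimage_self Y).ge = Y.topIso.inv :=
      Scheme.Opens.ι_appLE _ _ _ _
    rw [h5]
    exact congrArg (fun x => (i₁.appLE ⊤ ⊤ le_rfl).hom (Y.topIso.inv.hom x)) h4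
  -- `R` embeds in `K`, so the identity may be checked at the generic point, where both values are
  -- pulled back along the `K`-point of `Y`.
  have h3 : l.appLE V ⊤ hV u * i₂.appTop ((Scheme.ΓSpecIso _).inv s) = 1 := by
    apply hk
    rw [map_mul, h1, h2, map_one]
    have h := congrArg ((i₁ ≫ Y.ι).appLE (V ⊓ Y) ⊤ (le_inf hkV hkY)) hus
    rw [map_mul, map_one] at h
    have e1 := congrArg (·.hom u) ((i₁ ≫ Y.ι).map_appLE (le_inf hkV hkY) (homOfLE inf_le_left).op)
    have e2 := congrArg (·.hom s) ((i₁ ≫ Y.ι).map_appLE (le_inf hkV hkY) (homOfLE inf_le_right).op)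
    exact (congrArg₂ (· * ·) e1 e2).symm.trans h
  have h4 : l (IsLocalRing.closedPoint R) ∈ C.basicOpen u := by
    have h := Scheme.basicOpen_appLE l ⊤ V hV u
    rw [Scheme.basicOpen_of_isUnit _ (IsUnit.of_mul_eq_one _ h3), top_inf_eq] at h
    exact h.le (x := IsLocalRing.closedPoint R) trivial
  -- An open subset of a local spectrum that contains the closed point is everything.
  have h5 : l ⁻¹ᵁ Y = ⊤ := Scheme.preimage_eq_top_of_closedPoint_mem l (huY h4)
  have h6 : Set.range l ⊆ Set.range Y.ι := by
    rw [Scheme.Opens.range_ι]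
    rintro _ ⟨x, rfl⟩
    exact h5.ge (x := x) trivial
  have h7 : k ≫ IsOpenImmersion.lift Y.ι l h6 = i₁ := by
    rw [← cancel_mono Y.ι, Category.assoc, IsOpenImmersion.lift_fac, hl₁]
  refine ⟨⟨⟨IsOpenImmersion.lift Y.ι l h6, h7, ?_⟩⟩⟩
  exact eq_of_comp_eq_of_appTop_injective hk (by rw [reassoc_of% h7, w'])

end ValuativeCriterion

/-! ### The complement of the divisor over an affine base is affine -/

section Cartier

variable {C : Scheme.{u}} {I : C.IdealSheafData} (hI : IsCartier I)

include hI

lemma IsCartier.exists_isPrincipal {c : C} {W : C.Opens} (hc : c ∈ W) :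
    ∃ V : C.affineOpens, c ∈ V.1 ∧ V.1 ≤ W ∧ ∃ b, I.ideal V = Ideal.span {b} := by
  obtain ⟨V₀, hcV₀, b, -, hb⟩ := hI c
  obtain ⟨V, hV, hcV, hle⟩ := exists_isAffineOpen_mem_and_subset (U := V₀.1 ⊓ W) ⟨hcV₀, hc⟩
  have h : V ≤ V₀.1 := fun y hy => (hle hy).1
  refine ⟨⟨V, hV⟩, hcV, fun y hy => (hle hy).2, res h b, ?_⟩
  have h1 : (I.ideal V₀).map (res h) = I.ideal ⟨V, hV⟩ := 
    I.map_ideal (show (⟨V, hV⟩ : C.affineOpens) ≤ V₀ from h)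
  rw [← h1, hb, Ideal.map_span, Set.image_singleton]

lemma IsCartier.isAffineHom_ι_away : IsAffineHom (away I).ι := by
  refine isAffineHom_of_forall_exists_isAffineOpen _ fun x => ?_
  obtain ⟨V, hxV, -, b, hb⟩ := hI.exists_isPrincipal (W := ⊤) (Set.mem_univ x)
  refine ⟨V.1, hxV, V.2, ?_⟩
  rw [← (away I).ι.isAffineOpen_iff_of_isOpenImmersion, Scheme.Hom.image_preimage_eq_opensRange_inf,
    Scheme.Opens.opensRange_ι, inf_comm, inf_away_eq_basicOpen hb]
  exact V.2.basicOpen b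

lemma IsCartier.isAffineOpen_inf_away {W : C.Opens} (hW : IsAffineOpen W) :
    IsAffineOpen (W ⊓ away I) := by
  have := hI.isAffineHom_ι_away
  have h := hW.preimage (away I).ι
  rwa [← (away I).ι.isAffineOpen_iff_of_isOpenImmersion, Scheme.Hom.image_preimage_eq_opensRange_inf,
    Scheme.Opens.opensRange_ι, inf_comm] at h

lemma IsCartier.isCompact_inf_away {W : C.Opens} (hW : IsCompact (W : Set C)) :
    IsCompact ((W ⊓ away I : C.Opens) : Set C) := by
  have := hI.isAffineHom_ι_away
  have h := (QuasiCompact.isCompact_preimage (f := (away I).ι) _ W.2 hW).image (away I).ι.continuous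
  rwa [Set.image_preimage_eq_inter_range, Scheme.Opens.range_ι] at h

/-- With `b` a local equation of `P`, the section `b ^ (-n)` of `𝒪(nP)` is a multiple `a * s` of the
generator, so `u = b ^ n * a` is a regular inverse of `s`. As `n ≥ 1`, `u` vanishes on `P`, so its
basic open avoids `P`. -/
lemma GeneratesAt.exists_mul_eq_one {n : ℕ} (hn : 1 ≤ n) {W : C.Opens} {s : Γ(C, W ⊓ away I)}
    {c : C} (h : GeneratesAt I n s c) :
    ∃ (V : C.Opens) (u : Γ(C, V)), c ∈ V ∧ C.basicOpen u ≤ W ⊓ away I ∧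
      res (inf_le_left : V ⊓ (W ⊓ away I) ≤ V) u * res inf_le_right s = 1 := by
  obtain ⟨V₁, hV₁, hcV₁, hgen⟩ := h
  obtain ⟨V, hcV, hVV₁, b, hb⟩ := hI.exists_isPrincipal hcV₁
  have hbn : I.ideal V ^ n = Ideal.span {b ^ n} := by rw [hb, Ideal.span_singleton_pow]
  obtain ⟨t, ht⟩ := (isUnit_res_away hbn).exists_right_inv
  obtain ⟨a, ha⟩ := hgen V.1 hVV₁ t fun V' b' hb' => by
    have h1 : (I.ideal V).map (res V'.2) = I.ideal V'.1 := I.map_ideal V'.2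
    rw [← h1, ← Ideal.map_pow, hbn, Ideal.map_span, Set.image_singleton] at hb'
    obtain ⟨a, rfl⟩ := Ideal.mem_span_singleton.mp hb'
    refine ⟨a, ?_⟩
    have h2 := congrArg (res (inf_le_inf_right (away I) V'.2)) ht
    rw [map_mul, map_one, res_res] at h2
    rw [map_mul, res_res, mul_right_comm, h2, one_mul]
  have hVW : V.1 ≤ W := hVV₁.trans hV₁
  refine ⟨V.1, b ^ n * a, hcV, ?_, ?_⟩
  · rw [Scheme.basicOpen_mul, Scheme.basicOpen_pow _ _ (by omega), ← inf_away_eq_basicOpen hb]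
    exact inf_le_left.trans (inf_le_inf_right _ hVW)
  · have h3 := congrArg (res (le_inf inf_le_left (inf_le_right.trans inf_le_right) :
      V.1 ⊓ (W ⊓ away I) ≤ V.1 ⊓ away I)) ht
    rw [ha] at h3
    simpa only [map_mul, map_one, res_res, mul_assoc] using h3

end Cartier

section Away

variable {C : Scheme.{u}} {I : C.IdealSheafData}

lemma generatesAt_of_mem_basicOpen {n : ℕ} {W : C.Opens} {s : Γ(C, W ⊓ away I)} {y : C}
    (hy : y ∈ C.basicOpen s) : GeneratesAt I n s y := by
  have hle := C.basicOpen_le s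
  refine ⟨C.basicOpen s, hle.trans inf_le_left, hy, fun V' h t _ => ?_⟩
  have h' : V' ≤ V' ⊓ away I := le_inf le_rfl ((h.trans hle).trans inf_le_right)
  obtain ⟨v, hv⟩ := (isUnit_res_of_le_basicOpen (h.trans hle) s h).exists_right_inv
  refine ⟨res h' t * v, ?_⟩
  have h1 := congrArg (res (inf_le_left : V' ⊓ away I ≤ V')) hv
  simp only [map_mul, map_one, res_res] at h1 ⊢
  rw [res_self, mul_assoc, mul_comm (res _ v), h1, mul_one]

/-- Off `P`, generating `𝒪(nP)` at a point means being an invertible function there. -/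
lemma IsCartier.basicOpen_eq_inf (hI : IsCartier I) {n : ℕ} (hn : 1 ≤ n) {W V : C.Opens}
    (hVW : V ≤ W) {s : Γ(C, W ⊓ away I)} (hs : ∀ y ∈ W, y ∈ V ↔ GeneratesAt I n s y) :
    C.basicOpen s = V ⊓ away I := by
  ext y
  constructor
  · intro hy
    have h := C.basicOpen_le s hy
    exact ⟨(hs y h.1).mpr (generatesAt_of_mem_basicOpen hy), h.2⟩
  · intro hy
    obtain ⟨V', u, hyV', -, h⟩ :=
      ((hs y (hVW hy.1)).mp hy.1).exists_mul_eq_one hI hn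
    have h1 : y ∈ C.basicOpen (res (inf_le_right : V' ⊓ (W ⊓ away I) ≤ _) s) := by
      rw [Scheme.basicOpen_of_isUnit _ (IsUnit.of_mul_eq_one_right _ h)]
      exact ⟨hyV', hVW hy.1, hy.2⟩
    rw [basicOpen_res'] at h1
    exact h1.2

end Away

/-! ### A criterion for an open subset to be affine -/

section Affine

variable {C : Scheme.{u}} {Y : C.Opens}

/-- The valuative criterion makes the map closed, and for quasi-compact `Y` its image is dense. -/
lemma toSpecΓ_surjective (hY : IsCompact (Y : Set C))
    (h : ValuativeCriterion.Existence Y.toSpecΓ) : Function.Surjective Y.toSpecΓ := by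
  have : CompactSpace Y := isCompact_iff_compactSpace.mp hY
  have : QuasiCompact Y.toSpecΓ := by delta Scheme.Opens.toSpecΓ; infer_instance
  have h1 := UniversallyClosed.of_valuativeCriterion _ h
  have : IsDominant Y.toSpecΓ := by delta Scheme.Opens.toSpecΓ; infer_instance
  rw [← Set.range_eq_univ, ← Y.toSpecΓ.isClosedMap.isClosed_range.closure_eq]
  exact Y.toSpecΓ.denseRange.closure_range

/-- It suffices that the functions with affine basic open generate the unit ideal. Otherwise they
lie in a maximal ideal, which is the image of a point of `Y`; but one of them is invertible at that
point. -/
lemma isAffineOpen_of_surjective_toSpecΓ (h : Function.Surjective Y.toSpecΓ)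
    (hs : ∀ y ∈ Y, ∃ s : Γ(C, Y), y ∈ C.basicOpen s ∧ IsAffineOpen (C.basicOpen s)) :
    IsAffineOpen Y := by
  refine isAffineOpen_of_isAffineOpen_basicOpen Y {s | IsAffineOpen (C.basicOpen s)} ?_
    fun _ h => h
  by_contra hne
  obtain ⟨m, hm, hle⟩ := Ideal.exists_le_maximal _ hne
  obtain ⟨y, hy⟩ := h ⟨m, hm.isPrime⟩
  obtain ⟨s, hys, hsa⟩ := hs y.1 y.2
  have h1 : y ∈ Y.toSpecΓ ⁻¹ᵁ PrimeSpectrum.basicOpen s := by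
    rw [Scheme.Opens.toSpecΓ_preimage_basicOpen]
    exact hys
  have h2 : Y.toSpecΓ y ∈ PrimeSpectrum.basicOpen s := h1
  rw [hy] at h2
  exact h2 (hle (Ideal.subset_span hsa))

end Affine

namespace GeometricDatum

variable {S : Scheme.{u}} {r : ℕ} (D : GeometricDatum S r)

/-- The sections provided by ampleness serve twice: their local inverses give the valuative
criterion, and their basic opens, being affine opens with `P` removed, cover `π⁻¹(U) ∖ P`. -/
theorem isAffineOpen_punctured {U : S.Opens} (hU : IsAffineOpen U) :
    IsAffineOpen (D.punctured U) := by
  have := D.locallyProjective.isProper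
  refine isAffineOpen_of_surjective_toSpecΓ (toSpecΓ_surjective
    (D.cartier.isCompact_inf_away (QuasiCompact.isCompact_preimage _ U.2 hU.isCompact))
    (existence_toSpecΓ D.π hU inf_le_left fun c hc => ?_)) fun y hy => ?_
  · obtain ⟨n, hn, s, -, W, hcW, hs⟩ := D.ample ⟨U, hU⟩ c hc
    obtain ⟨V, u, h⟩ := ((hs c hc).mp hcW).exists_mul_eq_one D.cartier hn
    exact ⟨s, V, u, h⟩
  · obtain ⟨n, hn, s, -, W, hcW, hs⟩ := D.ample ⟨U, hU⟩ y hy.1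
    refine ⟨s, ?_, ?_⟩
    · rw [D.cartier.basicOpen_eq_inf hn W.2 hs]
      exact ⟨hcW, hy.2⟩
    · rw [D.cartier.basicOpen_eq_inf hn W.2 hs]
      exact D.cartier.isAffineOpen_inf_away W.1.2

instance isClosedImmersion_p : IsClosedImmersion D.p := by
  have := D.locallyProjective.isProper
  have : IsClosedImmersion (D.p ≫ D.π) := by
    rw [D.section_eq]
    infer_instance
  exact IsClosedImmersion.of_comp D.p D.π

lemma exists_p_eq_of_notMem_away {x : D.C} (hx : x ∉ away D.ideal) : ∃ s, D.p s = x := by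
  have h : x ∈ (D.ideal.support : Set D.C) := not_not.mp hx
  rw [Scheme.Hom.support_ker, D.p.isClosedEmbedding.isClosed_range.closure_eq] at h
  exact h

lemma p_mem_preimage {s : S} {U : S.Opens} (hs : s ∈ U) : D.p s ∈ D.π ⁻¹ᵁ U := by
  change D.π (D.p s) ∈ U
  rwa [← Scheme.Hom.comp_apply, D.section_eq]

end GeometricDatum

/-! ### Restriction of vectors of Laurent series -/

section LaurentRes

variable {S : Scheme.{u}} {r : ℕ}

/-- Restriction of vectors of Laurent series. -/
def laurentRes {V W : S.Opens} (h : V ≤ W) :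
    (Fin r → LaurentSeries Γ(S, W)) →+ (Fin r → LaurentSeries Γ(S, V)) :=
  (laurentMap (res h)).toAddMonoidHom.compLeft (Fin r)

lemma laurentRes_apply {V W : S.Opens} (h : V ≤ W) (g : Fin r → LaurentSeries Γ(S, W)) :
    laurentRes h g = fun i => laurentMap (res h) (g i) := rfl

lemma laurentRes_laurentRes {V W Z : S.Opens} (h : V ≤ W) (h' : W ≤ Z)
    (g : Fin r → LaurentSeries Γ(S, Z)) :
    laurentRes h (laurentRes h' g) = laurentRes (h.trans h') g :=
  funext fun _ => laurentMap_res_res h h' _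

lemma laurentRes_self {V : S.Opens} (g : Fin r → LaurentSeries Γ(S, V)) :
    laurentRes le_rfl g = g :=
  funext fun _ => GeometricDatum.laurentMap_res_self _

lemma laurentRes_smul {V W : S.Opens} (h : V ≤ W) (c : Γ(S, W))
    (g : Fin r → LaurentSeries Γ(S, W)) : laurentRes h (c • g) = res h c • laurentRes h g :=
  funext fun _ => laurentMap_smul _ _ _

lemma laurentRes_mem {V W : S.Opens} (h : V ≤ W) {g : Fin r → LaurentSeries Γ(S, W)}
    (hg : ∀ i, g i ∈ powerSeriesIn _) (i : Fin r) : laurentRes h g i ∈ powerSeriesIn _ :=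
  laurentMap_mem _ (hg i)

end LaurentRes

namespace GeometricDatum

variable {S : Scheme.{u}} {r : ℕ} (D : GeometricDatum S r)

/-! ### Coverings of the curve by an affine neighbourhood of `P` and the complement of `P` -/

/-- `V` is a principal neighbourhood of the part of `P` over the affine open `U`. -/
structure Adapted (U : S.Opens) (V : AffIn (D.π ⁻¹ᵁ U)) : Prop where
  isAffineOpen : IsAffineOpen U
  le_preimage : U ≤ D.p ⁻¹ᵁ V.1.1
  isPrincipal : ∃ b, D.ideal.ideal V.1 = Ideal.span {b}

variable {D} in
lemma Adapted.cover {U : S.Opens} {V : AffIn (D.π ⁻¹ᵁ U)} (h : D.Adapted U V) :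
    D.π ⁻¹ᵁ U ≤ V.1.1 ⊔ D.punctured U := by
  intro c hc
  by_cases hca : c ∈ away D.ideal
  · exact Or.inr ⟨hc, hca⟩
  · obtain ⟨s, rfl⟩ := D.exists_p_eq_of_notMem_away hca
    have hs : D.π (D.p s) ∈ U := hc
    rw [← Scheme.Hom.comp_apply, D.section_eq] at hs
    exact Or.inl (h.le_preimage hs)

/-- Start from a principal affine `V₀` around `p(s)` and shrink the base to the basic open of some
`f` over which `P` lies in `V₀`. The part of `V₀` over it is a basic open of `V₀`, hence affine. The
freedom in `W` allows common refinements of such neighbourhoods. -/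
lemma exists_adapted {U : S.Opens} {s : S} (hs : s ∈ U) {W : D.C.Opens} (hW : D.p s ∈ W) :
    ∃ (U' : S.Opens) (_ : U' ≤ U) (V : AffIn (D.π ⁻¹ᵁ U')), s ∈ U' ∧ V.1.1 ≤ W ∧
      D.Adapted U' V := by
  obtain ⟨U₁, hU₁, hsU₁, hle⟩ := exists_isAffineOpen_mem_and_subset hs
  obtain ⟨V₀, hsV₀, hV₀, b, hb⟩ := D.cartier.exists_isPrincipal (W := W ⊓ D.π ⁻¹ᵁ U₁)
    ⟨hW, D.p_mem_preimage hsU₁⟩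
  have hV₀U₁ : V₀.1 ≤ D.π ⁻¹ᵁ U₁ := hV₀.trans inf_le_right
  obtain ⟨f, hf, hsf⟩ := hU₁.exists_basicOpen_le (V := D.p ⁻¹ᵁ V₀.1) ⟨s, hsV₀⟩ hsU₁
  let V : D.C.affineOpens :=
    ⟨D.C.basicOpen (res hV₀U₁ (D.π.app U₁ f)), V₀.2.basicOpen _⟩
  have hV : V.1 = V₀.1 ⊓ D.π ⁻¹ᵁ (S.basicOpen f) := by
    rw [Scheme.preimage_basicOpen]
    exact basicOpen_res' _ _
  have h : V.1 ≤ V₀.1 := hV.le.trans inf_le_left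
  refine ⟨S.basicOpen f, (S.basicOpen_le f).trans hle, ⟨V, hV.le.trans inf_le_right⟩, hsf,
    h.trans (hV₀.trans inf_le_left), hU₁.basicOpen f, ?_, res h b, ?_⟩
  · intro y hy
    exact hV.ge ⟨hf hy, D.p_mem_preimage hy⟩
  · have := D.ideal_pow_res (n := 1) h (b := b) (by rw [pow_one, hb])
    rwa [pow_one] at this

/-! ### Presentations of the first higher direct image -/

/-- A presentation of a sheaf `T` on `S` (such as `R¹π_* F`) as the cokernel of `π_* J → π_* Q`,
for an embedding of `F` in an injective sheaf `J` with quotient `Q`. -/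
structure Presentation (T : S.Modules) where
  /-- the injective sheaf -/
  J : D.C.Modules
  /-- the quotient -/
  Q : D.C.Modules
  /-- the embedding -/
  i : D.F ⟶ J
  /-- the projection -/
  q : J ⟶ Q
  w : i ≫ q = 0
  /-- the connecting map -/
  δ : (Scheme.Modules.pushforward D.π).obj Q ⟶ T
  w' : (Scheme.Modules.pushforward D.π).map q ≫ δ = 0
  injective : Injective J
  shortExact : (ShortComplex.mk i q w).ShortExact
  exact : (ShortComplex.mk ((Scheme.Modules.pushforward D.π).map q) δ w').Exact
  epi : Epi δ

lemma nonempty_presentation :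
    Nonempty (D.Presentation ((higherDirectImage D.π 1).obj D.F)) := by
  obtain ⟨J, Q, i, q, w, δ, w', h1, h2, h3, h4⟩ := exists_connecting_map D.π D.F
  exact ⟨⟨J, Q, i, q, w, δ, w', h1, h2, h3, h4⟩⟩

namespace Presentation

variable {D} {T : S.Modules} (K : D.Presentation T)

/-- The connecting map on sections. -/
def del (U : S.Opens) : Γ(K.Q, D.π ⁻¹ᵁ U) →+ Γ(T, U) := (K.δ.app U).hom

/-- The projection on sections. -/
def proj (V : D.C.Opens) : Γ(K.J, V) →+ Γ(K.Q, V) := (K.q.app V).hom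

/-- The embedding on sections. -/
def emb (V : D.C.Opens) : Γ(D.F, V) →+ Γ(K.J, V) := (K.i.app V).hom

lemma del_res {U U' : S.Opens} (h : U' ≤ U) (x : Γ(K.Q, D.π ⁻¹ᵁ U)) :
    K.del U' (resM K.Q (preimage_le D.π h) x) = resM T h (K.del U x) :=
  app_resM K.δ h x

lemma proj_res {V V' : D.C.Opens} (h : V' ≤ V) (x : Γ(K.J, V)) :
    K.proj V' (resM K.J h x) = resM K.Q h (K.proj V x) :=
  app_resM K.q h x

lemma emb_res {V V' : D.C.Opens} (h : V' ≤ V) (x : Γ(D.F, V)) :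
    K.emb V' (resM D.F h x) = resM K.J h (K.emb V x) :=
  app_resM K.i h x

lemma del_smul (U : S.Opens) (c : Γ(S, U)) (x : Γ(K.Q, D.π ⁻¹ᵁ U)) :
    K.del U (D.π.app U c • x) = c • K.del U x :=
  K.δ.app_smul c x

lemma proj_smul (V : D.C.Opens) (c : Γ(D.C, V)) (x : Γ(K.J, V)) :
    K.proj V (c • x) = c • K.proj V x :=
  K.q.app_smul c x

lemma emb_smul (V : D.C.Opens) (c : Γ(D.C, V)) (x : Γ(D.F, V)) :
    K.emb V (c • x) = c • K.emb V x :=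
  K.i.app_smul c x

lemma proj_emb (V : D.C.Opens) (f : Γ(D.F, V)) : K.proj V (K.emb V f) = 0 :=
  congrArg (fun φ => φ.app V f) K.w

lemma del_proj (U : S.Opens) (j : Γ(K.J, D.π ⁻¹ᵁ U)) : K.del U (K.proj _ j) = 0 :=
  congrArg (fun φ => φ.app U j) K.w'

lemma emb_injective (V : D.C.Opens) : Function.Injective (K.emb V) :=
  have := K.shortExact.mono_f
  app_injective_of_mono K.i V

lemma exists_emb_eq {V : D.C.Opens} (j : Γ(K.J, V)) (hj : K.proj V j = 0) :
    ∃ f, K.emb V f = j :=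
  have := K.shortExact.mono_f
  exists_of_exact_mono K.shortExact.exact j hj

lemma exists_proj_eq {V : D.C.Opens} (hV : IsAffineOpen V) (x : Γ(K.Q, V)) :
    ∃ j, K.proj V j = x :=
  app_surjective_of_isAffineOpen K.shortExact D.quasicoherent hV x

lemma exists_resM_eq {V W : D.C.Opens} (h : V ≤ W) (j : Γ(K.J, V)) : ∃ t, resM K.J h t = j :=
  have := K.injective
  resM_surjective_of_injective K.J h j

lemma exists_local_del_eq {U : S.Opens} (τ : Γ(T, U)) {s : S} (hs : s ∈ U) :
    ∃ (U' : S.Opens) (h : U' ≤ U), s ∈ U' ∧ ∃ x, K.del U' x = resM T h τ :=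
  have := K.epi
  exists_local_lift_of_epi K.δ τ hs

lemma exists_local_proj_eq {U : S.Opens} (x : Γ(K.Q, D.π ⁻¹ᵁ U)) (hx : K.del U x = 0) {s : S}
    (hs : s ∈ U) : ∃ (U' : S.Opens) (h : U' ≤ U), s ∈ U' ∧
      ∃ j, K.proj (D.π ⁻¹ᵁ U') j = resM K.Q (preimage_le D.π h) x :=
  exists_local_of_exact K.exact x hx hs

/-! ### Comparison of Laurent series with sections of the quotient sheaf -/

/-- On the affine open `V`, the section `x` of `Q` lifts to `J`, and the lift restricts on `V ∖ P`
to a section of `F` with expansion `g` up to power series, while `x` vanishes outside `P`. -/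
def Represents {U : S.Opens} (V : AffIn (D.π ⁻¹ᵁ U)) (g : Fin r → LaurentSeries Γ(S, U))
    (x : Γ(K.Q, D.π ⁻¹ᵁ U)) : Prop :=
  resM K.Q (inf_le_left : D.punctured U ≤ _) x = 0 ∧
    ∃ (t : Γ(K.J, V.1.1)) (f : Γ(D.F, V.1.1 ⊓ away D.ideal))
      (h : Fin r → LaurentSeries Γ(S, D.p ⁻¹ᵁ V.1.1)), K.proj _ t = resM K.Q V.2 x ∧
      K.emb _ f = resM K.J inf_le_left t ∧ (∀ i, h i ∈ powerSeriesIn _) ∧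
      D.Expands V.1 f (laurentRes (section_le D.section_eq V.2) g - h)

variable {K} {U : S.Opens} {V : AffIn (D.π ⁻¹ᵁ U)}

lemma Represents.add {g g' : Fin r → LaurentSeries Γ(S, U)} {x x' : Γ(K.Q, D.π ⁻¹ᵁ U)}
    (H : K.Represents V g x) (H' : K.Represents V g' x') : K.Represents V (g + g') (x + x') := by
  obtain ⟨hx, t, f, h, h1, h2, h3, h4⟩ := H
  obtain ⟨hx', t', f', h', h1', h2', h3', h4'⟩ := H'
  refine ⟨by rw [map_add, hx, hx', add_zero], t + t', f + f', h + h', ?_, ?_,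
    fun i => add_mem (h3 i) (h3' i), ?_⟩
  · rw [map_add, map_add, h1, h1']
  · rw [map_add, map_add, h2, h2']
  · rw [map_add, add_sub_add_comm]
    exact h4.add h4'

lemma Represents.smul (c : Γ(S, U)) {g : Fin r → LaurentSeries Γ(S, U)}
    {x : Γ(K.Q, D.π ⁻¹ᵁ U)} (H : K.Represents V g x) :
    K.Represents V (c • g) (D.π.app U c • x) := by
  obtain ⟨hx, t, f, h, h1, h2, h3, h4⟩ := H
  have hVU := section_le D.section_eq V.2
  refine ⟨by rw [resM_smul, hx, smul_zero], res V.2 (D.π.app U c) • t,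
    res ((inf_le_left : V.1.1 ⊓ away D.ideal ≤ _).trans V.2) (D.π.app U c) • f, res hVU c • h, ?_, ?_,
    fun i => Submodule.smul_mem _ _ (h3 i), ?_⟩
  · rw [proj_smul, h1, resM_smul]
  · rw [emb_smul, h2, resM_smul, res_res]
  · rw [laurentRes_smul, ← smul_sub]
    exact h4.smul V.2 c

lemma Represents.restrict {U' : S.Opens} (hU : U' ≤ U) {g : Fin r → LaurentSeries Γ(S, U)}
    {x : Γ(K.Q, D.π ⁻¹ᵁ U)} (H : K.Represents V g x) (V' : AffIn (D.π ⁻¹ᵁ U'))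
    (hV : V'.1.1 ≤ V.1.1) :
    K.Represents V' (laurentRes hU g) (resM K.Q (preimage_le D.π hU) x) := by
  obtain ⟨hx, t, f, h, h1, h2, h3, h4⟩ := H
  refine ⟨?_, resM K.J hV t, resM D.F (inf_le_inf_right _ hV) f,
    laurentRes (preimage_le D.p hV) h, ?_, ?_, laurentRes_mem _ h3, ?_⟩
  · have := congrArg (resM K.Q (inf_le_inf_right _ (preimage_le D.π hU) :
      D.punctured U' ≤ D.punctured U)) hx
    rwa [resM_resM, map_zero, ← resM_resM _ inf_le_left (preimage_le D.π hU)] at this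
  · rw [proj_res, h1, resM_resM, resM_resM]
  · rw [emb_res, h2, resM_resM, resM_resM]
  · have := h4.restrict hV
    rw [← laurentRes_apply, map_sub, laurentRes_laurentRes] at this
    rwa [laurentRes_laurentRes]

lemma represents_zero_of_mem (K : D.Presentation T) (V : AffIn (D.π ⁻¹ᵁ U))
    {g : Fin r → LaurentSeries Γ(S, U)}
    (hg : ∀ i, g i ∈ powerSeriesIn _) : K.Represents V g 0 := by
  refine ⟨map_zero _, 0, 0, laurentRes (section_le D.section_eq V.2) g, ?_, ?_,
    laurentRes_mem _ hg, ?_⟩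
  · rw [map_zero, map_zero]
  · rw [map_zero, map_zero]
  · rw [sub_self]
    have h := D.expands_section (V := V.1) 0
    rw [map_zero] at h
    convert h using 1
    exact funext fun i => (D.expandF_zero _ i).symm

/-- This makes the class of `x` depend only on `g`. Here `f` has integral expansion, so it extends
to a section `m` of `F` on `V`. Then `t - m` vanishes off `P` and glues with zero to a section of
`J` lifting `x`. -/
lemma Represents.del_eq_zero (hV : D.Adapted U V) {x : Γ(K.Q, D.π ⁻¹ᵁ U)}
    (H : K.Represents V 0 x) : K.del U x = 0 := by
  obtain ⟨hx, t, f, h, h1, h2, h3, h4⟩ := H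
  rw [map_zero, zero_sub] at h4
  obtain ⟨m, rfl⟩ := h4.exists_extension fun i => neg_mem (h3 i)
  obtain ⟨j, hj₁, hj₂⟩ := exists_glue₂ K.J V.2 (inf_le_left : D.punctured U ≤ _) hV.cover
    (t - K.emb _ m) 0 (by
      rw [map_zero, map_sub]
      have := congrArg (resM K.J (le_inf inf_le_left (inf_le_right.trans inf_le_right) :
        V.1.1 ⊓ D.punctured U ≤ V.1.1 ⊓ away D.ideal)) h2
      rw [emb_res, resM_resM, resM_resM] at this
      rw [this, sub_self])
  have e : x = K.proj _ j := by
    refine section_ext₂ K.Q V.2 (inf_le_left : D.punctured U ≤ _) hV.cover ?_ ?_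
    · rw [← proj_res, hj₁, map_sub, h1, proj_emb, sub_zero]
    · rw [← proj_res, hj₂, hx, map_zero]
  rw [e, del_proj]

/-- Realise `g`, up to power series, by a section of `F` on `V ∖ P` and extend it to `V` inside the
flasque sheaf `J`. Its image in `Q` is zero on `V ∖ P`, so it glues with zero off `P`. -/
lemma exists_represents (K : D.Presentation T) (hV : D.Adapted U V)
    (g : Fin r → LaurentSeries Γ(S, U)) : ∃ x, K.Represents V g x := by
  obtain ⟨b, hb⟩ := hV.isPrincipal
  obtain ⟨f, h, hh, hf⟩ := D.exists_expands_sub hb (laurentRes (section_le D.section_eq V.2) g)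
  obtain ⟨t, ht⟩ := K.exists_resM_eq (inf_le_left : V.1.1 ⊓ away D.ideal ≤ _) (K.emb _ f)
  obtain ⟨x, hx₁, hx₂⟩ := exists_glue₂ K.Q V.2 (inf_le_left : D.punctured U ≤ _) hV.cover
    (K.proj _ t) 0 (by
      have := congrArg (resM K.Q (le_inf inf_le_left (inf_le_right.trans inf_le_right) :
        V.1.1 ⊓ D.punctured U ≤ V.1.1 ⊓ away D.ideal)) (congrArg (K.proj _) ht)
      rw [proj_emb, proj_res, resM_resM] at this
      rw [map_zero, this, map_zero])
  exact ⟨x, hx₂, t, f, h, hx₁.symm, ht.symm, hh, hf⟩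

/-- The source of surjectivity, where affineness of the complement of `P` is needed: there `x` lifts
to `J`, and the lift extends to a section `j` over all of `π⁻¹(U)`. What remains of `x` vanishes off
`P` and lifts on the affine `V` to a section which on `V ∖ P` comes from `F`. -/
lemma exists_represents_sub (K : D.Presentation T) (hV : D.Adapted U V)
    (x : Γ(K.Q, D.π ⁻¹ᵁ U)) : ∃ j g, K.Represents V g (x - K.proj _ j) := by
  obtain ⟨j₀, hj₀⟩ := K.exists_proj_eq (D.isAffineOpen_punctured hV.isAffineOpen)
    (resM K.Q inf_le_left x)
  obtain ⟨j, hj⟩ := K.exists_resM_eq (inf_le_left : D.punctured U ≤ _) j₀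
  have hx : resM K.Q (inf_le_left : D.punctured U ≤ _) (x - K.proj _ j) = 0 := by
    rw [map_sub, ← proj_res, hj, hj₀, sub_self]
  obtain ⟨t, ht⟩ := K.exists_proj_eq V.1.2 (resM K.Q V.2 (x - K.proj _ j))
  obtain ⟨f, hf⟩ := K.exists_emb_eq (resM K.J (inf_le_left : V.1.1 ⊓ away D.ideal ≤ _) t) (by
    have := congrArg (resM K.Q (le_inf (inf_le_left.trans V.2) inf_le_right :
      V.1.1 ⊓ away D.ideal ≤ D.punctured U)) hx
    rw [proj_res, ht, resM_resM]
    rwa [resM_resM, map_zero] at this)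
  obtain ⟨b, hb⟩ := hV.isPrincipal
  obtain ⟨g, hg⟩ := D.exists_expands hb f
  -- The expansion has coefficients over `p⁻¹(V)`; since `U` and `p⁻¹(V)` contain each other, it can
  -- be viewed over `U`.
  refine ⟨j, laurentRes hV.le_preimage g, hx, t, f, 0, ht, hf, fun i => zero_mem _, ?_⟩
  rwa [laurentRes_laurentRes, laurentRes_self, sub_zero]

/-- A section of `F` off `P` extends to a section of `J` over all of `π⁻¹(U)`. Its image in `Q`
represents the expansion, and the connecting map kills it. -/
lemma exists_represents_of_localExpansionF (K : D.Presentation T)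
    {m : Γ(D.F, D.punctured U)} {g : Fin r → LaurentSeries Γ(S, U)}
    (H : D.LocalExpansionF m g V) : ∃ x, K.Represents V g x ∧ K.del U x = 0 := by
  obtain ⟨j, hj⟩ := K.exists_resM_eq (inf_le_left : D.punctured U ≤ _) (K.emb _ m)
  refine ⟨K.proj _ j, ⟨?_, resM K.J V.2 j, resM D.F (inf_le_inf_right _ V.2) m, 0, ?_, ?_,
    fun i => zero_mem _, ?_⟩, K.del_proj U j⟩
  · rw [← proj_res, hj, proj_emb]
  · rw [proj_res]
  · rw [emb_res, ← hj, resM_resM, resM_resM]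
  · rw [sub_zero]
    exact H

/-- Compare the two lifts of the same section of `Q`: on `V`, `t - j` comes from a section `a` of
`F`, and off `P`, `j` comes from a section `m` of `F`. On `V ∖ P` this gives `f - a = m`, so `g` is
the expansion of `m` up to power series. -/
lemma Represents.exists_localExpansionF (hV : D.Adapted U V)
    {g : Fin r → LaurentSeries Γ(S, U)} {j : Γ(K.J, D.π ⁻¹ᵁ U)}
    (H : K.Represents V g (K.proj _ j)) :
    ∃ (h : Fin r → LaurentSeries Γ(S, U)) (m : Γ(D.F, D.punctured U)),
      (∀ i, h i ∈ powerSeriesIn _) ∧ D.LocalExpansionF m (g - h) V := by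
  obtain ⟨hx, t, f, h, h1, h2, h3, h4⟩ := H
  obtain ⟨a, ha⟩ := K.exists_emb_eq (t - resM K.J V.2 j) (by
    rw [map_sub, proj_res, h1, sub_self])
  obtain ⟨m, hm⟩ := K.exists_emb_eq (resM K.J (inf_le_left : D.punctured U ≤ _) j) (by
    rw [proj_res, hx])
  have hf : f - resM D.F inf_le_left a = resM D.F (inf_le_inf_right _ V.2) m := by
    apply K.emb_injective
    rw [map_sub, h2, emb_res, emb_res, ha, hm, map_sub, resM_resM, resM_resM, sub_sub_cancel]
  have h5 := h4.sub (D.expands_section a)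
  rw [hf, sub_sub] at h5
  refine ⟨laurentRes hV.le_preimage (h + D.expandF _ a), m,
    laurentRes_mem _ fun i => add_mem (h3 i) (D.expandF_mem _ a i), ?_⟩
  change D.Expands V.1 _ (laurentRes (section_le D.section_eq V.2) _)
  rwa [map_sub, laurentRes_laurentRes, laurentRes_self]

end Presentation

end GeometricDatum

/-! ### The homomorphism from Laurent vectors to the direct image, its kernel and its image -/

namespace GeometricDatum

variable {S : Scheme.{u}} {r : ℕ} {D : GeometricDatum S r}

namespace Presentation

variable {T : S.Modules} (K : D.Presentation T)

/-- Locally on `U`, the section `τ` is the image of a section of `Q` represented by `g`. -/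
def Matches {U : S.Opens} (g : Fin r → LaurentSeries Γ(S, U)) (τ : Γ(T, U)) : Prop :=
  ∀ s ∈ U, ∃ (U' : S.Opens) (h : U' ≤ U) (V : AffIn (D.π ⁻¹ᵁ U')), s ∈ U' ∧ D.Adapted U' V ∧
    ∃ x, K.Represents V (laurentRes h g) x ∧ K.del U' x = resM T h τ

variable {K} {U : S.Opens}

lemma Represents.matches {V : AffIn (D.π ⁻¹ᵁ U)} (hV : D.Adapted U V)
    {g : Fin r → LaurentSeries Γ(S, U)} {x : Γ(K.Q, D.π ⁻¹ᵁ U)} (H : K.Represents V g x)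
    {U' : S.Opens} (hU : U' ≤ U) : K.Matches (laurentRes hU g) (resM T hU (K.del U x)) := by
  intro s hs
  obtain ⟨U₁, hU₁, V₁, hs₁, hV₁, hA⟩ := D.exists_adapted hs (W := V.1.1) (hV.le_preimage (hU hs))
  refine ⟨U₁, hU₁, V₁, hs₁, hA, resM K.Q (preimage_le D.π (hU₁.trans hU)) x, ?_, ?_⟩
  · rw [laurentRes_laurentRes]
    exact H.restrict (hU₁.trans hU) V₁ hV₁
  · rw [del_res, resM_resM]

lemma Matches.restrict {g : Fin r → LaurentSeries Γ(S, U)} {τ : Γ(T, U)} (H : K.Matches g τ)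
    {U' : S.Opens} (hU : U' ≤ U) : K.Matches (laurentRes hU g) (resM T hU τ) := by
  intro s hs
  obtain ⟨U₁, h₁, V₁, hs₁, hA₁, x, hx, hxτ⟩ := H s (hU hs)
  obtain ⟨U₂, h₂, V₂, hs₂, hV₂, hA₂⟩ := D.exists_adapted (U := U₁ ⊓ U') ⟨hs₁, hs⟩ (W := V₁.1.1)
    (hA₁.le_preimage hs₁)
  refine ⟨U₂, h₂.trans inf_le_right, V₂, hs₂, hA₂,
    resM K.Q (preimage_le D.π (h₂.trans inf_le_left)) x, ?_, ?_⟩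
  · have := hx.restrict (h₂.trans inf_le_left) V₂ hV₂
    rw [laurentRes_laurentRes] at this ⊢
    exact this
  · rw [K.del_res (h₂.trans inf_le_left), hxτ, resM_resM, resM_resM]

lemma Matches.add {g g' : Fin r → LaurentSeries Γ(S, U)} {τ τ' : Γ(T, U)} (H : K.Matches g τ)
    (H' : K.Matches g' τ') : K.Matches (g + g') (τ + τ') := by
  intro s hs
  obtain ⟨U₁, h₁, V₁, hs₁, hA₁, x, hx, hxτ⟩ := H s hs
  obtain ⟨U₂, h₂, V₂, hs₂, hA₂, x', hx', hxτ'⟩ := H' s hs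
  obtain ⟨U₃, h₃, V₃, hs₃, hV₃, hA₃⟩ := D.exists_adapted (U := U₁ ⊓ U₂) ⟨hs₁, hs₂⟩
    (W := V₁.1.1 ⊓ V₂.1.1) ⟨hA₁.le_preimage hs₁, hA₂.le_preimage hs₂⟩
  have e := hx.restrict (h₃.trans inf_le_left) V₃ (hV₃.trans inf_le_left)
  have e' := hx'.restrict (h₃.trans inf_le_right) V₃ (hV₃.trans inf_le_right)
  rw [laurentRes_laurentRes] at e e'
  refine ⟨U₃, (h₃.trans inf_le_left).trans h₁, V₃, hs₃, hA₃,
    resM K.Q (preimage_le D.π (h₃.trans inf_le_left)) x +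
      resM K.Q (preimage_le D.π (h₃.trans inf_le_right)) x', ?_, ?_⟩
  · rw [map_add]
    exact e.add e'
  · rw [map_add, K.del_res (h₃.trans inf_le_left), K.del_res (h₃.trans inf_le_right), hxτ, hxτ',
      resM_resM, resM_resM, map_add]

lemma Matches.smul (c : Γ(S, U)) {g : Fin r → LaurentSeries Γ(S, U)} {τ : Γ(T, U)}
    (H : K.Matches g τ) : K.Matches (c • g) (c • τ) := by
  intro s hs
  obtain ⟨U₁, h₁, V₁, hs₁, hA₁, x, hx, hxτ⟩ := H s hs
  refine ⟨U₁, h₁, V₁, hs₁, hA₁, D.π.app U₁ (res h₁ c) • x, ?_, ?_⟩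
  · rw [laurentRes_smul]
    exact hx.smul (res h₁ c)
  · rw [del_smul, hxτ, resM_smul]

lemma Matches.eq_zero {τ : Γ(T, U)} (H : K.Matches 0 τ) : τ = 0 := by
  refine section_ext T fun s hs => ?_
  obtain ⟨U₁, h₁, V₁, hs₁, hA₁, x, hx, hxτ⟩ := H s hs
  rw [map_zero] at hx
  exact ⟨U₁, h₁, hs₁, by rw [← hxτ, hx.del_eq_zero hA₁, map_zero]⟩

lemma Matches.unique {g : Fin r → LaurentSeries Γ(S, U)} {τ τ' : Γ(T, U)} (H : K.Matches g τ)
    (H' : K.Matches g τ') : τ = τ' := by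
  have h := H'.smul (-1)
  rw [neg_one_smul, neg_one_smul] at h
  have h' := H.add h
  rw [add_neg_cancel, ← sub_eq_add_neg] at h'
  exact sub_eq_zero.mp h'.eq_zero

/-- Representatives exist over small opens, and `Matches.unique` makes their classes agree on
overlaps, so they glue. -/
lemma exists_matches (K : D.Presentation T) (g : Fin r → LaurentSeries Γ(S, U)) :
    ∃ τ : Γ(T, U), K.Matches g τ := by
  have H (s : U) : ∃ (U' : S.Opens) (h : U' ≤ U) (V : AffIn (D.π ⁻¹ᵁ U')), s.1 ∈ U' ∧
      D.Adapted U' V ∧ ∃ x, K.Represents V (laurentRes h g) x := by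
    obtain ⟨U', h, V, hs, -, hA⟩ := D.exists_adapted s.2 (W := ⊤) trivial
    exact ⟨U', h, V, hs, hA, exists_represents K hA _⟩
  choose W h V hs hA x hx using H
  obtain ⟨τ, hτ⟩ := exists_glue T U W h (fun s hsU => Opens.mem_iSup.mpr ⟨⟨s, hsU⟩, hs _⟩)
    (fun s => K.del _ (x s)) fun s s' => by
      have e := (hx s).matches (hA s) (inf_le_left : W s ⊓ W s' ≤ _)
      have e' := (hx s').matches (hA s') (inf_le_right : W s ⊓ W s' ≤ _)
      rw [laurentRes_laurentRes] at e e'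
      exact e.unique e'
  exact ⟨τ, fun s hsU => ⟨W ⟨s, hsU⟩, h _, V _, hs _, hA _, x _, hx _, (hτ _).symm⟩⟩

/-- The section of `T` determined by a vector of Laurent series. -/
def ofLaurent (K : D.Presentation T) (g : Fin r → LaurentSeries Γ(S, U)) : Γ(T, U) :=
  (exists_matches K g).choose

lemma matches_ofLaurent (K : D.Presentation T) (g : Fin r → LaurentSeries Γ(S, U)) :
    K.Matches g (K.ofLaurent g) :=
  (exists_matches K g).choose_spec

lemma ofLaurent_eq_zero_of_mem (K : D.Presentation T) {g : Fin r → LaurentSeries Γ(S, U)}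
    (hg : ∀ i, g i ∈ powerSeriesIn _) : K.ofLaurent g = 0 := by
  refine (K.matches_ofLaurent g).unique fun s hs => ?_
  obtain ⟨U', h, V, hsU', -, hA⟩ := D.exists_adapted hs (W := ⊤) trivial
  exact ⟨U', h, V, hsU', hA, 0, represents_zero_of_mem K V (laurentRes_mem h hg), by
    rw [map_zero, map_zero]⟩

lemma ofLaurent_eq_zero_of_mem_sectionsW (K : D.Presentation T)
    {g : Fin r → LaurentSeries Γ(S, U)} (hg : g ∈ D.sectionsW U) : K.ofLaurent g = 0 := by
  obtain ⟨m, hm⟩ := hg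
  refine (K.matches_ofLaurent g).unique fun s hs => ?_
  obtain ⟨V, hsV, H⟩ := hm s hs
  obtain ⟨U', h, V', hsU', hV', hA⟩ := D.exists_adapted hs hsV
  obtain ⟨x, hx, hx0⟩ := exists_represents_of_localExpansionF K (H.restrict h V' hV')
  exact ⟨U', h, V', hsU', hA, x, hx, by rw [hx0, map_zero]⟩

/-- When the class vanishes, the representing section of `Q` lifts to `J` over a smaller open of the
base, and the lift produces a section of `F` off `P`. After shrinking, a single neighbourhood `V₃`
contains all of `P` over `U₃`, so it certifies the expansion at every point. -/
lemma exists_mem_of_ofLaurent_eq_zero {g : Fin r → LaurentSeries Γ(S, U)}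
    (hg : K.ofLaurent g = 0) {s : S} (hs : s ∈ U) :
    ∃ (U' : S.Opens) (h : U' ≤ U), s ∈ U' ∧ ∃ g₁ ∈ D.sectionsW U', ∃ g₂,
      (∀ i, g₂ i ∈ powerSeriesIn _) ∧ laurentRes h g = g₁ + g₂ := by
  obtain ⟨U₁, h₁, V₁, hs₁, hA₁, x, hx, hxτ⟩ := K.matches_ofLaurent g s hs
  rw [hg, map_zero] at hxτ
  obtain ⟨U₂, h₂, hs₂, j, hj⟩ := K.exists_local_proj_eq x hxτ hs₁
  obtain ⟨U₃, h₃, V₃, hs₃, hV₃, hA₃⟩ := D.exists_adapted hs₂ (hA₁.le_preimage hs₁)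
  have e := hx.restrict (h₃.trans h₂) V₃ hV₃
  rw [← resM_resM _ (preimage_le D.π h₃) (preimage_le D.π h₂), ← hj, ← proj_res,
    laurentRes_laurentRes] at e
  obtain ⟨g₂, m, hg₂, H⟩ := e.exists_localExpansionF hA₃
  exact ⟨U₃, _, hs₃, _, ⟨m, fun y hy => ⟨V₃, hA₃.le_preimage hy, H⟩⟩, g₂, hg₂,
    (sub_add_cancel _ _).symm⟩

lemma exists_ofLaurent_eq (K : D.Presentation T) (τ : Γ(T, U)) {s : S} (hs : s ∈ U) :
    ∃ (U' : S.Opens) (h : U' ≤ U), s ∈ U' ∧ ∃ g : Fin r → LaurentSeries Γ(S, U'),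
      K.ofLaurent g = resM T h τ := by
  obtain ⟨U₁, h₁, hs₁, x, hx⟩ := K.exists_local_del_eq τ hs
  obtain ⟨U₂, h₂, V₂, hs₂, -, hA₂⟩ := D.exists_adapted hs₁ (W := ⊤) trivial
  obtain ⟨j, g, hg⟩ := exists_represents_sub K hA₂ (resM K.Q (preimage_le D.π h₂) x)
  have e := hg.matches hA₂ le_rfl
  rw [laurentRes_self, resM_self, map_sub, del_proj, sub_zero, K.del_res h₂, hx,
    resM_resM] at e
  exact ⟨U₂, h₂.trans h₁, hs₂, g, (K.matches_ofLaurent g).unique e⟩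

/-- The morphism from vectors of Laurent series to `T`. -/
def laurentHom (K : D.Presentation T) :
    laurentPow S r ⟶ (Scheme.Modules.toPresheafOfModules S).obj T where
  app U := ModuleCat.ofHom
    { toFun := fun g => K.ofLaurent (U := U.unop) g
      map_add' := fun g g' => (K.matches_ofLaurent _).unique
        ((K.matches_ofLaurent g).add (K.matches_ofLaurent g'))
      map_smul' := fun c g => (K.matches_ofLaurent _).unique ((K.matches_ofLaurent g).smul c) }
  naturality {U U'} h := by
    ext g
    exact (K.matches_ofLaurent _).unique ((K.matches_ofLaurent g).restrict h.unop.le)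

/-- The direct image enters only through its presentation, so the same argument serves for `F` and
for the structure sheaf. -/
theorem nonempty_iso (K : D.Presentation T) :
    Nonempty (quotientSheaf (laurentPow S r) (D.schurW ⊔ powerSeriesPowSub S r) ≅ T) := by
  refine nonempty_quotientSheaf_iso K.laurentHom (fun U g hg => ?_) (fun U g hg s hs => ?_)
    fun U τ s hs => ?_
  · obtain ⟨g₁, hg₁, g₂, hg₂, rfl⟩ := Submodule.mem_sup.mp hg
    refine (map_add _ _ _).trans ?_
    have e₁ := ofLaurent_eq_zero_of_mem_sectionsW K hg₁
    have e₂ := ofLaurent_eq_zero_of_mem K fun i => hg₂ i (Set.mem_univ i)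
    exact (congrArg₂ (· + ·) e₁ e₂).trans (add_zero _)
  · obtain ⟨U', h, hs', g₁, hg₁, g₂, hg₂, e⟩ := exists_mem_of_ofLaurent_eq_zero (K := K) hg hs
    refine ⟨U', h, hs', ?_⟩
    have e' : laurentRes h g ∈ D.sectionsW U' ⊔ powerSeriesPowIn _ r :=
      Submodule.mem_sup.mpr ⟨g₁, hg₁, g₂, fun i _ => hg₂ i, e.symm⟩
    exact e'
  · exact K.exists_ofLaurent_eq τ hs

end Presentation

end GeometricDatum

/-! ### The structure sheaf as a datum of rank one -/

section Unit

variable {T : Type u} [SmallCategory T] {J : GrothendieckTopology T} (R : Sheaf J RingCat.{u})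

/-- The free sheaf of modules on one generator is the structure sheaf. -/
def freePUnitIso : SheafOfModules.free PUnit.{u + 1} ≅ SheafOfModules.unit R :=
  coproductUniqueIso fun _ : PUnit.{u + 1} => SheafOfModules.unit R

/-- The structure sheaf is generated by one section. -/
def unitGeneratingSections : (SheafOfModules.unit R).GeneratingSections :=
  (SheafOfModules.free.generatingSections PUnit).ofEpi (freePUnitIso R).hom

instance isIso_unitGeneratingSections_π : IsIso (unitGeneratingSections R).π := by
  rw [unitGeneratingSections, SheafOfModules.GeneratingSections.ofEpi_π,
    SheafOfModules.free.generatingSections_π]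
  exact inferInstanceAs (IsIso (𝟙 _ ≫ (freePUnitIso R).hom))

variable {R} in
-- A basis is carried to a basis by a functor that preserves colimits and the unit. This is applied
-- to restriction to an open subset.
lemma isIso_map_π {T' : Type u} [SmallCategory T'] {J' : GrothendieckTopology T'}
    {R' : Sheaf J' RingCat.{u}} {M : SheafOfModules.{u} R} (G : M.GeneratingSections)
    (F : SheafOfModules.{u} R ⥤ SheafOfModules.{u} R') [PreservesColimitsOfSize.{u, u} F]
    (η : SheafOfModules.unit R' ≅ F.obj (SheafOfModules.unit R)) [IsIso G.π] :
    IsIso (G.map F η).π := by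
  refine (congrArg (fun f => IsIso f) (G.map_π_eq F η)).mpr ?_
  exact IsIso.comp_isIso' (Iso.isIso_hom (SheafOfModules.mapFreeIso F G.I η)) inferInstance

variable [HasBinaryProducts T]

/-- The structure sheaf is free on one generator, and so are its restrictions; locally free sheaves
are quasi-coherent. -/
lemma isQuasicoherent_unit : (SheafOfModules.unit R).IsQuasicoherent := by
  have h : (unitGeneratingSections R).localGeneratorsData.IsLocallyFreeData := by
    constructor
    intro (i : T)
    exact isIso_map_π (unitGeneratingSections R) (SheafOfModules.pushforward (𝟙 (R.over i)))
      (Iso.refl _)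
  have := (unitGeneratingSections R).localGeneratorsData.isLocallyFree
  infer_instance

lemma isFiniteType_unit : (SheafOfModules.unit R).IsFiniteType := by
  have h : (unitGeneratingSections R).localGeneratorsData.IsFiniteType := by
    constructor
    intro (i : T)
    exact ⟨inferInstanceAs (Finite PUnit.{u + 1})⟩
  constructor
  exact ⟨_, h⟩

end Unit

section StructureModule

lemma smul_eq_mul_adicCompletion {A : Type u} [CommRing A] {I : Ideal A}
    (c y : AdicCompletion I A) :
    (AdicCompletion.module I).toSMul.smul c y = c * y := by
  rfl

variable {X : Scheme.{u}} (I : X.IdealSheafData)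

/-- The completion of the structure sheaf, considered as a module over itself, is the completed
structure sheaf. -/
def completionStructureEquiv (W : X.Opens) :
    completionModule I (structureModule X) W ≃ₗ[completionRing I W] completionRing I W where
  toFun x := ⟨x.1, x.2⟩
  invFun x := ⟨x.1, x.2⟩
  left_inv _ := rfl
  right_inv _ := rfl
  map_add' _ _ := rfl
  map_smul' c x := by
    apply Subtype.ext
    funext V
    exact smul_eq_mul_adicCompletion (c.1 V) (x.1 V)

lemma isQuasicoherent_structureModule :
    SheafOfModules.IsQuasicoherent (R := X.ringCatSheaf) (structureModule X) :=
  isQuasicoherent_unit _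

lemma isFiniteType_structureModule :
    SheafOfModules.IsFiniteType (R := X.ringCatSheaf) (structureModule X) :=
  isFiniteType_unit _

end StructureModule

namespace GeometricDatum

variable {S : Scheme.{u}} {r : ℕ} (D : GeometricDatum S r)

/-- The geometric datum of rank one with the structure sheaf as sheaf on the curve. -/
def structureDatum : GeometricDatum S 1 where
  C := D.C
  π := D.π
  p := D.p
  section_eq := D.section_eq
  locallyProjective := D.locallyProjective
  cartier := D.cartier
  ample := D.ample
  conormal := D.conormal
  ρ := D.ρ
  ρ_res := D.ρ_res
  ρ_algebra := D.ρ_algebra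
  ρ_continuous := D.ρ_continuous
  ρ_symm_continuous := D.ρ_symm_continuous
  separated := D.separated
  F := structureModule D.C
  quasicoherent := isQuasicoherent_structureModule
  finiteType := isFiniteType_structureModule
  separatedF U m h := D.separated U m fun n V => by
    exact (Ideal.mul_le_left : D.p.ker.ideal V.1 ^ n * ⊤ ≤ _) (h n V)
  Φ W := (completionStructureEquiv D.p.ker W).trans
    (LinearEquiv.funUnique (Fin 1) (completionRing D.p.ker W) (completionRing D.p.ker W)).symm
  Φ_res _ _ _ := rfl

lemma localExpansionF_structureDatum_iff {U : S.Opens} (f : Γ(D.C, D.punctured U))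
    (g : LaurentSeries Γ(S, U)) (V : AffIn (D.π ⁻¹ᵁ U)) :
    D.structureDatum.LocalExpansionF f (fun _ => g) V ↔ D.LocalExpansion f g V := by
  constructor
  · rintro ⟨n, a, b, hb, h1, h2⟩
    exact ⟨n, a, b, hb, h1, h2 0⟩
  · rintro ⟨n, a, b, hb, h1, h2⟩
    exact ⟨n, a, b, hb, h1, fun _ => h2⟩

lemma mem_sectionsW_structureDatum_iff {U : S.Opens} (g : LaurentSeries Γ(S, U)) :
    (fun _ => g) ∈ D.structureDatum.sectionsW U ↔ g ∈ D.sectionsA U :=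
  exists_congr fun f => forall₂_congr fun _ _ => exists_congr fun V =>
    and_congr_right fun _ => D.localExpansionF_structureDatum_iff f g V

end GeometricDatum

/-! ### The comparison isomorphism for the structure sheaf -/

namespace GeometricDatum

variable {S : Scheme.{u}} {r : ℕ} {D : GeometricDatum S r} {T : S.Modules}

namespace Presentation

/-- The morphism from Laurent series to `T`, for the datum of the structure sheaf. -/
def laurentHomOne (K : D.structureDatum.Presentation T) :
    laurent S ⟶ (Scheme.Modules.toPresheafOfModules S).obj T where
  app U := ModuleCat.ofHom
    { toFun := fun g => K.ofLaurent (U := U.unop) fun _ => g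
      map_add' := fun g g' => (K.matches_ofLaurent _).unique
        ((K.matches_ofLaurent fun _ => g).add (K.matches_ofLaurent fun _ => g'))
      map_smul' := fun c g =>
        (K.matches_ofLaurent _).unique ((K.matches_ofLaurent fun _ => g).smul c) }
  naturality {U U'} h := by
    ext g
    exact (K.matches_ofLaurent _).unique ((K.matches_ofLaurent fun _ => g).restrict h.unop.le)

theorem nonempty_iso_one (K : D.structureDatum.Presentation T) :
    Nonempty (quotientSheaf (laurent S) (D.schurA ⊔ powerSeriesSub S) ≅ T) := by
  refine nonempty_quotientSheaf_iso K.laurentHomOne (fun U g hg => ?_) (fun U g hg s hs => ?_)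
    fun U τ s hs => ?_
  · obtain ⟨g₁, hg₁, g₂, hg₂, rfl⟩ := Submodule.mem_sup.mp hg
    refine (map_add _ _ _).trans ?_
    have e₁ := ofLaurent_eq_zero_of_mem_sectionsW K
      ((D.mem_sectionsW_structureDatum_iff g₁).mpr hg₁)
    have e₂ := ofLaurent_eq_zero_of_mem K (g := fun _ => g₂) fun _ => hg₂
    exact (congrArg₂ (· + ·) e₁ e₂).trans (add_zero _)
  · obtain ⟨U', h, hs', g₁, hg₁, g₂, hg₂, e⟩ :=
      exists_mem_of_ofLaurent_eq_zero (K := K) (g := fun _ => g) hg hs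
    refine ⟨U', h, hs', ?_⟩
    -- A vector indexed by `Fin 1` is the constant function at its single component.
    have hg₁' : g₁ 0 ∈ D.sectionsA U' := (D.mem_sectionsW_structureDatum_iff _).mp (by
      convert hg₁ using 1
      exact funext fun i => congrArg g₁ (Subsingleton.elim _ _))
    have e' : laurentMap (res h) g ∈ D.sectionsA U' ⊔ powerSeriesIn _ :=
      Submodule.mem_sup.mpr ⟨g₁ 0, hg₁', g₂ 0, hg₂ 0, (congrFun e 0).symm⟩
    exact e'
  · obtain ⟨U', h, hs', g, hg⟩ := K.exists_ofLaurent_eq τ hs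
    refine ⟨U', h, hs', g 0, Eq.trans ?_ hg⟩
    exact congrArg K.ofLaurent (funext fun i => congrArg g (Subsingleton.elim _ _))

end Presentation

end GeometricDatum

end
end Krichever

theorem mainTheorem6 (S : Scheme.{u}) [IsLocallyNoetherian S] (r : ℕ)
    (D : Krichever.GeometricDatum S r) :
    Nonempty (Krichever.quotientSheaf (Krichever.laurent S)
        (D.schurA ⊔ Krichever.powerSeriesSub S) ≅
      (Krichever.higherDirectImage D.π 1).obj (Krichever.structureModule D.C)) ∧
    Nonempty (Krichever.quotientSheaf (Krichever.laurentPow S r)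
        (D.schurW ⊔ Krichever.powerSeriesPowSub S r) ≅
      (Krichever.higherDirectImage D.π 1).obj D.F) := by
  obtain ⟨K₁⟩ := D.structureDatum.nonempty_presentation
  obtain ⟨K⟩ := D.nonempty_presentation
  exact ⟨K₁.nonempty_iso_one, K.nonempty_iso⟩
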